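/- Let $M$ be a closed (compact, connected, without boundary, not necessarily orientable) surface with a smooth Riemannian metric, and let $\alpha$ be a simple closed geodesic in $M$, i.e. a geodesic $\alpha:\mathbb R\to M$ that is periodic of some period $l>0$ and injective on $[0,l)$; write $\alpha$ also for its image. For a nonconstant geodesic $\beta:\mathbb R\to M$ issued orthogonally from $\alpha$ (that is, $\beta(0)=\alpha(t)$ and $\beta'(0)\perp\alpha'(t)$ for some $t$), the cut point of $\alpha$ along $\beta$ is the first point $\beta(s)$, $s\ge 0$, such that for every $r>s$ the length of the arc of $\beta$ between $\beta(0)$ and $\beta(r)$ is different from the distance $d(\beta(r),\alpha)$. The cut locus $\mathrm{Cut}(\alpha)$ is the set of all the cut points of $\alpha$ along all geodesics issued orthogonally from $\alpha$. Then $\mathrm{Cut}(\alpha)\subset M\setminus\alpha$, and $\mathrm{Cut}(\alpha)$ is a (strong) deformation retract of $M\setminus\alpha$: there is a continuous map $F:[0,1]\times(M\setminus\alpha)\to M\setminus\alpha$ with $F(0,x)=x$ and $F(1,x)\in\mathrm{Cut}(\alpha)$ for all $x\in M\setminus\alpha$, and $F(t,y)=y$ for all $y\in\mathrm{Cut}(\alpha)$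 and $t\in[0,1]$. Moreover, $F$ can be chosen to slide points along the minimizing geodesics orthogonal to $\alpha$: for every $x\in M\setminus(\alpha\cup\mathrm{Cut}(\alpha))$, with $d=d(x,\alpha)$, there is a unique unit speed geodesic $\gamma:\mathbb R\to M$ with $\gamma(0)\in\alpha$ and $\gamma(d)=x$; this $\gamma$ is issued orthogonally from $\alpha$, the cut point of $\alpha$ along $\gamma$ is $\gamma(c)$ for some $c>d$, and $$F(t,x)=\gamma\bigl((1-t)d+tc\bigr)\qquad\text{for all } t\in[0,1].$$ -/

import Mathlib

open Set Manifold Bundle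
open scoped ContDiff unitInterval

-- Otherwise `TopCat.of.chartedSpace` is found for plain vector spaces too, in place of the
-- (definitionally equal) `chartedSpaceSelf`.
attribute [-instance] TopCat.of.chartedSpace

/-- The model plane of a surface. -/
abbrev Plane : Type := EuclideanSpace ℝ (Fin 2)

noncomputable section SurfaceGeodesics

variable {M : Type*} [MetricSpace M] [ChartedSpace Plane M] [IsManifold (𝓡 2) ∞ M]
  [RiemannianBundle (fun x : M => TangentSpace (𝓡 2) x)]

/-- The velocity of a curve, as a point of the tangent bundle. -/
def velocity (γ : ℝ → M) (t : ℝ) : TangentBundle (𝓡 2) M :=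
  ⟨γ t, mfderiv 𝓘(ℝ, ℝ) (𝓡 2) γ t (1 : ℝ)⟩

/-- The Riemannian metric in the chart at `x₀`: `g_z(u, v)` at the point of coordinates `z`, for
coordinate vectors `u` and `v`. -/
def chartMetric (x₀ : M) (z u v : Plane) : ℝ :=
  inner ℝ (mfderiv 𝓘(ℝ, Plane) (𝓡 2) (extChartAt (𝓡 2) x₀).symm z u :
      TangentSpace (𝓡 2) ((extChartAt (𝓡 2) x₀).symm z))
    (mfderiv 𝓘(ℝ, Plane) (𝓡 2) (extChartAt (𝓡 2) x₀).symm z v)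

/-- The Christoffel symbols of the first kind in the chart at `x₀`:
`½ (∂_u g(v, w) + ∂_v g(u, w) - ∂_w g(u, v))`, that is `g(∇_u v, w)` for the Levi-Civita
connection `∇` and constant coordinate vector fields `u`, `v`, `w`. -/
def chartChristoffel (x₀ : M) (z u v w : Plane) : ℝ :=
  (fderiv ℝ (fun y => chartMetric x₀ y v w) z u + fderiv ℝ (fun y => chartMetric x₀ y u w) z v
    - fderiv ℝ (fun y => chartMetric x₀ y u v) z w) / 2

/-- Complete geodesics: smooth curves `γ : ℝ → M` with vanishing covariant acceleration
`∇_{γ'} γ' = 0`. In the coordinates `c` of `γ`, this says `g(c'', w) + g(Γ(c', c'), w) = 0` for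
every vector `w`. Constant curves are included. -/
def IsGeodesic (γ : ℝ → M) : Prop :=
  ContMDiff 𝓘(ℝ, ℝ) (𝓡 2) ∞ γ ∧
    ∀ (x₀ : M) (t : ℝ), γ t ∈ (chartAt Plane x₀).source →
      let c : ℝ → Plane := fun s => extChartAt (𝓡 2) x₀ (γ s)
      ∀ w : Plane, chartMetric x₀ (c t) (deriv (deriv c) t) w
        + chartChristoffel x₀ (c t) (deriv c t) (deriv c t) w = 0

/-- A simple closed geodesic `α` of period `l`: a geodesic that closes up smoothly after time `l`
and has no other self-intersection (so it is not constant). -/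
structure IsSimpleClosedGeodesic (α : ℝ → M) (l : ℝ) : Prop where
  geodesic : IsGeodesic α
  pos : 0 < l
  periodic : Function.Periodic α l
  injOn : InjOn α (Ico 0 l)

/-- `β` is a nonconstant geodesic whose initial velocity is a vector `v` at some `α t`,
normal to `α`. -/
def IssuesOrthogonally (α β : ℝ → M) : Prop :=
  IsGeodesic β ∧ ∃ (t : ℝ) (v : TangentSpace (𝓡 2) (α t)),
    v ≠ 0 ∧ inner ℝ v (mfderiv 𝓘(ℝ, ℝ) (𝓡 2) α t (1 : ℝ) : TangentSpace (𝓡 2) (α t)) = 0 ∧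
      velocity β 0 = ⟨α t, v⟩

/-- `s` is the first parameter such that, for every `r > s`, the length of the arc of `β` between
`β 0` and `β r` no longer agrees with the distance from `β r` to `A`. -/
def IsCutTime (A : Set M) (β : ℝ → M) (s : ℝ) : Prop :=
  IsLeast {s : ℝ | 0 ≤ s ∧
    ∀ r : ℝ, s < r → pathELength (𝓡 2) β 0 r ≠ Metric.infEDist (β r) A} s

/-- The cut locus of `α`: the cut points of `α` along all geodesics issued orthogonally
from `α`. -/
def cutLocus (α : ℝ → M) : Set M :=
  {q | ∃ (β : ℝ → M) (s : ℝ), IssuesOrthogonally α β ∧ IsCutTime (range α) β s ∧ q = β s}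

/-- `γ` is a unit speed geodesic that starts on `A` and reaches `x` at time `dist(x, A)`. -/
def IsMinimizingFromTo (A : Set M) (γ : ℝ → M) (x : M) : Prop :=
  IsGeodesic γ ∧
    (∀ t, ‖(mfderiv 𝓘(ℝ, ℝ) (𝓡 2) γ t (1 : ℝ) : TangentSpace (𝓡 2) (γ t))‖ = 1) ∧
    γ 0 ∈ A ∧ γ (Metric.infDist x A) = x

end SurfaceGeodesics

/-! For a unit speed geodesic `γ` issued orthogonally from `α`, the times `r ≥ 0` with `d(γ(r), α) =
r` form an interval `[0, c(γ)]`, because the distance to `α` is 1-Lipschitz, and `γ(c(γ))` is the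
cut point. Every point `x` is reached by such a geodesic at time `d(x, α)`: minimizing geodesics
exist by Hopf-Rinow (`exists_minimizing`), and the first variation of length makes them orthogonal
to `α` (`isUnitNormal_of_infDist_eq`). If `x` lies off `α` and before the cut point of one of them,
it is the only one: another one followed up to `x`, then the first one continued, would be a
minimizing path with a corner (`velocity_eq_of_dist_ge`, `eq_of_lt_cutTime`). Hence sliding `x`
along a minimizer to the cut point is well defined, and it fixes the cut locus.

Continuity of the slide follows from compactness of the unit tangent vectors once the cut time
depends continuously on the geodesic (`tendsto_cutTime`). Limits of distance realizing arcs realize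
the distance, so limits of cut times are not larger than the cut time of the limit. For the
converse, suppose that `γₙ → γ₀` and `tₙ → s < c(γ₀)`, but that `γₙ` no longer minimizes at time
`tₙ`. Minimizers to `γₙ(tₙ)` subconverge to a minimizer to `γ₀(s)`, which is `γ₀` by uniqueness when
`s > 0`. Then the normal exponential map takes equal values at two nearby parameters with different
times, contradicting its local injectivity at `(θ₀, s)` (`eventually_eq_of_velocityTendsto`). The
same argument at `s = 0`, where the opposite normal needs a separate treatment, shows that cut times
are positive, so the cut locus misses `α`.

Local injectivity means that there is no focal point before the cut point
(`injective_fderiv_normalExp`). This is proved without Jacobi fields or second variation. At `p =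
γ₀(s)` the distance to `α` is squeezed between functions with the same linear part and quadratic
errors, from below because `γ₀` still minimizes slightly past `s`; so the data of minimizers depend
in a Lipschitz way on their end points near `p` (`exists_lipschitz_minimizing`). If the differential
missed a direction `w`, the parameters of minimizers to the points `p + h w` would be `O(h)` away
from `(θ₀, s)`, while the component of their images outside the range of the differential is both
exactly `h` and `o(h)`.

The Riemannian background is developed from the geodesic equation in charts: a flow that is `C¹` in
the initial data, completeness, the first variation with uniform quadratic error, and local
minimality of geodesics by a direct length estimate (`MetricBounds.geodesic_le_length`). -/

section SurfaceTheory

open Filter Topology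

set_option maxSynthPendingDepth 3
set_option linter.unusedSectionVars false
set_option synthInstance.maxHeartbeats 100000

/-! ### The Riemannian metric in coordinates. -/

section ChartWrappers

variable {M : Type*} [MetricSpace M] [ChartedSpace Plane M]
  [RiemannianBundle (fun x : M => TangentSpace (𝓡 2) x)]

/-- The differential of the inverse chart at `x₀`, as a map from the model plane. -/
noncomputable def chartSymmDeriv (x₀ : M) (z : Plane) :
    Plane →L[ℝ] TangentSpace (𝓡 2) ((extChartAt (𝓡 2) x₀).symm z) :=
  mfderiv 𝓘(ℝ, Plane) (𝓡 2) (extChartAt (𝓡 2) x₀).symm z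

theorem chartMetric_eq_inner (x₀ : M) (z u v : Plane) :
    chartMetric x₀ z u v = inner ℝ (chartSymmDeriv x₀ z u) (chartSymmDeriv x₀ z v) := rfl

theorem chartMetric_symm (x₀ : M) (z u v : Plane) : chartMetric x₀ z u v = chartMetric x₀ z v u :=
  real_inner_comm _ _

/-- The metric in the chart at `x₀`, as a bilinear form on coordinate vectors. -/
noncomputable def metricForm (x₀ : M) (z : Plane) : Plane →L[ℝ] Plane →L[ℝ] ℝ :=
  LinearMap.toContinuousLinearMap
    ((LinearMap.toContinuousLinearMap : (Plane →ₗ[ℝ] ℝ) ≃ₗ[ℝ] (Plane →L[ℝ] ℝ)).toLinearMap ∘ₗ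
      LinearMap.mk₂ ℝ (chartMetric x₀ z)
        (fun u u' v => by
          simp only [chartMetric_eq_inner, map_add]; exact inner_add_left _ _ _)
        (fun a u v => by
          simp only [chartMetric_eq_inner, map_smul]; exact real_inner_smul_left _ _ _)
        (fun u v v' => by
          simp only [chartMetric_eq_inner, map_add]; exact inner_add_right _ _ _)
        (fun a u v => by
          simp only [chartMetric_eq_inner, map_smul]; exact real_inner_smul_right _ _ _))

theorem metricForm_apply (x₀ : M) (z u v : Plane) : metricForm x₀ z u v = chartMetric x₀ z u v := rfl

variable [IsManifold (𝓡 2) ∞ M]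

/-- The inverse chart carries a constant coordinate field to a smooth field, by smoothness of its
tangent map, and the bundle metric of two smooth fields is smooth. -/
theorem contDiffOn_chartMetric
    [IsContMDiffRiemannianBundle (𝓡 2) ∞ Plane (fun x : M => TangentSpace (𝓡 2) x)] (x₀ : M) (u v : Plane) :
    ContDiffOn ℝ ∞ (fun z => chartMetric x₀ z u v) (extChartAt (𝓡 2) x₀).target := by
  have key : ∀ u : Plane, ContMDiffOn 𝓘(ℝ, Plane) ((𝓡 2).prod 𝓘(ℝ, Plane)) ∞ (fun z : Plane =>
      (⟨(extChartAt (𝓡 2) x₀).symm z, mfderiv 𝓘(ℝ, Plane) (𝓡 2) (extChartAt (𝓡 2) x₀).symm z u⟩ :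
        TangentBundle (𝓡 2) M)) (extChartAt (𝓡 2) x₀).target := by
    intro u
    have h1 : ContMDiffOn 𝓘(ℝ, Plane) (𝓡 2) ∞ (extChartAt (𝓡 2) x₀).symm
      (extChartAt (𝓡 2) x₀).target := contMDiffOn_extChartAt_symm x₀
    have h2 := h1.contMDiffOn_tangentMapWithin (m := ∞) (by simp) ((isOpen_extChartAt_target x₀).uniqueMDiffOn)
    have h3 : ContMDiffOn 𝓘(ℝ, Plane) 𝓘(ℝ, Plane).tangent ∞ (fun z : Plane => (⟨z, u⟩ : TangentBundle 𝓘(ℝ, Plane) Plane)) (extChartAt (𝓡 2) x₀).target := by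
      exact contMDiffOn_vectorSpace_iff_contDiffOn.2 contDiffOn_const
    refine (h2.comp h3 ?_).congr ?_
    · intro z hz; exact hz
    · intro z hz
      simp only [Function.comp, tangentMapWithin]
      rw [mfderivWithin_of_isOpen (isOpen_extChartAt_target x₀) hz]
  rw [← contMDiffOn_iff_contDiffOn]
  exact (key u).inner_bundle (key v)

/-- The coordinates in the chart at `x₀` of a tangent vector at `x`. -/
noncomputable def chartCoord (x₀ x : M) : TangentSpace (𝓡 2) x →L[ℝ] Plane :=
  mfderiv (𝓡 2) 𝓘(ℝ, Plane) (extChartAt (𝓡 2) x₀) x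

theorem chartCoord_chartSymmDeriv (x₀ : M) {z : Plane}
    (hz : z ∈ (extChartAt (𝓡 2) x₀).target) (u : Plane) :
    chartCoord x₀ ((extChartAt (𝓡 2) x₀).symm z) (chartSymmDeriv x₀ z u) = u := by
  have h := mfderiv_extChartAt_comp_mfderivWithin_extChartAt_symm hz
  have hr : range (𝓡 2) = (univ : Set Plane) := by simp
  rw [hr, mfderivWithin_univ] at h
  exact congr($h u)

theorem chartSymmDeriv_chartCoord (x₀ : M) {z : Plane}
    (hz : z ∈ (extChartAt (𝓡 2) x₀).target)
    (v : TangentSpace (𝓡 2) ((extChartAt (𝓡 2) x₀).symm z)) :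
    chartSymmDeriv x₀ z (chartCoord x₀ ((extChartAt (𝓡 2) x₀).symm z) v) = v := by
  have h := mfderivWithin_extChartAt_symm_comp_mfderiv_extChartAt hz
  have hr : range (𝓡 2) = (univ : Set Plane) := by simp
  rw [hr, mfderivWithin_univ] at h
  exact congr($h v)

theorem chartMetric_pos (x₀ : M) {z : Plane} (hz : z ∈ (extChartAt (𝓡 2) x₀).target)
    {u : Plane} (hu : u ≠ 0) : 0 < chartMetric x₀ z u u := by
  rw [chartMetric_eq_inner, real_inner_self_pos]
  intro h
  apply hu
  rw [← chartCoord_chartSymmDeriv x₀ hz u, h]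
  exact map_zero _

theorem chartMetric_chartCoord {x₀ x : M} (hx : x ∈ (chartAt Plane x₀).source)
    (v w : TangentSpace (𝓡 2) x) :
    chartMetric x₀ (extChartAt (𝓡 2) x₀ x) (chartCoord x₀ x v) (chartCoord x₀ x w)
      = inner ℝ v w := by
  obtain ⟨z, hz, rfl⟩ : ∃ z ∈ (extChartAt (𝓡 2) x₀).target, (extChartAt (𝓡 2) x₀).symm z = x :=
    ⟨extChartAt (𝓡 2) x₀ x, (extChartAt (𝓡 2) x₀).map_source (by rwa [extChartAt_source]),
      (extChartAt (𝓡 2) x₀).left_inv (by rwa [extChartAt_source])⟩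
  rw [(extChartAt (𝓡 2) x₀).right_inv hz, chartMetric_eq_inner]
  rw [chartSymmDeriv_chartCoord x₀ hz, chartSymmDeriv_chartCoord x₀ hz]

theorem chartCoord_injective {x₀ x : M} (hx : x ∈ (chartAt Plane x₀).source) :
    Function.Injective (chartCoord x₀ x) := by
  rw [injective_iff_map_eq_zero]
  intro v hv
  have := chartMetric_chartCoord hx v v
  rw [hv, chartMetric_eq_inner, map_zero, inner_zero_left] at this
  exact inner_self_eq_zero.1 this.symm

theorem chartCoord_surjective {x₀ x : M} (hx : x ∈ (chartAt Plane x₀).source) :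
    Function.Surjective (chartCoord x₀ x) := by
  obtain ⟨z, hz, rfl⟩ : ∃ z ∈ (extChartAt (𝓡 2) x₀).target, (extChartAt (𝓡 2) x₀).symm z = x :=
    ⟨extChartAt (𝓡 2) x₀ x, (extChartAt (𝓡 2) x₀).map_source (by rwa [extChartAt_source]),
      (extChartAt (𝓡 2) x₀).left_inv (by rwa [extChartAt_source])⟩
  exact fun u => ⟨_, chartCoord_chartSymmDeriv x₀ hz u⟩

theorem hasDerivAt_extChartAt_comp {x₀ : M} {γ : ℝ → M} {t : ℝ}
    (hγ : MDifferentiableAt 𝓘(ℝ, ℝ) (𝓡 2) γ t) (ht : γ t ∈ (chartAt Plane x₀).source) :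
    HasDerivAt (fun s => extChartAt (𝓡 2) x₀ (γ s))
      (chartCoord x₀ (γ t) (mfderiv 𝓘(ℝ, ℝ) (𝓡 2) γ t (1 : ℝ))) t := by
  have h1 : MDifferentiableAt (𝓡 2) 𝓘(ℝ, Plane) (extChartAt (𝓡 2) x₀) (γ t) :=
    mdifferentiableAt_extChartAt ht
  have h2 : HasFDerivAt (fun s => extChartAt (𝓡 2) x₀ (γ s))
      (show ℝ →L[ℝ] Plane from (chartCoord x₀ (γ t)).comp (mfderiv 𝓘(ℝ, ℝ) (𝓡 2) γ t)) t :=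
    (h1.hasMFDerivAt.comp t hγ.hasMFDerivAt).hasFDerivAt
  exact h2.hasDerivAt

theorem norm_mfderiv_sq {x₀ : M} {γ : ℝ → M} {t : ℝ}
    (hγ : MDifferentiableAt 𝓘(ℝ, ℝ) (𝓡 2) γ t) (ht : γ t ∈ (chartAt Plane x₀).source) :
    ‖(mfderiv 𝓘(ℝ, ℝ) (𝓡 2) γ t (1 : ℝ) : TangentSpace (𝓡 2) (γ t))‖ ^ 2 =
      chartMetric x₀ (extChartAt (𝓡 2) x₀ (γ t)) (deriv (fun s => extChartAt (𝓡 2) x₀ (γ s)) t)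
        (deriv (fun s => extChartAt (𝓡 2) x₀ (γ s)) t) := by
  rw [(hasDerivAt_extChartAt_comp hγ ht).deriv, chartMetric_chartCoord ht, real_inner_self_eq_norm_sq]

end ChartWrappers

/-! ### Metrics and sprays on open subsets of a vector space. -/

section FlatMetric

attribute [-instance]
  Bundle.instNormedAddCommGroupOfRiemannianBundleOfIsTopologicalAddGroupOfContinuousConstSMulReal
  Bundle.instInnerProductSpaceReal

variable {E : Type*} [NormedAddCommGroup E] [NormedSpace ℝ E]

/-- `G` is a smooth Riemannian metric on the open subset `U` of a vector space. -/
structure IsSmoothMetricOn (G : E → E →L[ℝ] E →L[ℝ] ℝ) (U : Set E) : Prop where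
  isOpen : IsOpen U
  contDiffOn : ContDiffOn ℝ ∞ G U
  symm : ∀ z ∈ U, ∀ u v, G z u v = G z v u
  pos : ∀ z ∈ U, ∀ u, u ≠ 0 → 0 < G z u u

/-- The covector `w ↦ D_u g(u, w) - ½ D_w g(u, u)`, which is `g(Γ(u, u), ·)`. -/
noncomputable def christoffelForm (G : E → E →L[ℝ] E →L[ℝ] ℝ) (z u : E) : E →L[ℝ] ℝ :=
  fderiv ℝ G z u u - (1 / 2 : ℝ) • ((fderiv ℝ G z).flip u).flip u

/-- The acceleration `-Γ(u, u)` of a geodesic with velocity `u` at `z`. -/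
noncomputable def spray (G : E → E →L[ℝ] E →L[ℝ] ℝ) (z u : E) : E :=
  (G z).inverse (-christoffelForm G z u)

/-- The geodesic vector field on pairs of a position and a velocity. -/
noncomputable def geodesicField (G : E → E →L[ℝ] E →L[ℝ] ℝ) (y : E × E) : E × E :=
  (y.2, spray G y.1 y.2)

theorem christoffelForm_apply (G : E → E →L[ℝ] E →L[ℝ] ℝ) (z u w : E) :
    christoffelForm G z u w = fderiv ℝ G z u u w - (1 / 2 : ℝ) * fderiv ℝ G z w u u := rfl

namespace IsSmoothMetricOn

variable {G : E → E →L[ℝ] E →L[ℝ] ℝ} {U : Set E} (hG : IsSmoothMetricOn G U)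
include hG

theorem contDiffAt {z : E} (hz : z ∈ U) : ContDiffAt ℝ ∞ G z :=
  hG.contDiffOn.contDiffAt (hG.isOpen.mem_nhds hz)

theorem differentiableAt {z : E} (hz : z ∈ U) : DifferentiableAt ℝ G z :=
  (hG.contDiffAt hz).differentiableAt (by simp)

theorem nonneg {z : E} (hz : z ∈ U) (u : E) : 0 ≤ G z u u := by
  rcases eq_or_ne u 0 with rfl | hu
  · simp
  · exact (hG.pos z hz u hu).le

variable [FiniteDimensional ℝ E]

/-- Positivity makes `G z` injective and the dual has the same dimension. Invertibility is what
makes the spray well defined and smooth. -/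
theorem exists_equiv {z : E} (hz : z ∈ U) :
    ∃ e : E ≃L[ℝ] (E →L[ℝ] ℝ), (e : E →L[ℝ] E →L[ℝ] ℝ) = G z := by
  have hinj : Function.Injective (G z) := by
    rw [injective_iff_map_eq_zero]
    intro u hu
    by_contra h
    have := hG.pos z hz u h
    rw [hu] at this
    simp at this
  have hdim : Module.finrank ℝ E = Module.finrank ℝ (E →L[ℝ] ℝ) := by
    rw [← (LinearMap.toContinuousLinearMap : (E →ₗ[ℝ] ℝ) ≃ₗ[ℝ] (E →L[ℝ] ℝ)).finrank_eq]
    exact (Subspace.dual_finrank_eq (K := ℝ) (V := E)).symm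
  let e := LinearEquiv.ofInjectiveOfFinrankEq (G z).toLinearMap hinj hdim
  exact ⟨e.toContinuousLinearEquiv, by ext; rfl⟩

theorem apply_spray {z : E} (hz : z ∈ U) (u : E) :
    G z (spray G z u) = -christoffelForm G z u := by
  obtain ⟨e, he⟩ := hG.exists_equiv hz
  unfold spray
  rw [← he, ContinuousLinearMap.inverse_equiv]
  exact e.apply_symm_apply _

theorem eq_spray {z u a : E} (hz : z ∈ U) (h : ∀ w, G z a w + christoffelForm G z u w = 0) :
    a = spray G z u := by
  obtain ⟨e, he⟩ := hG.exists_equiv hz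
  apply e.injective
  have h1 : e a = G z a := congr($he a)
  have h2 : e (spray G z u) = G z (spray G z u) := congr($he _)
  rw [h1, h2, hG.apply_spray hz]
  ext w
  have := h w
  simp only [neg_apply]
  linarith

/-- Quadratic homogeneity is what lets affine reparametrizations of geodesics be geodesics. -/
theorem spray_smul {z : E} (hz : z ∈ U) (k : ℝ) (u : E) :
    spray G z (k • u) = k ^ 2 • spray G z u := by
  symm
  apply hG.eq_spray hz
  intro w
  have := congr($(hG.apply_spray hz u) w)
  simp only [map_smul, smul_apply, christoffelForm_apply, smul_eq_mul,
    neg_apply] at this ⊢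
  rw [this]
  ring

/-- Inversion of linear maps is smooth near an invertible one; the covector is built from `G` and
its first derivative. -/
theorem contDiffOn_spray :
    ContDiffOn ℝ ∞ (fun y : E × E => spray G y.1 y.2) (U ×ˢ univ) := by
  have : CompleteSpace E := FiniteDimensional.complete ℝ E
  rintro ⟨z, u⟩ ⟨hz, -⟩
  apply ContDiffAt.contDiffWithinAt
  have h1 : ContDiffAt ℝ ∞ (fun y : E × E => G y.1) (z, u) :=
    (hG.contDiffAt hz).comp (z, u) contDiffAt_fst
  have h2 : ContDiffAt ℝ ∞ (fun y : E × E => fderiv ℝ G y.1) (z, u) :=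
    ((hG.contDiffAt hz).fderiv_right (m := ∞) (by simp)).comp (z, u) contDiffAt_fst
  have h3 : ContDiffAt ℝ ∞ (fun y : E × E => y.2) (z, u) := contDiffAt_snd
  have h4 : ContDiffAt ℝ ∞ (fun y : E × E => (G y.1).inverse) (z, u) := by
    obtain ⟨e, he⟩ := hG.exists_equiv hz
    have := contDiffAt_map_inverse (n := ∞) e
    rw [he] at this
    exact this.comp (z, u) h1
  have h5 : ContDiffAt ℝ ∞ (fun y : E × E => christoffelForm G y.1 y.2) (z, u) := by
    unfold christoffelForm
    have h6 : ContDiffAt ℝ ∞ (fun y : E × E => (fderiv ℝ G y.1).flip) (z, u) :=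
      (ContinuousLinearMap.flipₗᵢ ℝ E E (E →L[ℝ] ℝ)).contDiff.contDiffAt.comp (z, u) h2
    have h7 : ContDiffAt ℝ ∞ (fun y : E × E => ((fderiv ℝ G y.1).flip y.2).flip) (z, u) :=
      (ContinuousLinearMap.flipₗᵢ ℝ E E ℝ).contDiff.contDiffAt.comp (z, u) (h6.clm_apply h3)
    exact ((h2.clm_apply h3).clm_apply h3).sub ((h7.clm_apply h3).const_smul _)
  exact h4.clm_apply h5.neg

theorem contDiffOn_geodesicField :
    ContDiffOn ℝ ∞ (geodesicField G) (U ×ˢ univ) :=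
  contDiffOn_snd.prodMk hG.contDiffOn_spray

/-- The first variation formula along a reparametrized solution of the geodesic equation. -/
theorem hasDerivAt_metric_velocity {c v η : ℝ → E} {η' : E} {t k : ℝ} (hz : c t ∈ U)
    (hc : HasDerivAt c (k • v t) t) (hv : HasDerivAt v (k • spray G (c t) (v t)) t)
    (hη : HasDerivAt η η' t) :
    HasDerivAt (fun s => G (c s) (v s) (η s))
      (k * (1 / 2 * fderiv ℝ G (c t) (η t) (v t) (v t)) + G (c t) (v t) η') t := by
  have h1 : HasDerivAt (fun s => G (c s)) (fderiv ℝ G (c t) (k • v t)) t :=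
    (hG.differentiableAt hz).hasFDerivAt.comp_hasDerivAt t hc
  have h2 := (h1.clm_apply hv).clm_apply hη
  refine h2.congr_deriv ?_
  -- The geodesic equation replaces the `D_v g(v, η)` produced by the chain rule with half of `D_η
  -- g(v, v)`.
  have := congr($(hG.apply_spray hz (v t)) (η t))
  simp only [neg_apply, christoffelForm_apply] at this
  simp only [add_apply, map_smul, smul_apply, smul_eq_mul]
  rw [this]
  ring

/-- Conservation of energy: in the first variation formula with the velocity itself as variation
field, the two terms cancel. -/
theorem hasDerivAt_speed_sq {c v : ℝ → E} {t : ℝ} (hz : c t ∈ U)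
    (hc : HasDerivAt c (v t) t) (hv : HasDerivAt v (spray G (c t) (v t)) t) :
    HasDerivAt (fun s => G (c s) (v s) (v s)) 0 t := by
  refine (hG.hasDerivAt_metric_velocity (k := 1) hz (by simpa using hc) (by simpa using hv)
    hv).congr_deriv ?_
  have := congr($(hG.apply_spray hz (v t)) (v t))
  rw [hG.symm _ hz (v t)]
  simp only [neg_apply, christoffelForm_apply] at this
  rw [this]
  ring

/-- The spray is natural under isometries. -/
theorem spray_of_isometry {G' : E → E →L[ℝ] E →L[ℝ] ℝ} {U' : Set E} (hG' : IsSmoothMetricOn G' U')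
    {ψ : E → E} {z : E} (hz : z ∈ U) (hz' : ψ z ∈ U') (hψ : ContDiffAt ℝ 2 ψ z)
    (hsurj : Function.Surjective (fderiv ℝ ψ z))
    (hiso : ∀ᶠ y in 𝓝 z, ∀ u v, G y u v = G' (ψ y) (fderiv ℝ ψ y u) (fderiv ℝ ψ y v)) (u : E) :
    fderiv ℝ (fderiv ℝ ψ) z u u + fderiv ℝ ψ z (spray G z u) = spray G' (ψ z) (fderiv ℝ ψ z u) := by
  apply hG'.eq_spray hz'
  intro w'
  obtain ⟨w, rfl⟩ := hsurj w'
  have hψ1 : HasFDerivAt ψ (fderiv ℝ ψ z) z := (hψ.differentiableAt (by simp)).hasFDerivAt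
  have hψ2 : HasFDerivAt (fderiv ℝ ψ) (fderiv ℝ (fderiv ℝ ψ) z) z :=
    ((hψ.fderiv_right (m := 1) (by norm_num)).differentiableAt (by simp)).hasFDerivAt
  have hsym : ∀ a b, fderiv ℝ (fderiv ℝ ψ) z a b = fderiv ℝ (fderiv ℝ ψ) z b a := fun a b =>
    (hψ.isSymmSndFDerivAt (by simp)).eq a b
  -- The isometry identity is differentiated along the line through `z` in direction `d`.
  have hG1 : ∀ a b d, fderiv ℝ G z d a b =
      fderiv ℝ G' (ψ z) (fderiv ℝ ψ z d) (fderiv ℝ ψ z a) (fderiv ℝ ψ z b)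
      + G' (ψ z) (fderiv ℝ (fderiv ℝ ψ) z d a) (fderiv ℝ ψ z b)
      + G' (ψ z) (fderiv ℝ ψ z a) (fderiv ℝ (fderiv ℝ ψ) z d b) := by
    intro a b d
    have hl : HasDerivAt (fun t : ℝ => z + t • d) d 0 := by
      simpa using ((hasDerivAt_id (0 : ℝ)).smul_const d).const_add z
    have hl0 : z + (0 : ℝ) • d = z := by simp
    have e1 : HasDerivAt (fun t : ℝ => G (z + t • d) a b) (fderiv ℝ G z d a b) 0 := by
      have h := (hG.differentiableAt hz).hasFDerivAt
      rw [← hl0] at h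
      have h := (h.comp_hasDerivAt (0 : ℝ) hl)
      rw [hl0] at h
      simpa using (h.clm_apply (hasDerivAt_const _ a)).clm_apply (hasDerivAt_const _ b)
    have e2 : ∀ a : E, HasDerivAt (fun t : ℝ => fderiv ℝ ψ (z + t • d) a)
        (fderiv ℝ (fderiv ℝ ψ) z d a) 0 := by
      intro a
      have h := hψ2
      rw [← hl0] at h
      have h := (h.comp_hasDerivAt (0 : ℝ) hl)
      rw [hl0] at h
      simpa using h.clm_apply (hasDerivAt_const _ a)
    have e3 : HasDerivAt (fun t : ℝ => G' (ψ (z + t • d)))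
        (fderiv ℝ G' (ψ z) (fderiv ℝ ψ z d)) 0 := by
      have h := (hG'.differentiableAt hz').hasFDerivAt.comp z hψ1
      rw [← hl0] at h
      have h := (h.comp_hasDerivAt (0 : ℝ) hl)
      rw [hl0] at h
      exact h
    have e4 := (e3.clm_apply (e2 a)).clm_apply (e2 b)
    have hev : (fun t : ℝ => G (z + t • d) a b) =ᶠ[𝓝 0] fun t =>
        G' (ψ (z + t • d)) (fderiv ℝ ψ (z + t • d) a) (fderiv ℝ ψ (z + t • d) b) := by
      have : Tendsto (fun t : ℝ => z + t • d) (𝓝 0) (𝓝 z) := by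
        have := hl.continuousAt.tendsto
        rwa [hl0] at this
      filter_upwards [this.eventually hiso] with t ht using ht a b
    have := e1.unique (e4.congr_of_eventuallyEq hev)
    rw [this]
    simp only [add_apply, hl0]
  have h1 := congr($(hG.apply_spray hz u) w)
  have h2 := hiso.self_of_nhds (spray G z u) w
  simp only [neg_apply, christoffelForm_apply, map_add, add_apply] at h1 ⊢
  -- In the combination defining the Christoffel covector, the terms with the mixed second
  -- derivative of `ψ` cancel by symmetry; only the one with `D²ψ(u, u)` survives.
  rw [hG1, hG1, h2, hsym w u, hG'.symm _ hz' (fderiv ℝ (fderiv ℝ ψ) z u w)] at h1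
  linarith

end IsSmoothMetricOn
end FlatMetric

/-! ### Uniform bounds for a metric on a compact convex set. -/

section FlatEstimates

attribute [-instance]
  Bundle.instNormedAddCommGroupOfRiemannianBundleOfIsTopologicalAddGroupOfContinuousConstSMulReal
  Bundle.instInnerProductSpaceReal

variable {E : Type*} [NormedAddCommGroup E] [NormedSpace ℝ E]

/-- Uniform bounds for a metric on a set of base points. -/
structure MetricBounds (G : E → E →L[ℝ] E →L[ℝ] ℝ) (K : Set E) (lam C : ℝ) : Prop where
  lam_pos : 0 < lam
  C_nonneg : 0 ≤ C
  lower : ∀ z ∈ K, ∀ u, lam * ‖u‖ ^ 2 ≤ G z u u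
  norm_le : ∀ z ∈ K, ‖G z‖ ≤ C
  sub_le : ∀ z ∈ K, ∀ y ∈ K, ‖G y - G z‖ ≤ C * ‖y - z‖
  taylor : ∀ z ∈ K, ∀ y ∈ K, ‖G y - G z - fderiv ℝ G z (y - z)‖ ≤ C * ‖y - z‖ ^ 2

/-- The lower bound is the minimum over `K` times the unit sphere, extended by homogeneity. The
others are mean value estimates with bounds on the first two derivatives of `G`, which is where
convexity of `K` enters. -/
theorem IsSmoothMetricOn.exists_metricBounds [FiniteDimensional ℝ E]
    {G : E → E →L[ℝ] E →L[ℝ] ℝ} {U K : Set E} (hG : IsSmoothMetricOn G U) (hK : IsCompact K)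
    (hconv : Convex ℝ K) (hKU : K ⊆ U) : ∃ lam C, MetricBounds G K lam C := by
  have : ProperSpace E := FiniteDimensional.proper_real E
  have hcont : ContinuousOn G K := hG.contDiffOn.continuousOn.mono hKU
  have hdcont : ContDiffOn ℝ ∞ (fderiv ℝ G) U :=
    hG.contDiffOn.fderiv_of_isOpen hG.isOpen (by simp)
  obtain ⟨lam, hlam, hlow⟩ : ∃ lam > 0, ∀ z ∈ K, ∀ u, lam * ‖u‖ ^ 2 ≤ G z u u := by
    have hS : IsCompact (K ×ˢ Metric.sphere (0 : E) 1) := hK.prod (isCompact_sphere 0 1)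
    have hf : ContinuousOn (fun p : E × E => G p.1 p.2 p.2) (K ×ˢ Metric.sphere (0 : E) 1) :=
      ((hcont.comp continuousOn_fst fun p hp => hp.1).clm_apply continuousOn_snd).clm_apply
        continuousOn_snd
    rcases (K ×ˢ Metric.sphere (0 : E) 1).eq_empty_or_nonempty with he | hne
    · refine ⟨1, one_pos, fun z hz u => ?_⟩
      rcases eq_or_ne u 0 with rfl | hu
      · simp
      · have : ((z, ‖u‖⁻¹ • u) : E × E) ∈ K ×ˢ Metric.sphere (0 : E) 1 := by
          refine ⟨hz, ?_⟩
          simp [norm_smul, hu]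
        rw [he] at this
        exact this.elim
    · obtain ⟨p, hp, hmin⟩ := hS.exists_isMinOn hne hf
      have hp2 : p.2 ≠ 0 := by
        intro h
        have := hp.2
        rw [h] at this
        simp at this
      refine ⟨G p.1 p.2 p.2, hG.pos _ (hKU hp.1) _ hp2, fun z hz u => ?_⟩
      rcases eq_or_ne u 0 with rfl | hu
      · simp
      · have h1 : ((z, ‖u‖⁻¹ • u) : E × E) ∈ K ×ˢ Metric.sphere (0 : E) 1 := by
          refine ⟨hz, ?_⟩
          simp [norm_smul, hu]
        have h2 : G p.1 p.2 p.2 ≤ G z (‖u‖⁻¹ • u) (‖u‖⁻¹ • u) := hmin h1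
        simp only [map_smul, smul_apply, smul_eq_mul] at h2
        have hu' : 0 < ‖u‖ := norm_pos_iff.2 hu
        calc G p.1 p.2 p.2 * ‖u‖ ^ 2 ≤ (‖u‖⁻¹ * (‖u‖⁻¹ * G z u u)) * ‖u‖ ^ 2 := by gcongr
          _ = G z u u := by field_simp
  obtain ⟨C₁, hC₁⟩ := hK.exists_bound_of_continuousOn hcont
  obtain ⟨C₂, hC₂⟩ := hK.exists_bound_of_continuousOn (hdcont.continuousOn.mono hKU)
  obtain ⟨C₃, hC₃⟩ := hK.exists_bound_of_continuousOn
    ((hdcont.fderiv_of_isOpen (m := 0) hG.isOpen (by simp)).continuousOn.mono hKU)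
  have hLip : ∀ z ∈ K, ∀ y ∈ K, ‖fderiv ℝ G y - fderiv ℝ G z‖ ≤ C₃ * ‖y - z‖ := fun z hz y hy =>
    hconv.norm_image_sub_le_of_norm_fderiv_le (𝕜 := ℝ)
      (fun x hx => (hdcont.contDiffAt (hG.isOpen.mem_nhds (hKU hx))).differentiableAt (by simp))
      hC₃ hz hy
  refine ⟨lam, max (max C₁ C₂) (max C₃ 0), hlam, by simp, hlow, fun z hz => (hC₁ z hz).trans ?_,
    fun z hz y hy => ?_, fun z hz y hy => ?_⟩
  · simp
  · refine (hconv.norm_image_sub_le_of_norm_fderiv_le (𝕜 := ℝ)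
      (fun x hx => hG.differentiableAt (hKU hx)) hC₂ hz hy).trans ?_
    gcongr
    simp
  · have hseg : segment ℝ z y ⊆ K := hconv.segment_subset hz hy
    have := (convex_segment z y).norm_image_sub_le_of_norm_hasFDerivWithin_le' (𝕜 := ℝ)
      (f := G) (f' := fun x => fderiv ℝ G x) (φ := fderiv ℝ G z) (C := max C₃ 0 * ‖y - z‖)
      (fun x hx => (hG.differentiableAt (hKU (hseg hx))).hasFDerivAt.hasFDerivWithinAt)
      (fun x hx => (hLip z hz x (hseg hx)).trans ?_) (left_mem_segment ℝ z y)
      (right_mem_segment ℝ z y)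
    · refine this.trans ?_
      rw [mul_assoc, ← sq]
      exact mul_le_mul_of_nonneg_right (le_max_right _ _) (sq_nonneg _)
    · gcongr
      · exact le_max_left _ _
      · obtain ⟨a, b, ha, hb, hab, rfl⟩ := hx
        have : a • z + b • y - z = b • (y - z) := by
          have : a = 1 - b := by linarith
          rw [this]; module
        rw [this, norm_smul, Real.norm_of_nonneg hb]
        exact mul_le_of_le_one_left (norm_nonneg _) (by linarith)

namespace MetricBounds

variable {G : E → E →L[ℝ] E →L[ℝ] ℝ} {K : Set E} {lam C : ℝ} (hB : MetricBounds G K lam C)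
include hB

theorem apply_le {z : E} (hz : z ∈ K) (u w : E) : |G z u w| ≤ C * ‖u‖ * ‖w‖ := by
  refine ((G z u).le_opNorm w).trans ?_
  gcongr
  exact ((G z).le_opNorm u).trans (by gcongr; exact hB.norm_le z hz)

theorem norm_le_of_unit {z u : E} (hz : z ∈ K) (hu : G z u u = 1) : ‖u‖ ≤ Real.sqrt lam⁻¹ := by
  apply Real.le_sqrt_of_sq_le
  have := hB.lower z hz u
  rw [hu] at this
  rw [inv_eq_one_div, le_div_iff₀ hB.lam_pos]
  linarith

/-- Second order expansion of `g_{z + η}(u + ζ, u + ζ)`. -/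
theorem expansion {z y : E} (hz : z ∈ K) (hy : y ∈ K) (hsymm : ∀ u w, G y u w = G y w u)
    (u ζ : E) :
    |G y (u + ζ) (u + ζ) - (G z u u + fderiv ℝ G z (y - z) u u + 2 * G z u ζ + G y ζ ζ)| ≤
      C * ‖y - z‖ ^ 2 * ‖u‖ ^ 2 + 2 * C * ‖y - z‖ * ‖u‖ * ‖ζ‖ := by
  have h1 : |(G y - G z - fderiv ℝ G z (y - z)) u u| ≤ C * ‖y - z‖ ^ 2 * ‖u‖ ^ 2 := by
    refine (((G y - G z - fderiv ℝ G z (y - z)) u).le_opNorm u).trans ?_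
    have := ((G y - G z - fderiv ℝ G z (y - z)).le_opNorm u).trans
      (mul_le_mul_of_nonneg_right (hB.taylor z hz y hy) (norm_nonneg _))
    calc _ ≤ (C * ‖y - z‖ ^ 2 * ‖u‖) * ‖u‖ := by gcongr
      _ = _ := by ring
  have h2 : |(G y - G z) u ζ| ≤ C * ‖y - z‖ * ‖u‖ * ‖ζ‖ := by
    refine (((G y - G z) u).le_opNorm ζ).trans ?_
    have := ((G y - G z).le_opNorm u).trans
      (mul_le_mul_of_nonneg_right (hB.sub_le z hz y hy) (norm_nonneg _))
    gcongr
  have h3 : G y (u + ζ) (u + ζ) - (G z u u + fderiv ℝ G z (y - z) u u + 2 * G z u ζ + G y ζ ζ)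
      = (G y - G z - fderiv ℝ G z (y - z)) u u + 2 * (G y - G z) u ζ := by
    simp only [map_add, add_apply, sub_apply]
    rw [hsymm ζ u]
    ring
  rw [h3]
  refine (abs_add_le _ _).trans ?_
  rw [abs_mul, abs_two]
  linarith

end MetricBounds
end FlatEstimates

/-! ### Length of curves near a geodesic. -/

section FlatVariation

attribute [-instance]
  Bundle.instNormedAddCommGroupOfRiemannianBundleOfIsTopologicalAddGroupOfContinuousConstSMulReal
  Bundle.instInnerProductSpaceReal

open MeasureTheory intervalIntegral

variable {E : Type*} [NormedAddCommGroup E] [NormedSpace ℝ E] [FiniteDimensional ℝ E]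
  {G : E → E →L[ℝ] E →L[ℝ] ℝ} {U K : Set E} {lam C : ℝ}

/-- Adding to a unit speed geodesic a field that grows linearly from `0` at time `a` to `ξ` at time
`a + r` yields a curve whose speed is at most the derivative of
`t ↦ t + g(v, η) + O(‖ξ‖²) t`. -/
theorem MetricBounds.speed_bump_le (hB : MetricBounds G K lam C) (hG : IsSmoothMetricOn G U)
    (hKU : K ⊆ U) {r : ℝ} (hr : 0 < r) {c v : ℝ → E} {a t : ℝ} {ξ : E} (hc : HasDerivAt c (v t) t)
    (hv : HasDerivAt v (spray G (c t) (v t)) t) (hct : c t ∈ K) (hunit : G (c t) (v t) (v t) = 1)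
    (ht : t ∈ Icc a (a + r)) (hb : c t + ((t - a) / r) • ξ ∈ K) :
    ∃ D, HasDerivAt (fun s => s + G (c s) (v s) (((s - a) / r) • ξ)
        + (C * (1 / lam + 2 * √lam⁻¹ / r + 1 / r ^ 2) / 2 * ‖ξ‖ ^ 2) * s) D t ∧
      √(G (c t + ((t - a) / r) • ξ) (v t + r⁻¹ • ξ) (v t + r⁻¹ • ξ)) ≤ D := by
  have hη : HasDerivAt (fun s => ((s - a) / r) • ξ) (r⁻¹ • ξ) t := by
    have h : HasDerivAt (fun s => (s - a) / r) (1 / r) t :=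
      ((hasDerivAt_id t).sub_const a).div_const r
    simpa using h.smul_const ξ
  refine ⟨_, ((hasDerivAt_id t).add (hG.hasDerivAt_metric_velocity (k := 1) (hKU hct)
    (by simpa using hc) (by simpa using hv) hη)).add ((hasDerivAt_id t).const_mul _), ?_⟩
  set η := ((t - a) / r) • ξ with hηdef
  have hV := hB.norm_le_of_unit hct hunit
  set V := √lam⁻¹ with hVdef
  have hV0 : 0 ≤ V := Real.sqrt_nonneg _
  have hV2 : V ^ 2 = 1 / lam := by rw [hVdef, Real.sq_sqrt (inv_nonneg.2 hB.lam_pos.le), one_div]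
  have hexp := (abs_le.1 (hB.expansion hct hb (hG.symm _ (hKU hb)) (v t) (r⁻¹ • ξ))).2
  have hηξ : ‖η‖ ≤ ‖ξ‖ := by
    rw [hηdef, norm_smul, Real.norm_of_nonneg (div_nonneg (by linarith [ht.1]) hr.le)]
    exact mul_le_of_le_one_left (norm_nonneg _) ((div_le_one hr).2 (by linarith [ht.2]))
  have hζ : ‖r⁻¹ • ξ‖ = ‖ξ‖ / r := by
    rw [norm_smul, Real.norm_of_nonneg (inv_nonneg.2 hr.le)]; ring
  have hzz := (le_abs_self _).trans (hB.apply_le hb (r⁻¹ • ξ) (r⁻¹ • ξ))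
  rw [hζ] at hzz hexp
  rw [add_sub_cancel_left, hunit] at hexp
  have hC := hB.C_nonneg
  have e1 : C * ‖η‖ ^ 2 * ‖v t‖ ^ 2 ≤ C * ‖ξ‖ ^ 2 * V ^ 2 := by gcongr
  have e2 : 2 * C * ‖η‖ * ‖v t‖ * (‖ξ‖ / r) ≤ 2 * C * ‖ξ‖ * V * (‖ξ‖ / r) := by gcongr
  -- The tangent line of the square root at `1`, the squared speed of the unperturbed geodesic,
  -- reduces the bound on the speed to the expansion of its square.
  have hsqrt : ∀ x : ℝ, 0 ≤ x → √x ≤ (1 + x) / 2 := fun x hx => by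
    nlinarith [Real.sq_sqrt hx, sq_nonneg (√x - 1)]
  refine (hsqrt _ (hG.nonneg (hKU hb) _)).trans ?_
  have e3 : C * (1 / lam + 2 * V / r + 1 / r ^ 2) / 2 * ‖ξ‖ ^ 2 =
      (C * ‖ξ‖ ^ 2 * V ^ 2 + 2 * C * ‖ξ‖ * V * (‖ξ‖ / r) + C * (‖ξ‖ / r) * (‖ξ‖ / r)) / 2 := by
    rw [hV2]
    field_simp
  rw [mul_one, e3]
  linarith

/-- Lower second order estimate for `g_y(u + ζ, u + ζ)` around a unit vector `u` at `z`. -/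
theorem MetricBounds.le_expansion (hB : MetricBounds G K lam C) {z y u ζ : E} (hz : z ∈ K)
    (hy : y ∈ K) (hsymm : ∀ u w, G y u w = G y w u) (hu : G z u u = 1) :
    1 + fderiv ℝ G z (y - z) u u + 2 * G z u ζ + lam / 2 * ‖ζ‖ ^ 2
      - (C / lam + 2 * C ^ 2 / lam ^ 2) * ‖y - z‖ ^ 2 ≤ G y (u + ζ) (u + ζ) := by
  have hC := hB.C_nonneg
  have hlam := hB.lam_pos
  have hexp := (abs_le.1 (hB.expansion hz hy hsymm u ζ)).1
  rw [hu] at hexp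
  have hlow := hB.lower _ hy ζ
  have hV := hB.norm_le_of_unit hz hu
  set V := √lam⁻¹ with hVdef
  have hV2 : V ^ 2 = 1 / lam := by
    rw [hVdef, Real.sq_sqrt (inv_nonneg.2 hlam.le), one_div]
  have e1 : C * ‖y - z‖ ^ 2 * ‖u‖ ^ 2 ≤ C * ‖y - z‖ ^ 2 * V ^ 2 := by gcongr
  have e2 : 2 * C * ‖y - z‖ * ‖u‖ * ‖ζ‖ ≤ 2 * C * ‖y - z‖ * V * ‖ζ‖ := by gcongr
  generalize ‖y - z‖ = n at *
  generalize ‖ζ‖ = k at *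
  -- Young's inequality: half of the coercive term `lam * k ^ 2` pays for the mixed term.
  have e3 : 2 * C * n * V * k ≤ lam / 2 * k ^ 2 + 2 * C ^ 2 / lam ^ 2 * n ^ 2 := by
    have h1 : 2 / lam * (lam / 2 * k - C * V * n) ^ 2 = lam / 2 * k ^ 2
        - 2 * C * n * V * k + 2 / lam * C ^ 2 * V ^ 2 * n ^ 2 := by
      field_simp
      ring
    have h2 : 0 ≤ 2 / lam * (lam / 2 * k - C * V * n) ^ 2 := by positivity
    have h3 : 2 / lam * C ^ 2 * V ^ 2 * n ^ 2 = 2 * C ^ 2 / lam ^ 2 * n ^ 2 := by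
      rw [hV2]
      field_simp
    rw [h1, h3] at h2
    linarith only [h2]
  have e4 : (C / lam + 2 * C ^ 2 / lam ^ 2) * n ^ 2 =
      C * n ^ 2 * V ^ 2 + 2 * C ^ 2 / lam ^ 2 * n ^ 2 := by
    rw [hV2]; ring
  rw [e4]
  linarith only [hexp, hlow, e1, e2, e3]

/-- Cauchy-Schwarz in the form used for reparametrized energies. -/
theorem sq_le_of_forall_le_half {x h Q : ℝ} (hh : 0 < h) (hx : 0 ≤ x) (hQ : 0 ≤ Q)
    (H : ∀ k > 0, x ≤ k * h / 2 + Q / (2 * k)) : x ^ 2 ≤ h * Q := by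
  rcases hx.eq_or_lt with rfl | hx
  · simpa using mul_nonneg hh.le hQ
  -- With this weight the first term on the right is `x / 2`, which is absorbed on the left.
  · have := H (x / h) (div_pos hx hh)
    have h1 : x / h * h / 2 = x / 2 := by field_simp
    have h2 : Q / (2 * (x / h)) = Q * h / (2 * x) := by field_simp
    rw [h1, h2, ← sub_le_iff_le_add', le_div_iff₀ (by linarith)] at this
    nlinarith

/-- Short geodesics are not longer than the curves with the same end points in a given compact
set. -/
theorem MetricBounds.geodesic_le_length (hB : MetricBounds G K lam C) (hG : IsSmoothMetricOn G U)
    (hKU : K ⊆ U) {h : ℝ} (hh : 0 < h) (hsmall : (C / lam + 2 * C ^ 2 / lam ^ 2) * h ^ 2 ≤ lam / 2)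
    {c v : ℝ → E} (hc : ∀ t ∈ Icc 0 h, HasDerivAt c (v t) t)
    (hv : ∀ t ∈ Icc 0 h, HasDerivAt v (spray G (c t) (v t)) t) (hcK : ∀ t ∈ Icc 0 h, c t ∈ K)
    (hunit : ∀ t ∈ Icc 0 h, G (c t) (v t) (v t) = 1) {b b' : ℝ → E}
    (hb : ∀ t ∈ Icc (0 : ℝ) 1, HasDerivAt b (b' t) t) (hb' : ContinuousOn b' (Icc 0 1))
    (hbK : ∀ t ∈ Icc (0 : ℝ) 1, b t ∈ K) (hb0 : b 0 = c 0) (hb1 : b 1 = c h) :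
    h ≤ ∫ t in (0 : ℝ)..1, √(G (b t) (b' t) (b' t)) := by
  have hC := hB.C_nonneg
  have hlam := hB.lam_pos
  have hGc : ContinuousOn G U := hG.contDiffOn.continuousOn
  have hbc : ContinuousOn b (Icc 0 1) := HasDerivAt.continuousOn hb
  have hwc : ContinuousOn (fun t => √(G (b t) (b' t) (b' t))) (Icc 0 1) :=
    (((hGc.comp hbc fun t ht => hKU (hbK t ht)).clm_apply hb').clm_apply hb').sqrt
  set w : ℝ → ℝ := fun t => √(G (b t) (b' t) (b' t)) with hw
  have hw0 : ∀ t, 0 ≤ w t := fun t => Real.sqrt_nonneg _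
  have huIcc : uIcc (0 : ℝ) 1 = Icc 0 1 := uIcc_of_le zero_le_one
  have hint : ∀ {f : ℝ → ℝ}, ContinuousOn f (Icc 0 1) → IntervalIntegrable f volume 0 1 :=
    fun hf => ContinuousOn.intervalIntegrable (by rwa [huIcc])
  set ℓ := ∫ t in (0 : ℝ)..1, w t with hℓ
  have hℓ0 : 0 ≤ ℓ := integral_nonneg zero_le_one fun t _ => hw0 t
  clear_value w ℓ
  -- The speed of `b` may vanish; `ε` keeps the reparametrization speed positive and is removed at
  -- the end.
  suffices H : ∀ ε > 0, h ^ 2 ≤ ℓ * (ℓ + ε) by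
    have h2 : h ^ 2 ≤ ℓ * ℓ := by
      apply le_of_forall_pos_le_add
      intro ε hε
      have := H (ε / (ℓ + 1)) (by positivity)
      have h3 : ℓ * (ε / (ℓ + 1)) ≤ ε := by
        rw [mul_div_assoc', div_le_iff₀ (by positivity)]
        nlinarith
      nlinarith
    nlinarith
  intro ε hε
  -- The function `ψ` below is the arc length of `b`, regularized by `ε` and scaled by `κ` to end at
  -- `h`. Thus `c ∘ ψ` runs through the geodesic essentially in step with `b`, with the same end
  -- points, and `η` measures the deviation.
  set κ := h / (ℓ + ε) with hκdef
  have hκ : 0 < κ := by positivity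
  -- the reparametrization
  set m : ℝ → ℝ := fun t => κ * (w t + ε) with hmdef
  have hm0 : ∀ t, 0 < m t := fun t => mul_pos hκ (by linarith [hw0 t])
  have hmc : ContinuousOn m (Icc 0 1) := continuousOn_const.mul (hwc.add continuousOn_const)
  clear_value m
  set ψ : ℝ → ℝ := fun t => ∫ s in (0 : ℝ)..t, m s with hψdef
  have hψ0 : ψ 0 = 0 := integral_same
  have hψ1 : ψ 1 = h := by
    simp only [hψdef, hmdef]
    rw [intervalIntegral.integral_const_mul, integral_add (hint hwc) (hint continuousOn_const)]
    simp only [intervalIntegral.integral_const, sub_zero, one_smul]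
    rw [← hℓ, hκdef]
    field_simp
  have hψd : ∀ t ∈ Ioo (0 : ℝ) 1, HasDerivAt ψ (m t) t := by
    intro t ht
    apply integral_hasDerivAt_right
    · apply ContinuousOn.intervalIntegrable
      rw [uIcc_of_le ht.1.le]
      exact hmc.mono (Icc_subset_Icc_right ht.2.le)
    · exact (hmc.mono Ioo_subset_Icc_self).stronglyMeasurableAtFilter isOpen_Ioo t ht
    · exact hmc.continuousAt (Icc_mem_nhds ht.1 ht.2)
  have hψc : ContinuousOn ψ (Icc 0 1) := by
    have := continuousOn_primitive_interval (μ := volume) (f := m) (a := 0) (b := 1)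
      (by rw [huIcc]; exact hmc.integrableOn_Icc)
    rwa [huIcc] at this
  have hm1 : ∫ t in (0 : ℝ)..1, m t = h := hψ1
  clear_value ψ κ
  have hψmono : MonotoneOn ψ (Icc 0 1) := by
    apply monotoneOn_of_deriv_nonneg (convex_Icc 0 1) hψc
    · rw [interior_Icc]
      exact fun t ht => (hψd t ht).differentiableAt.differentiableWithinAt
    · rw [interior_Icc]
      exact fun t ht => (hψd t ht).deriv ▸ (hm0 t).le
  have hψmem : ∀ t ∈ Icc (0 : ℝ) 1, ψ t ∈ Icc 0 h := by
    intro t ht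
    constructor
    · rw [← hψ0]; exact hψmono (by simp) ht ht.1
    · rw [← hψ1]; exact hψmono ht (by simp) ht.2
  have hcc : ContinuousOn (fun t => c (ψ t)) (Icc 0 1) :=
    (HasDerivAt.continuousOn hc).comp hψc hψmem
  have hvc : ContinuousOn (fun t => v (ψ t)) (Icc 0 1) :=
    (HasDerivAt.continuousOn hv).comp hψc hψmem
  set η : ℝ → E := fun t => b t - c (ψ t) with hηdef
  set η' : ℝ → E := fun t => b' t - m t • v (ψ t) with hη'def
  have hη0 : η 0 = 0 := by simp [hηdef, hψ0, hb0]
  have hη1 : η 1 = 0 := by simp [hηdef, hψ1, hb1]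
  have hηc : ContinuousOn η (Icc 0 1) := hbc.sub hcc
  have hη'c : ContinuousOn η' (Icc 0 1) := hb'.sub (hmc.smul hvc)
  have hcd : ∀ t ∈ Ioo (0 : ℝ) 1, HasDerivAt (fun t => c (ψ t)) (m t • v (ψ t)) t := fun t ht =>
    HasDerivAt.scomp t (hc _ (hψmem t (Ioo_subset_Icc_self ht))) (hψd t ht)
  have hvd : ∀ t ∈ Ioo (0 : ℝ) 1,
      HasDerivAt (fun t => v (ψ t)) (m t • spray G (c (ψ t)) (v (ψ t))) t := fun t ht =>
    HasDerivAt.scomp t (hv _ (hψmem t (Ioo_subset_Icc_self ht))) (hψd t ht)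
  have hηd : ∀ t ∈ Ioo (0 : ℝ) 1, HasDerivAt η (η' t) t := fun t ht =>
    (hb t (Ioo_subset_Icc_self ht)).sub (hcd t ht)
  -- the Poincaré inequality
  set q : ℝ → ℝ := fun t => ‖η' t‖ ^ 2 / m t with hqdef
  have hq0 : ∀ t, 0 ≤ q t := fun t => div_nonneg (sq_nonneg _) (hm0 t).le
  have hqc : ContinuousOn q (Icc 0 1) := (hη'c.norm.pow 2).div hmc fun t _ => (hm0 t).ne'
  set Q := ∫ t in (0 : ℝ)..1, q t with hQ
  have hQ0 : 0 ≤ Q := integral_nonneg zero_le_one fun t _ => hq0 t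
  have hI : ∫ t in (0 : ℝ)..1, ‖η' t‖ ≤ √(h * Q) := by
    apply Real.le_sqrt_of_sq_le
    apply sq_le_of_forall_le_half hh (integral_nonneg zero_le_one fun t _ => norm_nonneg _) hQ0
    -- Cauchy-Schwarz for `‖η'‖ = √m · (‖η'‖ / √m)`, in the form of a family of AM-GM inequalities.
    intro k hk
    have hk1 : ContinuousOn (fun t => k / 2 * m t) (Icc 0 1) := continuousOn_const.mul hmc
    have hk2 : ContinuousOn (fun t => 1 / (2 * k) * q t) (Icc 0 1) := continuousOn_const.mul hqc
    have h1 : ∫ t in (0 : ℝ)..1, ‖η' t‖ ≤ ∫ t in (0 : ℝ)..1, (k / 2 * m t + 1 / (2 * k) * q t) := by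
      apply integral_mono_on zero_le_one (hint hη'c.norm)
      · exact hint (hk1.add hk2)
      · intro t ht
        have hmt := hm0 t
        have : k / 2 * m t + 1 / (2 * k) * q t - ‖η' t‖ = (k * m t - ‖η' t‖) ^ 2 / (2 * k * m t) := by
          simp only [hqdef]
          field_simp
          ring
        have h2 : 0 ≤ (k * m t - ‖η' t‖) ^ 2 / (2 * k * m t) := by positivity
        linarith
    rw [integral_add (hint hk1) (hint hk2), intervalIntegral.integral_const_mul,
      intervalIntegral.integral_const_mul, ← hQ] at h1
    rw [hm1] at h1
    refine h1.trans_eq ?_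
    field_simp
  clear_value q Q
  have hηle : ∀ t ∈ Icc (0 : ℝ) 1, ‖η t‖ ^ 2 ≤ h * Q := by
    intro t ht
    have hsub : Icc 0 t ⊆ Icc (0 : ℝ) 1 := Icc_subset_Icc_right ht.2
    have h1 : ∫ s in (0 : ℝ)..t, η' s = η t := by
      rw [integral_eq_sub_of_hasDerivAt_of_le ht.1 (hηc.mono hsub)
        (fun s hs => hηd s ⟨hs.1, hs.2.trans_le ht.2⟩), hη0, sub_zero]
      apply ContinuousOn.intervalIntegrable
      rw [uIcc_of_le ht.1]
      exact hη'c.mono hsub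
    have h2 : ‖η t‖ ≤ ∫ s in (0 : ℝ)..1, ‖η' s‖ := by
      rw [← h1]
      refine (intervalIntegral.norm_integral_le_integral_norm ht.1).trans ?_
      exact integral_mono_interval le_rfl ht.1 ht.2
        (Eventually.of_forall fun s => norm_nonneg _) (hint hη'c.norm)
    calc ‖η t‖ ^ 2 ≤ √(h * Q) ^ 2 := by gcongr; exact h2.trans hI
      _ = h * Q := Real.sq_sqrt (by positivity)
  -- the first variation
  set F : ℝ → ℝ := fun t => 2 * G (c (ψ t)) (v (ψ t)) (η t) with hFdef
  set F' : ℝ → ℝ := fun t => 2 * (m t * (1 / 2 * fderiv ℝ G (c (ψ t)) (η t) (v (ψ t)) (v (ψ t)))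
    + G (c (ψ t)) (v (ψ t)) (η' t)) with hF'def
  have hcψU : ∀ t ∈ Icc (0 : ℝ) 1, c (ψ t) ∈ U := fun t ht => hKU (hcK _ (hψmem t ht))
  have hGψ : ContinuousOn (fun t => G (c (ψ t))) (Icc 0 1) := hGc.comp hcc hcψU
  have hdGψ : ContinuousOn (fun t => fderiv ℝ G (c (ψ t))) (Icc 0 1) :=
    (hG.contDiffOn.continuousOn_fderiv_of_isOpen hG.isOpen (by simp)).comp hcc hcψU
  have hFd : ∀ t ∈ Ioo (0 : ℝ) 1, HasDerivAt F (F' t) t := fun t ht =>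
    (hG.hasDerivAt_metric_velocity (c := fun t => c (ψ t)) (v := fun t => v (ψ t))
      (hcψU t (Ioo_subset_Icc_self ht)) (hcd t ht) (hvd t ht) (hηd t ht)).const_mul 2
  have hFc : ContinuousOn F (Icc 0 1) :=
    continuousOn_const.mul ((hGψ.clm_apply hvc).clm_apply hηc)
  have hF'c : ContinuousOn F' (Icc 0 1) :=
    continuousOn_const.mul ((hmc.mul (continuousOn_const.mul
      (((hdGψ.clm_apply hηc).clm_apply hvc).clm_apply hvc))).add
      ((hGψ.clm_apply hvc).clm_apply hη'c))
  -- The linear part of the change of energy is an exact derivative, by the geodesic equation, and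
  -- `η` vanishes at both ends.
  have hFint : ∫ t in (0 : ℝ)..1, F' t = 0 := by
    rw [integral_eq_sub_of_hasDerivAt_of_le zero_le_one hFc hFd (hint hF'c)]
    simp [hFdef, hη0, hη1]
  clear_value F F' η'
  -- the pointwise inequality
  set A := C / lam + 2 * C ^ 2 / lam ^ 2 with hA
  have hA0 : 0 ≤ A := by positivity
  have hpt : ∀ t ∈ Icc (0 : ℝ) 1,
      m t + F' t + (lam / 2 * q t - A * (h * Q) * m t) ≤ w t / κ := by
    intro t ht
    have hmt := hm0 t
    have hbt := hbK t ht
    have hct := hcK _ (hψmem t ht)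
    have hut := hunit _ (hψmem t ht)
    set u := v (ψ t) with hu
    set ζ := (m t)⁻¹ • η' t with hζ
    have hb't : b' t = m t • (u + ζ) := by
      rw [hζ, smul_add, smul_inv_smul₀ hmt.ne']
      simp only [hη'def]
      abel
    have e4 : ‖ζ‖ ^ 2 * m t = q t := by
      rw [hζ, norm_smul, Real.norm_of_nonneg (inv_nonneg.2 hmt.le)]
      simp only [hqdef]
      field_simp
    have e5 : F' t = m t * (fderiv ℝ G (c (ψ t)) (η t) u u + 2 * G (c (ψ t)) u ζ) := by
      simp only [hF'def]
      rw [hζ, map_smul, smul_eq_mul, ← hu]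
      field_simp
    have e6 : w t ^ 2 = m t ^ 2 * G (b t) (u + ζ) (u + ζ) := by
      simp only [hw]
      rw [Real.sq_sqrt (hG.nonneg (hKU hbt) _), hb't]
      simp only [map_smul, smul_apply, smul_eq_mul]
      ring
    -- The left side is `w² / m`, and `m ≥ κ w` by the choice of the reparametrization. This turns
    -- an energy bound into a length bound.
    have e7 : m t * G (b t) (u + ζ) (u + ζ) ≤ w t / κ := by
      have h1 : m t * G (b t) (u + ζ) (u + ζ) = w t ^ 2 / m t := by
        rw [e6]; field_simp
      rw [h1, div_le_div_iff₀ hmt hκ]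
      have : w t * κ ≤ m t := by
        simp only [hmdef]
        nlinarith
      nlinarith [hw0 t]
    refine le_trans ?_ e7
    have e8 : 1 + fderiv ℝ G (c (ψ t)) (η t) u u + 2 * G (c (ψ t)) u ζ + lam / 2 * ‖ζ‖ ^ 2
        - A * ‖η t‖ ^ 2 ≤ G (b t) (u + ζ) (u + ζ) :=
      hB.le_expansion hct hbt (hG.symm _ (hKU hbt)) hut
    have e9 : A * ‖η t‖ ^ 2 * m t ≤ A * (h * Q) * m t := by
      gcongr
      exact hηle t ht
    have := mul_le_mul_of_nonneg_left e8 hmt.le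
    rw [e5, ← e4]
    linarith only [this, e9]
  have hqc' : ContinuousOn (fun t => lam / 2 * q t) (Icc 0 1) := continuousOn_const.mul hqc
  have hmc' : ContinuousOn (fun t => A * (h * Q) * m t) (Icc 0 1) := continuousOn_const.mul hmc
  have hmF : ContinuousOn (fun t => m t + F' t) (Icc 0 1) := hmc.add hF'c
  have hqm : ContinuousOn (fun t => lam / 2 * q t - A * (h * Q) * m t) (Icc 0 1) := hqc'.sub hmc'
  have hsum : ContinuousOn (fun t => m t + F' t + (lam / 2 * q t - A * (h * Q) * m t)) (Icc 0 1) :=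
    hmF.add hqm
  have hfin := integral_mono_on zero_le_one (hint hsum) (hint (hwc.div_const κ)) hpt
  rw [integral_add (hint hmF) (hint hqm), integral_add (hint hmc) (hint hF'c),
    integral_sub (hint hqc') (hint hmc'), intervalIntegral.integral_const_mul,
    intervalIntegral.integral_const_mul, intervalIntegral.integral_div, ← hQ, ← hℓ, hFint, hm1]
    at hfin
  -- Smallness of `h` lets the coercive term in `η'` absorb the curvature-type error in `η`, through
  -- the Poincaré inequality. What remains is `h ≤ ℓ / κ`, that is `h² ≤ ℓ (ℓ + ε)`.
  have h1 : A * (h * Q) * h ≤ lam / 2 * Q := by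
    have := mul_le_mul_of_nonneg_right hsmall hQ0
    linarith only [this]
  have h2 : h ≤ ℓ / κ := by linarith only [h1, hfin]
  rw [hκdef, div_div_eq_mul_div, le_div_iff₀ hh] at h2
  linarith

end FlatVariation

/-! ### Differentiable dependence of ODE solutions on initial data. -/

section SmoothFlow

attribute [-instance]
  Bundle.instNormedAddCommGroupOfRiemannianBundleOfIsTopologicalAddGroupOfContinuousConstSMulReal
  Bundle.instInnerProductSpaceReal

variable {E : Type*} [NormedAddCommGroup E] [NormedSpace ℝ E]

/-- The difference of two solutions of an ODE agrees to first order with the solution of the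
linearized equation. -/
theorem norm_sub_sub_le_of_variation {V : E → E} {V' : E → E →L[ℝ] E} {B : Set E} {A : NNReal}
    {C T : ℝ} (hA : 0 < A) (hC : 0 ≤ C) (hL : LipschitzOnWith A V B) (hV' : ∀ z ∈ B, ‖V' z‖ ≤ A)
    (htaylor : ∀ z ∈ B, ∀ y ∈ B, ‖V y - V z - V' z (y - z)‖ ≤ C * ‖y - z‖ ^ 2) (hT : 0 ≤ T)
    {z y j : ℝ → E}
    (hz : ∀ t ∈ Icc 0 T, HasDerivAt z (V (z t)) t ∧ z t ∈ B)
    (hy : ∀ t ∈ Icc 0 T, HasDerivAt y (V (y t)) t ∧ y t ∈ B)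
    (hj : ∀ t ∈ Icc 0 T, HasDerivAt j (V' (z t) (j t)) t) (hj0 : j 0 = y 0 - z 0) :
    ‖y T - z T - j T‖ ≤ C * Real.exp (A * T) ^ 2 / A * (Real.exp (A * T) - 1) * ‖y 0 - z 0‖ ^ 2 := by
  have hlip : ∀ t ∈ Icc 0 T, ‖y t - z t‖ ≤ ‖y 0 - z 0‖ * Real.exp (A * T) := by
    intro t ht
    have := dist_le_of_trajectories_ODE_of_mem (v := fun _ => V) (s := fun _ => B) (K := A)
      (f := y) (g := z) (a := 0) (b := T) (δ := ‖y 0 - z 0‖) (fun _ _ => hL)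
      (HasDerivAt.continuousOn fun t ht => (hy t ht).1)
      (fun t ht => (hy t (Ico_subset_Icc_self ht)).1.hasDerivWithinAt)
      (fun t ht => (hy t (Ico_subset_Icc_self ht)).2)
      (HasDerivAt.continuousOn fun t ht => (hz t ht).1)
      (fun t ht => (hz t (Ico_subset_Icc_self ht)).1.hasDerivWithinAt)
      (fun t ht => (hz t (Ico_subset_Icc_self ht)).2) (dist_eq_norm _ _).le t ht
    rw [dist_eq_norm, sub_zero] at this
    refine this.trans ?_
    gcongr
    exact ht.2
  have hder : ∀ t ∈ Icc 0 T, HasDerivAt (fun t => y t - z t - j t)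
      (V (y t) - V (z t) - V' (z t) (j t)) t := fun t ht =>
    ((hy t ht).1.sub (hz t ht).1).sub (hj t ht)
  have := norm_le_gronwallBound_of_norm_deriv_right_le (f := fun t => y t - z t - j t) (δ := 0)
    (K := A) (ε := C * (‖y 0 - z 0‖ * Real.exp (A * T)) ^ 2) (HasDerivAt.continuousOn hder)
    (fun t ht => (hder t (Ico_subset_Icc_self ht)).hasDerivWithinAt) (by simp [hj0]) ?_ T
    (right_mem_Icc.2 hT)
  · rw [gronwallBound_of_K_ne_0 (by positivity)] at this
    refine this.trans_eq ?_
    simp only [sub_zero]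
    ring
  · intro t ht
    have ht := Ico_subset_Icc_self ht
    -- The error solves the linearized equation up to a Taylor remainder, which is quadratic in `y -
    -- z`; Grönwall then applies with zero initial error.
    have e : V (y t) - V (z t) - V' (z t) (j t) = V' (z t) (y t - z t - j t)
        + (V (y t) - V (z t) - V' (z t) (y t - z t)) := by
      rw [map_sub (V' (z t)) (y t - z t)]
      abel
    rw [e]
    refine (norm_add_le _ _).trans (add_le_add ?_ ?_)
    · exact ((V' (z t)).le_opNorm _).trans (by gcongr; exact hV' _ (hz t ht).2)
    · refine (htaylor _ (hz t ht).2 _ (hy t ht).2).trans ?_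
      gcongr
      exact hlip t ht

/-- A `C²` map has a Lipschitz derivative near the point, and the mean value inequality on segments
gives the quadratic remainder. -/
theorem ContDiffAt.exists_taylor_bounds {V : E → E} {y₀ : E} (hV : ContDiffAt ℝ 2 V y₀) :
    ∃ δ > 0, ∃ A : NNReal, ∃ C : ℝ, 0 < A ∧ 0 ≤ C ∧ LipschitzOnWith A V (Metric.ball y₀ δ) ∧
      (∀ z ∈ Metric.ball y₀ δ, ‖fderiv ℝ V z‖ ≤ A) ∧
      ∀ z ∈ Metric.ball y₀ δ, ∀ y ∈ Metric.ball y₀ δ,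
        ‖V y - V z - fderiv ℝ V z (y - z)‖ ≤ C * ‖y - z‖ ^ 2 := by
  have hd : ContDiffAt ℝ 1 (fderiv ℝ V) y₀ := hV.fderiv_right (by norm_num)
  obtain ⟨C, s, hs, hsC⟩ := hd.exists_lipschitzOnWith
  have hdiff : ∀ᶠ y in 𝓝 y₀, DifferentiableAt ℝ V y := by
    filter_upwards [hV.eventually (by simp)] with y hy using hy.differentiableAt (by simp)
  have hbd : ∀ᶠ y in 𝓝 y₀, ‖fderiv ℝ V y‖ < ‖fderiv ℝ V y₀‖ + 1 :=
    hd.continuousAt.norm.eventually_lt_const (by linarith)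
  obtain ⟨δ, hδ, hball⟩ := Metric.mem_nhds_iff.1 (inter_mem (inter_mem hdiff hbd) hs)
  set A : NNReal := ⟨‖fderiv ℝ V y₀‖ + 1, by positivity⟩ with hA
  have hV' : ∀ z ∈ Metric.ball y₀ δ, ‖fderiv ℝ V z‖ ≤ A := fun z hz => (hball hz).1.2.le
  refine ⟨δ, hδ, A, C, ?_, C.2, ?_, hV', fun z hz y hy => ?_⟩
  · have h : (0 : ℝ) < ‖fderiv ℝ V y₀‖ + 1 := by positivity
    exact h
  · exact (convex_ball y₀ δ).lipschitzOnWith_of_nnnorm_fderiv_le (𝕜 := ℝ)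
      (fun z hz => (hball hz).1.1) fun z hz => hV' z hz
  · have hseg : segment ℝ z y ⊆ Metric.ball y₀ δ := (convex_ball y₀ δ).segment_subset hz hy
    have := (convex_segment z y).norm_image_sub_le_of_norm_hasFDerivWithin_le' (𝕜 := ℝ)
      (f := V) (f' := fun x => fderiv ℝ V x) (φ := fderiv ℝ V z) (C := C * ‖y - z‖)
      (fun x hx => (hball (hseg hx)).1.1.hasFDerivAt.hasFDerivWithinAt)
      (fun x hx => ?_) (left_mem_segment ℝ z y) (right_mem_segment ℝ z y)
    · refine this.trans_eq ?_
      ring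
    · refine (hsC.norm_sub_le (hball (hseg hx)).2 (hball hz).2).trans ?_
      gcongr
      obtain ⟨a, b, ha, hb, hab, rfl⟩ := hx
      have : a • z + b • y - z = b • (y - z) := by
        have : a = 1 - b := by linarith
        rw [this]; module
      rw [this, norm_smul, Real.norm_of_nonneg hb]
      exact mul_le_of_le_one_left (norm_nonneg _) (by linarith)

/-- A `C²` vector field has a local flow, which is `C¹` in the initial condition. -/
theorem ContDiffAt.exists_contDiffOn_flow [CompleteSpace E] {V : E → E} {y₀ : E}
    (hV : ContDiffAt ℝ 2 V y₀) {N : Set E} (hN : N ∈ 𝓝 y₀) :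
    ∃ r > 0, ∃ ε > 0, ∃ Φ : E → ℝ → E,
      (∀ y ∈ Metric.ball y₀ r, Φ y 0 = y ∧
        ∀ t ∈ Ioo (-ε) ε, HasDerivAt (Φ y) (V (Φ y t)) t ∧ Φ y t ∈ N) ∧
      ∀ t ∈ Ioo (-ε) ε, ContDiffOn ℝ 1 (fun y => Φ y t) (Metric.ball y₀ r) := by
  obtain ⟨δ, hδ, A, C, hA, hC, hL, hV', htaylor⟩ := hV.exists_taylor_bounds
  set B := Metric.ball y₀ δ with hB
  -- The field is coupled with its linearization. Since `W` is `C¹`, its Picard-Lindelöf flow gives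
  -- `Φ` together with a candidate `J` for its derivative, continuous in the initial point.
  let W : E × (E →L[ℝ] E) → E × (E →L[ℝ] E) := fun p => (V p.1, (fderiv ℝ V p.1).comp p.2)
  have hW : ContDiffAt ℝ 1 W (y₀, ContinuousLinearMap.id ℝ E) := by
    have hd : ContDiffAt ℝ 1 (fderiv ℝ V) y₀ := hV.fderiv_right (by norm_num)
    have hfst : ContDiffAt ℝ 1 (Prod.fst : E × (E →L[ℝ] E) → E) (y₀, ContinuousLinearMap.id ℝ E) :=
      contDiffAt_fst
    exact ((hV.of_le (by norm_num)).comp (y₀, ContinuousLinearMap.id ℝ E) hfst).prodMk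
      ((hd.comp (y₀, ContinuousLinearMap.id ℝ E) hfst).clm_comp contDiffAt_snd)
  obtain ⟨ε₁, hε₁, a, r₁, L, K, hr₁, hpl⟩ := IsPicardLindelof.of_contDiffAt_one hW
  obtain ⟨α, hα, hαc⟩ :=
    (hpl 0).exists_forall_mem_closedBall_eq_hasDerivWithinAt_continuousOn
  simp only [zero_sub, zero_add] at hα hαc
  set Φ : E → ℝ → E := fun y t => (α ((y, ContinuousLinearMap.id ℝ E), t)).1 with hΦ
  set J : E → ℝ → (E →L[ℝ] E) := fun y t => (α ((y, ContinuousLinearMap.id ℝ E), t)).2 with hJ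
  have hmem₁ : ∀ y ∈ Metric.ball y₀ r₁, (y, ContinuousLinearMap.id ℝ E) ∈
      Metric.closedBall (y₀, ContinuousLinearMap.id ℝ E) (r₁ : ℝ) := by
    intro y hy
    rw [Metric.mem_closedBall, Prod.dist_eq, dist_self]
    exact max_le (Metric.mem_ball.1 hy).le r₁.2
  have hcont : ContinuousOn (fun p : E × ℝ => α ((p.1, ContinuousLinearMap.id ℝ E), p.2))
      (Metric.ball y₀ r₁ ×ˢ Ioo (-ε₁) ε₁) := by
    refine hαc.comp (by fun_prop) fun p hp => ⟨hmem₁ _ hp.1, Ioo_subset_Icc_self hp.2⟩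
  have h0 : Φ y₀ 0 = y₀ := by
    simp only [hΦ]
    rw [(hα _ (hmem₁ y₀ (Metric.mem_ball_self hr₁))).1]
  have hnear : ∀ᶠ p in 𝓝 (y₀, (0 : ℝ)), Φ p.1 p.2 ∈ N ∩ B := by
    have hc : ContinuousAt (fun p : E × ℝ => Φ p.1 p.2) (y₀, 0) :=
      (hcont.continuousAt (prod_mem_nhds (Metric.ball_mem_nhds _ hr₁)
        (Ioo_mem_nhds (by linarith) hε₁))).fst
    refine hc ?_
    simp only [h0]
    exact inter_mem hN (Metric.ball_mem_nhds _ hδ)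
  obtain ⟨ρ, hρ, hρN⟩ := Metric.eventually_nhds_iff.1 hnear
  set r := min ρ (r₁ : ℝ) with hr
  set ε := min ρ ε₁ with hε
  have hr0 : 0 < r := lt_min hρ hr₁
  have hε0 : 0 < ε := lt_min hρ hε₁
  have hball : ∀ y ∈ Metric.ball y₀ r, y ∈ Metric.ball y₀ r₁ := fun y hy =>
    Metric.ball_subset_ball (min_le_right _ _) hy
  have hIoo : ∀ t ∈ Ioo (-ε) ε, t ∈ Ioo (-ε₁) ε₁ := fun t ht =>
    ⟨by linarith [ht.1, min_le_right ρ ε₁], by linarith [ht.2, min_le_right ρ ε₁]⟩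
  have hmem : ∀ y ∈ Metric.ball y₀ r, ∀ t ∈ Ioo (-ε) ε, Φ y t ∈ N ∩ B := by
    intro y hy t ht
    refine @hρN (y, t) ?_
    rw [Prod.dist_eq]
    refine max_lt (lt_of_lt_of_le (Metric.mem_ball.1 hy) (min_le_left _ _)) ?_
    rw [Real.dist_eq, sub_zero, abs_lt]
    exact ⟨by linarith [ht.1, min_le_left ρ ε₁], by linarith [ht.2, min_le_left ρ ε₁]⟩
  have hder : ∀ y ∈ Metric.ball y₀ r, ∀ t ∈ Ioo (-ε) ε,
      HasDerivAt (fun t => α ((y, ContinuousLinearMap.id ℝ E), t))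
        (W (α ((y, ContinuousLinearMap.id ℝ E), t))) t := fun y hy t ht =>
    ((hα _ (hmem₁ y (hball y hy))).2 t (Ioo_subset_Icc_self (hIoo t ht))).hasDerivAt
      (Icc_mem_nhds (hIoo t ht).1 (hIoo t ht).2)
  have hΦd : ∀ y ∈ Metric.ball y₀ r, ∀ t ∈ Ioo (-ε) ε, HasDerivAt (Φ y) (V (Φ y t)) t :=
    fun y hy t ht => (hder y hy t ht).fst
  have hJd : ∀ y ∈ Metric.ball y₀ r, ∀ t ∈ Ioo (-ε) ε,
      HasDerivAt (J y) ((fderiv ℝ V (Φ y t)).comp (J y t)) t :=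
    fun y hy t ht => (hder y hy t ht).snd
  have hΦ0 : ∀ y ∈ Metric.ball y₀ r, Φ y 0 = y := fun y hy => by
    simp only [hΦ]
    rw [(hα _ (hmem₁ y (hball y hy))).1]
  have hJ0 : ∀ y ∈ Metric.ball y₀ r, J y 0 = ContinuousLinearMap.id ℝ E := fun y hy => by
    simp only [hJ]
    rw [(hα _ (hmem₁ y (hball y hy))).1]
  refine ⟨r, hr0, ε, hε0, Φ, fun y hy => ⟨hΦ0 y hy, fun t ht =>
    ⟨hΦd y hy t ht, (hmem y hy t ht).1⟩⟩, fun t ht => ?_⟩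
  clear_value Φ J W
  have hfd : ∀ y ∈ Metric.ball y₀ r, HasFDerivAt (fun y => Φ y t) (J y t) y := by
    intro y hy
    obtain ⟨M, hM0, hM⟩ : ∃ M : ℝ, 0 ≤ M ∧ ∀ z ∈ Metric.ball y₀ r,
        ‖Φ z t - Φ y t - J y t (z - y)‖ ≤ M * ‖z - y‖ ^ 2 := by
      refine ⟨C * Real.exp (A * |t|) ^ 2 / A * (Real.exp (A * |t|) - 1), ?_, fun z hz => ?_⟩
      · have : 1 ≤ Real.exp (A * |t|) := Real.one_le_exp (by positivity)
        have : 0 ≤ Real.exp (A * |t|) - 1 := by linarith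
        positivity
      rcases le_total 0 t with h | h
      · rw [abs_of_nonneg h]
        have hI : ∀ s ∈ Icc 0 t, s ∈ Ioo (-ε) ε := fun s hs =>
          ⟨by linarith [hs.1], hs.2.trans_lt ht.2⟩
        have := norm_sub_sub_le_of_variation hA hC hL hV' htaylor h (z := Φ y) (y := Φ z)
          (j := fun s => J y s (z - y))
          (fun s hs => ⟨hΦd y hy s (hI s hs), (hmem y hy s (hI s hs)).2⟩)
          (fun s hs => ⟨hΦd z hz s (hI s hs), (hmem z hz s (hI s hs)).2⟩)
          (fun s hs => by
            simpa using (hJd y hy s (hI s hs)).clm_apply (hasDerivAt_const s (z - y)))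
          (by rw [hJ0 y hy, hΦ0 y hy, hΦ0 z hz]; rfl)
        rwa [hΦ0 y hy, hΦ0 z hz] at this
      · rw [abs_of_nonpos h]
        have hI : ∀ s ∈ Icc 0 (-t), -s ∈ Ioo (-ε) ε := fun s hs =>
          ⟨by linarith [hs.2, ht.1], by linarith [hs.1]⟩
        have hneg : ∀ s : ℝ, HasDerivAt (fun s : ℝ => -s) (-1) s := fun s => hasDerivAt_neg s
        -- Negative times are positive times for the reversed field `-V`.
        have := norm_sub_sub_le_of_variation (V := fun z => -V z) (V' := fun z => -fderiv ℝ V z)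
          (T := -t) hA hC hL.neg (fun z hz => by rw [norm_neg]; exact hV' z hz)
          (fun z hz y hy => by
            have := htaylor z hz y hy
            rw [← norm_neg] at this
            refine le_of_eq_of_le (congrArg _ ?_) this
            rw [neg_apply]
            abel)
          (by linarith) (z := fun s => Φ y (-s)) (y := fun s => Φ z (-s))
          (j := fun s => J y (-s) (z - y))
          (fun s hs => ⟨(HasDerivAt.scomp s (hΦd y hy _ (hI s hs)) (hneg s)).congr_deriv (by simp),
            (hmem y hy _ (hI s hs)).2⟩)
          (fun s hs => ⟨(HasDerivAt.scomp s (hΦd z hz _ (hI s hs)) (hneg s)).congr_deriv (by simp),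
            (hmem z hz _ (hI s hs)).2⟩)
          (fun s hs => by
            simpa using (HasDerivAt.scomp s (hJd y hy _ (hI s hs)) (hneg s)).clm_apply
              (hasDerivAt_const s (z - y)))
          (by simp only [neg_zero]; rw [hJ0 y hy, hΦ0 y hy, hΦ0 z hz]; rfl)
        simp only [neg_zero, neg_neg] at this
        rwa [hΦ0 y hy, hΦ0 z hz] at this
    rw [hasFDerivAt_iff_isLittleO]
    have h1 : (fun z => Φ z t - Φ y t - J y t (z - y)) =O[𝓝 y] fun z => ‖z - y‖ ^ 2 := by
      refine Asymptotics.IsBigO.of_bound M ?_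
      filter_upwards [Metric.isOpen_ball.mem_nhds hy] with z hz
      rw [Real.norm_of_nonneg (sq_nonneg _)]
      exact hM z hz
    exact h1.trans_isLittleO (Asymptotics.isLittleO_pow_sub_sub y one_lt_two)
  have hJc : ContinuousOn (fun y => J y t) (Metric.ball y₀ r) := by
    rw [hJ]
    exact (hcont.comp (f := fun y => (y, t)) (by fun_prop)
      fun y hy => ⟨hball y hy, hIoo t ht⟩).snd
  rw [show (1 : WithTop ℕ∞) = 0 + 1 from rfl,
    contDiffOn_succ_iff_fderiv_of_isOpen Metric.isOpen_ball, contDiffOn_zero]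
  exact ⟨fun y hy => (hfd y hy).differentiableAt.differentiableWithinAt, by simp,
    hJc.congr fun y hy => (hfd y hy).fderiv⟩

end SmoothFlow

/-! ### The geodesic equation as a first order system in charts. -/

section ManifoldGeodesics

variable {M : Type*} [MetricSpace M] [ChartedSpace Plane M] [IsManifold (𝓡 2) ∞ M]
  [RiemannianBundle (fun x : M => TangentSpace (𝓡 2) x)]
  [IsContMDiffRiemannianBundle (𝓡 2) ∞ Plane (fun x : M => TangentSpace (𝓡 2) x)]

theorem isSmoothMetricOn_metricForm (x₀ : M) :
    IsSmoothMetricOn (metricForm x₀) (extChartAt (𝓡 2) x₀).target where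
  isOpen := isOpen_extChartAt_target x₀
  contDiffOn := contDiffOn_clm_apply.2 fun u => contDiffOn_clm_apply.2 fun v =>
    contDiffOn_chartMetric x₀ u v
  symm z _ u v := chartMetric_symm x₀ z u v
  pos _ hz _ hu := chartMetric_pos x₀ hz hu

theorem chartChristoffel_eq (x₀ : M) {z : Plane} (hz : z ∈ (extChartAt (𝓡 2) x₀).target)
    (u w : Plane) : chartChristoffel x₀ z u u w = christoffelForm (metricForm x₀) z u w := by
  have key : ∀ a u v, fderiv ℝ (fun y => chartMetric x₀ y u v) z a
      = fderiv ℝ (metricForm x₀) z a u v := by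
    intro a u v
    have hd := ((isSmoothMetricOn_metricForm x₀).differentiableAt hz).hasFDerivAt
    have := ((ContinuousLinearMap.apply ℝ ℝ v).hasFDerivAt.comp z
      ((ContinuousLinearMap.apply ℝ (Plane →L[ℝ] ℝ) u).hasFDerivAt.comp z hd))
    have e : (fun y => chartMetric x₀ y u v) = (ContinuousLinearMap.apply ℝ ℝ v) ∘
      (ContinuousLinearMap.apply ℝ (Plane →L[ℝ] ℝ) u) ∘ metricForm x₀ := rfl
    rw [e, this.fderiv]
    rfl
  rw [chartChristoffel, key, key, christoffelForm_apply]
  ring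

/-- The coordinates of a tangent vector in the chart at `x₀`. -/
noncomputable def tangentCoord (x₀ : M) (v : TangentBundle (𝓡 2) M) : Plane × Plane :=
  (extChartAt (𝓡 2) x₀ v.1, chartCoord x₀ v.1 v.2)

theorem tangentCoord_injOn (x₀ : M) {v w : TangentBundle (𝓡 2) M}
    (hv : v.1 ∈ (chartAt Plane x₀).source) (hw : w.1 ∈ (chartAt Plane x₀).source)
    (h : tangentCoord x₀ v = tangentCoord x₀ w) : v = w := by
  obtain ⟨p, v⟩ := v
  obtain ⟨q, w⟩ := w
  have hpq : p = q := (extChartAt (𝓡 2) x₀).injOn (by rwa [extChartAt_source])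
    (by rwa [extChartAt_source]) congr($h.1)
  subst hpq
  have h2 : chartCoord x₀ p v = chartCoord x₀ p w := congrArg Prod.snd h
  exact congrArg (TotalSpace.mk p) (chartCoord_injective hv h2)

theorem tangentCoord_fst_mem {x₀ : M} {v : TangentBundle (𝓡 2) M}
    (hv : v.1 ∈ (chartAt Plane x₀).source) :
    (tangentCoord x₀ v).1 ∈ (extChartAt (𝓡 2) x₀).target :=
  (extChartAt (𝓡 2) x₀).map_source (by rwa [extChartAt_source])

theorem metricForm_tangentCoord {x₀ : M} {v : TangentBundle (𝓡 2) M}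
    (hv : v.1 ∈ (chartAt Plane x₀).source) :
    metricForm x₀ (tangentCoord x₀ v).1 (tangentCoord x₀ v).2 (tangentCoord x₀ v).2 = ‖v.2‖ ^ 2 :=
  (chartMetric_chartCoord hv v.2 v.2).trans (real_inner_self_eq_norm_sq _)

theorem exists_tangentCoord_eq (x₀ : M) {y : Plane × Plane}
    (hy : y.1 ∈ (extChartAt (𝓡 2) x₀).target) :
    ∃ v : TangentBundle (𝓡 2) M, v.1 ∈ (chartAt Plane x₀).source ∧ tangentCoord x₀ v = y := by
  refine ⟨⟨(extChartAt (𝓡 2) x₀).symm y.1, chartSymmDeriv x₀ y.1 y.2⟩, ?_, ?_⟩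
  · have := (extChartAt (𝓡 2) x₀).map_target hy
    rwa [extChartAt_source] at this
  · exact Prod.ext ((extChartAt (𝓡 2) x₀).right_inv hy) (chartCoord_chartSymmDeriv x₀ hy y.2)

/-- The geodesic vector field in the chart at `x₀`. -/
noncomputable def chartGeodesicField (x₀ : M) : Plane × Plane → Plane × Plane :=
  geodesicField (metricForm x₀)

theorem contDiffOn_chartGeodesicField (x₀ : M) :
    ContDiffOn ℝ ∞ (chartGeodesicField x₀) ((extChartAt (𝓡 2) x₀).target ×ˢ univ) :=
  (isSmoothMetricOn_metricForm x₀).contDiffOn_geodesicField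

theorem contDiffAt_chartGeodesicField (x₀ : M) {y : Plane × Plane}
    (hy : y.1 ∈ (extChartAt (𝓡 2) x₀).target) : ContDiffAt ℝ ∞ (chartGeodesicField x₀) y :=
  (contDiffOn_chartGeodesicField x₀).contDiffAt
    (((isOpen_extChartAt_target x₀).prod isOpen_univ).mem_nhds ⟨hy, mem_univ _⟩)

/-- `γ` is smooth at `t` and satisfies the geodesic equation there. -/
def IsGeodesicAt (γ : ℝ → M) (t : ℝ) : Prop :=
  ContMDiffAt 𝓘(ℝ, ℝ) (𝓡 2) ∞ γ t ∧ ∀ x₀ : M, γ t ∈ (chartAt Plane x₀).source →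
    HasDerivAt (fun s => tangentCoord x₀ (velocity γ s))
      (chartGeodesicField x₀ (tangentCoord x₀ (velocity γ t))) t

section Curves

variable {γ β : ℝ → M} {t : ℝ} {x₀ : M}

theorem contDiffAt_extChartAt_comp (hγ : ContMDiffAt 𝓘(ℝ, ℝ) (𝓡 2) ∞ γ t)
    (ht : γ t ∈ (chartAt Plane x₀).source) :
    ContDiffAt ℝ ∞ (fun s => extChartAt (𝓡 2) x₀ (γ s)) t := by
  rw [← contMDiffAt_iff_contDiffAt]
  exact (contMDiffAt_extChartAt' ht).comp t hγ

theorem ContMDiffAt.eventually_mem_source (hγ : ContMDiffAt 𝓘(ℝ, ℝ) (𝓡 2) ∞ γ t)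
    (ht : γ t ∈ (chartAt Plane x₀).source) : ∀ᶠ s in 𝓝 t, γ s ∈ (chartAt Plane x₀).source :=
  hγ.continuousAt ((chartAt Plane x₀).open_source.mem_nhds ht)

theorem ContMDiffAt.eventually_mdifferentiableAt (hγ : ContMDiffAt 𝓘(ℝ, ℝ) (𝓡 2) ∞ γ t) :
    ∀ᶠ s in 𝓝 t, MDifferentiableAt 𝓘(ℝ, ℝ) (𝓡 2) γ s := by
  have h : ContMDiffAt 𝓘(ℝ, ℝ) (𝓡 2) 1 γ t := hγ.of_le (by simp)
  filter_upwards [(contMDiffAt_iff_contMDiffAt_nhds (by simp)).1 h] with s hs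
  exact hs.mdifferentiableAt (by simp)

theorem tangentCoord_velocity_eq (hγ : MDifferentiableAt 𝓘(ℝ, ℝ) (𝓡 2) γ t)
    (ht : γ t ∈ (chartAt Plane x₀).source) :
    tangentCoord x₀ (velocity γ t) =
      (extChartAt (𝓡 2) x₀ (γ t), deriv (fun s => extChartAt (𝓡 2) x₀ (γ s)) t) :=
  Prod.ext rfl (hasDerivAt_extChartAt_comp hγ ht).deriv.symm

theorem eventually_tangentCoord_velocity_eq (hγ : ContMDiffAt 𝓘(ℝ, ℝ) (𝓡 2) ∞ γ t)
    (ht : γ t ∈ (chartAt Plane x₀).source) :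
    (fun s => tangentCoord x₀ (velocity γ s)) =ᶠ[𝓝 t] fun s =>
      (extChartAt (𝓡 2) x₀ (γ s), deriv (fun s => extChartAt (𝓡 2) x₀ (γ s)) s) := by
  filter_upwards [hγ.eventually_mem_source ht, hγ.eventually_mdifferentiableAt] with s hs hs'
  exact tangentCoord_velocity_eq hs' hs

theorem hasDerivAt_tangentCoord_velocity (hγ : ContMDiffAt 𝓘(ℝ, ℝ) (𝓡 2) ∞ γ t)
    (ht : γ t ∈ (chartAt Plane x₀).source) :
    HasDerivAt (fun s => tangentCoord x₀ (velocity γ s))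
      ((tangentCoord x₀ (velocity γ t)).2,
        deriv (deriv fun s => extChartAt (𝓡 2) x₀ (γ s)) t) t := by
  have hc := contDiffAt_extChartAt_comp hγ ht
  refine HasDerivAt.congr_of_eventuallyEq ?_ (eventually_tangentCoord_velocity_eq hγ ht)
  refine (hasDerivAt_extChartAt_comp (hγ.mdifferentiableAt (by simp)) ht).prodMk ?_
  have : ContDiffAt ℝ ∞ (deriv fun s => extChartAt (𝓡 2) x₀ (γ s)) t :=
    (hc.fderiv_right (m := ∞) (by simp)).clm_apply contDiffAt_const
  exact (this.differentiableAt (by simp)).hasDerivAt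

/-- Testing against all `w` determines the acceleration because the metric is nondegenerate. The
condition becomes local in time and first order in the velocity, as ODE theory requires. -/
theorem isGeodesic_iff : IsGeodesic γ ↔ ∀ t, IsGeodesicAt γ t := by
  unfold IsGeodesic
  have key : ∀ (x₀ : M) (t : ℝ), ContMDiffAt 𝓘(ℝ, ℝ) (𝓡 2) ∞ γ t →
      γ t ∈ (chartAt Plane x₀).source →
      ((∀ w : Plane, chartMetric x₀ (extChartAt (𝓡 2) x₀ (γ t))
          (deriv (deriv fun s => extChartAt (𝓡 2) x₀ (γ s)) t) w
        + chartChristoffel x₀ (extChartAt (𝓡 2) x₀ (γ t))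
          (deriv (fun s => extChartAt (𝓡 2) x₀ (γ s)) t)
          (deriv (fun s => extChartAt (𝓡 2) x₀ (γ s)) t) w = 0) ↔
      HasDerivAt (fun s => tangentCoord x₀ (velocity γ s))
      (chartGeodesicField x₀ (tangentCoord x₀ (velocity γ t))) t) := by
    intro x₀ t hγ ht
    have hz : extChartAt (𝓡 2) x₀ (γ t) ∈ (extChartAt (𝓡 2) x₀).target :=
      (extChartAt (𝓡 2) x₀).map_source (by rwa [extChartAt_source])
    have hG := isSmoothMetricOn_metricForm x₀
    have hd := hasDerivAt_tangentCoord_velocity hγ ht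
    have heq := tangentCoord_velocity_eq (hγ.mdifferentiableAt (by simp)) ht
    constructor
    · intro h
      refine hd.congr_deriv ?_
      refine Prod.ext rfl ?_
      rw [heq]
      refine hG.eq_spray hz fun w => ?_
      rw [← chartChristoffel_eq x₀ hz]
      exact h w
    · intro h w
      have h1 := congrArg Prod.snd (h.unique hd)
      rw [heq] at h1
      have h2 := congr($(hG.apply_spray hz (deriv (fun s => extChartAt (𝓡 2) x₀ (γ s)) t)) w)
      rw [neg_apply, ← chartChristoffel_eq x₀ hz] at h2
      have h3 : spray (metricForm x₀) (extChartAt (𝓡 2) x₀ (γ t))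
          (deriv (fun s => extChartAt (𝓡 2) x₀ (γ s)) t) =
          (deriv (deriv fun s => extChartAt (𝓡 2) x₀ (γ s)) t) := h1
      rw [h3, metricForm_apply] at h2
      rw [h2]
      ring
  constructor
  · rintro ⟨h1, h2⟩ t
    exact ⟨h1 t, fun x₀ ht => (key x₀ t (h1 t) ht).1 (h2 x₀ t ht)⟩
  · intro h
    exact ⟨fun t => (h t).1, fun x₀ t ht => (key x₀ t (h t).1 ht).2 ((h t).2 x₀ ht)⟩

theorem velocity_congr (h : γ =ᶠ[𝓝 t] β) : velocity γ t = velocity β t := by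
  unfold velocity
  rw [h.mfderiv_eq, h.eq_of_nhds]

theorem velocity_eventuallyEq (h : γ =ᶠ[𝓝 t] β) : velocity γ =ᶠ[𝓝 t] velocity β :=
  h.eventuallyEq_nhds.mono fun _ hs => velocity_congr hs

theorem IsGeodesicAt.congr (hγ : IsGeodesicAt γ t) (h : γ =ᶠ[𝓝 t] β) : IsGeodesicAt β t := by
  refine ⟨hγ.1.congr_of_eventuallyEq h.symm, fun x₀ ht => ?_⟩
  rw [← h.eq_of_nhds] at ht
  rw [← velocity_congr h]
  refine (hγ.2 x₀ ht).congr_of_eventuallyEq ?_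
  filter_upwards [velocity_eventuallyEq h] with s hs
  rw [hs]

end Curves

end ManifoldGeodesics

/-! ### The geodesic field under isometries. -/

section FlatTransition

attribute [-instance]
  Bundle.instNormedAddCommGroupOfRiemannianBundleOfIsTopologicalAddGroupOfContinuousConstSMulReal
  Bundle.instInnerProductSpaceReal

variable {E : Type*} [NormedAddCommGroup E] [NormedSpace ℝ E] [FiniteDimensional ℝ E]

/-- The chain rule produces the second derivative of `ψ`, which `spray_of_isometry` combines with
the old spray into the new one. -/
theorem IsSmoothMetricOn.hasDerivAt_transition {G G' : E → E →L[ℝ] E →L[ℝ] ℝ} {U U' : Set E}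
    (hG : IsSmoothMetricOn G U) (hG' : IsSmoothMetricOn G' U') {ψ : E → E} {Y : ℝ → E × E} {t : ℝ}
    (hz : (Y t).1 ∈ U) (hz' : ψ (Y t).1 ∈ U') (hψ : ContDiffAt ℝ 2 ψ (Y t).1)
    (hsurj : Function.Surjective (fderiv ℝ ψ (Y t).1))
    (hiso : ∀ᶠ y in 𝓝 (Y t).1, ∀ u v, G y u v = G' (ψ y) (fderiv ℝ ψ y u) (fderiv ℝ ψ y v))
    (hY : HasDerivAt Y (geodesicField G (Y t)) t) :
    HasDerivAt (fun s => (ψ (Y s).1, fderiv ℝ ψ (Y s).1 (Y s).2))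
      (geodesicField G' (ψ (Y t).1, fderiv ℝ ψ (Y t).1 (Y t).2)) t := by
  have hc : HasDerivAt (fun s => (Y s).1) (Y t).2 t := hY.fst
  have hv : HasDerivAt (fun s => (Y s).2) (spray G (Y t).1 (Y t).2) t := hY.snd
  have e1 : HasDerivAt (fun s => ψ (Y s).1) (fderiv ℝ ψ (Y t).1 (Y t).2) t :=
    (hψ.differentiableAt (by simp)).hasFDerivAt.comp_hasDerivAt t hc
  have hd : DifferentiableAt ℝ (fderiv ℝ ψ) (Y t).1 :=
    (hψ.fderiv_right (m := 1) (by norm_num)).differentiableAt (by simp)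
  have e2 : HasDerivAt (fun s => fderiv ℝ ψ (Y s).1)
      (fderiv ℝ (fderiv ℝ ψ) (Y t).1 (Y t).2) t := hd.hasFDerivAt.comp_hasDerivAt t hc
  have e3 : HasDerivAt (fun s => fderiv ℝ ψ (Y s).1 (Y s).2)
      (fderiv ℝ (fderiv ℝ ψ) (Y t).1 (Y t).2 (Y t).2
        + fderiv ℝ ψ (Y t).1 (spray G (Y t).1 (Y t).2)) t := e2.clm_apply hv
  rw [hG.spray_of_isometry hG' hz hz' hψ hsurj hiso (Y t).2] at e3
  exact e1.prodMk e3

end FlatTransition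

/-! ### Independence of the chart; reparametrization and speed. -/

section ChartInvariance

variable {M : Type*} [MetricSpace M] [ChartedSpace Plane M] [IsManifold (𝓡 2) ∞ M]
  [RiemannianBundle (fun x : M => TangentSpace (𝓡 2) x)]
  [IsContMDiffRiemannianBundle (𝓡 2) ∞ Plane (fun x : M => TangentSpace (𝓡 2) x)]

/-- The transition map from the chart at `x₀` to the chart at `x₁`. -/
noncomputable def chartTransition (x₀ x₁ : M) (z : Plane) : Plane :=
  extChartAt (𝓡 2) x₁ ((extChartAt (𝓡 2) x₀).symm z)

theorem contMDiffAt_extChartAt_symm {x₀ : M} {z : Plane} (hz : z ∈ (extChartAt (𝓡 2) x₀).target) :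
    ContMDiffAt 𝓘(ℝ, Plane) (𝓡 2) ∞ (extChartAt (𝓡 2) x₀).symm z :=
  (contMDiffOn_extChartAt_symm x₀).contMDiffAt ((isOpen_extChartAt_target x₀).mem_nhds hz)

theorem contDiffAt_chartTransition {x₀ x₁ : M} {z : Plane}
    (hz : z ∈ (extChartAt (𝓡 2) x₀).target)
    (h₁ : (extChartAt (𝓡 2) x₀).symm z ∈ (chartAt Plane x₁).source) :
    ContDiffAt ℝ ∞ (chartTransition x₀ x₁) z := by
  rw [← contMDiffAt_iff_contDiffAt]
  exact (contMDiffAt_extChartAt' h₁).comp z (contMDiffAt_extChartAt_symm hz)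

theorem hasFDerivAt_chartTransition {x₀ x₁ : M} {z : Plane}
    (hz : z ∈ (extChartAt (𝓡 2) x₀).target)
    (h₁ : (extChartAt (𝓡 2) x₀).symm z ∈ (chartAt Plane x₁).source) :
    HasFDerivAt (chartTransition x₀ x₁)
      ((chartCoord x₁ ((extChartAt (𝓡 2) x₀).symm z)).comp (chartSymmDeriv x₀ z)) z := by
  have h1 : MDifferentiableAt (𝓡 2) 𝓘(ℝ, Plane) (extChartAt (𝓡 2) x₁)
      ((extChartAt (𝓡 2) x₀).symm z) := mdifferentiableAt_extChartAt h₁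
  have h2 : MDifferentiableAt 𝓘(ℝ, Plane) (𝓡 2) (extChartAt (𝓡 2) x₀).symm z :=
    (contMDiffAt_extChartAt_symm hz).mdifferentiableAt (by simp)
  exact (h1.hasMFDerivAt.comp z h2.hasMFDerivAt).hasFDerivAt

theorem chartMetric_chartTransition {x₀ x₁ : M} {z : Plane}
    (hz : z ∈ (extChartAt (𝓡 2) x₀).target)
    (h₁ : (extChartAt (𝓡 2) x₀).symm z ∈ (chartAt Plane x₁).source) (u v : Plane) :
    metricForm x₀ z u v = metricForm x₁ (chartTransition x₀ x₁ z)
      (fderiv ℝ (chartTransition x₀ x₁) z u) (fderiv ℝ (chartTransition x₀ x₁) z v) := by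
  rw [(hasFDerivAt_chartTransition hz h₁).fderiv]
  exact (chartMetric_chartCoord h₁ (chartSymmDeriv x₀ z u) (chartSymmDeriv x₀ z v)).symm

theorem surjective_fderiv_chartTransition {x₀ x₁ : M} {z : Plane}
    (hz : z ∈ (extChartAt (𝓡 2) x₀).target)
    (h₁ : (extChartAt (𝓡 2) x₀).symm z ∈ (chartAt Plane x₁).source) :
    Function.Surjective (fderiv ℝ (chartTransition x₀ x₁) z) := by
  rw [(hasFDerivAt_chartTransition hz h₁).fderiv]
  intro u
  obtain ⟨v, hv⟩ := chartCoord_surjective h₁ u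
  refine ⟨chartCoord x₀ _ v, ?_⟩
  rw [← hv]
  exact congrArg _ (chartSymmDeriv_chartCoord x₀ hz v)

/-- The change of coordinates of tangent vectors. -/
noncomputable def tangentTransition (x₀ x₁ : M) (y : Plane × Plane) : Plane × Plane :=
  (chartTransition x₀ x₁ y.1, fderiv ℝ (chartTransition x₀ x₁) y.1 y.2)

theorem tangentTransition_tangentCoord {x₀ x₁ : M} {v : TangentBundle (𝓡 2) M}
    (h₀ : v.1 ∈ (chartAt Plane x₀).source) (h₁ : v.1 ∈ (chartAt Plane x₁).source) :
    tangentTransition x₀ x₁ (tangentCoord x₀ v) = tangentCoord x₁ v := by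
  obtain ⟨x, v⟩ := v
  obtain ⟨z, hz, rfl⟩ : ∃ z ∈ (extChartAt (𝓡 2) x₀).target, (extChartAt (𝓡 2) x₀).symm z = x :=
    ⟨extChartAt (𝓡 2) x₀ x, (extChartAt (𝓡 2) x₀).map_source (by rwa [extChartAt_source]),
      (extChartAt (𝓡 2) x₀).left_inv (by rwa [extChartAt_source])⟩
  unfold tangentTransition tangentCoord chartTransition
  simp only [(extChartAt (𝓡 2) x₀).right_inv hz]
  refine Prod.ext rfl ?_
  change fderiv ℝ (chartTransition x₀ x₁) z _ = _
  rw [(hasFDerivAt_chartTransition hz h₁).fderiv]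
  exact congrArg _ (chartSymmDeriv_chartCoord x₀ hz v)

theorem contDiffAt_tangentTransition {x₀ x₁ : M} {y : Plane × Plane}
    (hz : y.1 ∈ (extChartAt (𝓡 2) x₀).target)
    (h₁ : (extChartAt (𝓡 2) x₀).symm y.1 ∈ (chartAt Plane x₁).source) :
    ContDiffAt ℝ ∞ (tangentTransition x₀ x₁) y := by
  have h := contDiffAt_chartTransition hz h₁
  exact (h.comp y contDiffAt_fst).prodMk
    (((h.fderiv_right (m := ∞) (by simp)).comp y contDiffAt_fst).clm_apply contDiffAt_snd)

theorem eventually_symm_mem_source {x₀ x₁ : M} {z : Plane}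
    (hz : z ∈ (extChartAt (𝓡 2) x₀).target)
    (h₁ : (extChartAt (𝓡 2) x₀).symm z ∈ (chartAt Plane x₁).source) :
    ∀ᶠ y in 𝓝 z, y ∈ (extChartAt (𝓡 2) x₀).target ∧
      (extChartAt (𝓡 2) x₀).symm y ∈ (chartAt Plane x₁).source :=
  ((isOpen_extChartAt_target x₀).eventually_mem hz).and
    ((contMDiffAt_extChartAt_symm hz).continuousAt ((chartAt Plane x₁).open_source.mem_nhds h₁))

section Curves

variable {γ β : ℝ → M} {t : ℝ} {x₀ : M}

/-- Transition maps are isometries of the coordinate metrics, so the geodesic equation transfers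
from one chart to every other one. -/
theorem isGeodesicAt_of_chart (hγ : ContMDiffAt 𝓘(ℝ, ℝ) (𝓡 2) ∞ γ t)
    (ht : γ t ∈ (chartAt Plane x₀).source)
    (h : HasDerivAt (fun s => tangentCoord x₀ (velocity γ s))
      (chartGeodesicField x₀ (tangentCoord x₀ (velocity γ t))) t) : IsGeodesicAt γ t := by
  refine ⟨hγ, fun x₁ ht₁ => ?_⟩
  have heq : (fun s => tangentCoord x₁ (velocity γ s)) =ᶠ[𝓝 t]
      fun s => tangentTransition x₀ x₁ (tangentCoord x₀ (velocity γ s)) := by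
    filter_upwards [hγ.eventually_mem_source ht, hγ.eventually_mem_source ht₁] with s hs hs₁
    exact (tangentTransition_tangentCoord hs hs₁).symm
  have hz : (tangentCoord x₀ (velocity γ t)).1 ∈ (extChartAt (𝓡 2) x₀).target :=
    tangentCoord_fst_mem ht
  have hz' : (tangentCoord x₁ (velocity γ t)).1 ∈ (extChartAt (𝓡 2) x₁).target :=
    tangentCoord_fst_mem ht₁
  have h₁ : (extChartAt (𝓡 2) x₀).symm (tangentCoord x₀ (velocity γ t)).1 ∈
      (chartAt Plane x₁).source := by
    change (extChartAt (𝓡 2) x₀).symm (extChartAt (𝓡 2) x₀ (γ t)) ∈ _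
    rwa [(extChartAt (𝓡 2) x₀).left_inv (by rwa [extChartAt_source])]
  have htr := tangentTransition_tangentCoord (v := velocity γ t) ht ht₁
  refine HasDerivAt.congr_of_eventuallyEq ?_ heq
  rw [← htr] at hz' ⊢
  exact (isSmoothMetricOn_metricForm x₀).hasDerivAt_transition (isSmoothMetricOn_metricForm x₁)
    (Y := fun s => tangentCoord x₀ (velocity γ s)) hz hz'
    (mod_cast contDiffAt_infty.1 (contDiffAt_chartTransition hz h₁) 2) (surjective_fderiv_chartTransition hz h₁)
    ((eventually_symm_mem_source hz h₁).mono fun z hz u v =>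
      chartMetric_chartTransition hz.1 hz.2 u v) h

theorem velocity_comp_affine (k b : ℝ) (hγ : MDifferentiableAt 𝓘(ℝ, ℝ) (𝓡 2) γ (k * t + b)) :
    velocity (fun s => γ (k * s + b)) t =
      ⟨γ (k * t + b), k • (velocity γ (k * t + b)).2⟩ := by
  have hd : HasDerivAt (fun s : ℝ => k * s + b) k t := by
    simpa using ((hasDerivAt_id t).const_mul k).add_const b
  have h := hγ.hasMFDerivAt.comp t hd.hasFDerivAt.hasMFDerivAt
  unfold velocity
  congr 1
  have h2 := congr($h.mfderiv (1 : ℝ))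
  refine h2.trans ?_
  change mfderiv 𝓘(ℝ, ℝ) (𝓡 2) γ (k * t + b) ((ContinuousLinearMap.toSpanSingleton ℝ k) (1 : ℝ)) = _
  rw [ContinuousLinearMap.toSpanSingleton_apply, one_smul]
  have h3 := (mfderiv 𝓘(ℝ, ℝ) (𝓡 2) γ (k * t + b)).map_smul k (1 : ℝ)
  rw [← h3]
  exact congrArg _ (mul_one k).symm

theorem contMDiffAt_comp_affine (k b : ℝ)
    (hγ : ContMDiffAt 𝓘(ℝ, ℝ) (𝓡 2) ∞ γ (k * t + b)) :
    ContMDiffAt 𝓘(ℝ, ℝ) (𝓡 2) ∞ (fun s => γ (k * s + b)) t := by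
  have hd : ContMDiffAt 𝓘(ℝ, ℝ) 𝓘(ℝ, ℝ) ∞ (fun s : ℝ => k * s + b) t := by
    rw [contMDiffAt_iff_contDiffAt]
    fun_prop
  exact hγ.comp t hd

/-- The acceleration scales by `k ^ 2`, as does the spray. The value `k = 0` is allowed and gives
the constant geodesics, around which exponential maps are later expanded. -/
theorem IsGeodesicAt.comp_affine (k b : ℝ) (hγ : IsGeodesicAt γ (k * t + b)) :
    IsGeodesicAt (fun s => γ (k * s + b)) t := by
  have ht : γ (k * t + b) ∈ (chartAt Plane (γ (k * t + b))).source := mem_chart_source _ _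
  set x₀ := γ (k * t + b) with hx₀
  refine isGeodesicAt_of_chart (x₀ := x₀) (contMDiffAt_comp_affine k b hγ.1) ht ?_
  have hd : HasDerivAt (fun s : ℝ => k * s + b) k t := by
    simpa using ((hasDerivAt_id t).const_mul k).add_const b
  have heq : ∀ s, MDifferentiableAt 𝓘(ℝ, ℝ) (𝓡 2) γ (k * s + b) →
      tangentCoord x₀ (velocity (fun s => γ (k * s + b)) s) =
        ((tangentCoord x₀ (velocity γ (k * s + b))).1,
          k • (tangentCoord x₀ (velocity γ (k * s + b))).2) := by
    intro s hs
    rw [velocity_comp_affine k b hs]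
    exact Prod.ext rfl ((chartCoord x₀ (γ (k * s + b))).map_smul k _)
  have hev : ∀ᶠ s in 𝓝 t, MDifferentiableAt 𝓘(ℝ, ℝ) (𝓡 2) γ (k * s + b) :=
    hd.continuousAt.eventually hγ.1.eventually_mdifferentiableAt
  rw [heq t (hγ.1.mdifferentiableAt (by simp))]
  refine HasDerivAt.congr_of_eventuallyEq ?_ (hev.mono heq)
  have h := HasDerivAt.scomp t (hγ.2 x₀ ht) hd
  set y := tangentCoord x₀ (velocity γ (k * t + b)) with hy
  have h1 : HasDerivAt (fun s => (tangentCoord x₀ (velocity γ (k * s + b))).1) (k • y.2) t := h.fst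
  have h2 : HasDerivAt (fun s => (tangentCoord x₀ (velocity γ (k * s + b))).2)
    (k • spray (metricForm x₀) y.1 y.2) t := h.snd
  refine (h1.prodMk (h2.const_smul k)).congr_deriv (Prod.ext rfl ?_)
  have := (isSmoothMetricOn_metricForm x₀).spray_smul
    (tangentCoord_fst_mem (v := velocity γ (k * t + b)) ht) k y.2
  refine Eq.trans ?_ this.symm
  rw [smul_smul, sq]

theorem IsGeodesicAt.hasDerivAt_speed_sq (hγ : ∀ᶠ s in 𝓝 t, IsGeodesicAt γ s) :
    HasDerivAt (fun s => ‖(velocity γ s).2‖ ^ 2) 0 t := by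
  have ht : γ t ∈ (chartAt Plane (γ t)).source := mem_chart_source _ _
  set x₀ := γ t with hx₀
  have h := hγ.self_of_nhds.2 x₀ ht
  have hev : (fun s => ‖(velocity γ s).2‖ ^ 2) =ᶠ[𝓝 t] fun s =>
      metricForm x₀ (tangentCoord x₀ (velocity γ s)).1 (tangentCoord x₀ (velocity γ s)).2
        (tangentCoord x₀ (velocity γ s)).2 := by
    filter_upwards [hγ.self_of_nhds.1.eventually_mem_source ht] with s hs
    exact (metricForm_tangentCoord hs).symm
  refine HasDerivAt.congr_of_eventuallyEq ?_ hev
  exact (isSmoothMetricOn_metricForm x₀).hasDerivAt_speed_sq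
    (tangentCoord_fst_mem (v := velocity γ t) ht) h.fst h.snd

theorem norm_velocity_eq_of_isGeodesicAt {a b s : ℝ} (hγ : ∀ t ∈ Ioo a b, IsGeodesicAt γ t)
    (ht : t ∈ Ioo a b) (hs : s ∈ Ioo a b) : ‖(velocity γ t).2‖ = ‖(velocity γ s).2‖ := by
  have h : ∀ t ∈ Ioo a b, HasDerivAt (fun s => ‖(velocity γ s).2‖ ^ 2) 0 t := fun t ht =>
    IsGeodesicAt.hasDerivAt_speed_sq ((isOpen_Ioo.eventually_mem ht).mono hγ)
  have := isOpen_Ioo.is_const_of_deriv_eq_zero isPreconnected_Ioo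
    (fun t ht => (h t ht).differentiableAt.differentiableWithinAt) (fun t ht => (h t ht).deriv) ht hs
  exact (sq_eq_sq₀ (norm_nonneg _) (norm_nonneg _)).1 this

end Curves

end ChartInvariance

/-! ### Smoothness of ODE solutions in time. -/

section SmoothSolutions

attribute [-instance]
  Bundle.instNormedAddCommGroupOfRiemannianBundleOfIsTopologicalAddGroupOfContinuousConstSMulReal
  Bundle.instInnerProductSpaceReal

theorem contDiffOn_Ioo_of_hasDerivAt {E : Type*} [NormedAddCommGroup E] [NormedSpace ℝ E]
    [CompleteSpace E] {V : E → E} {U : Set E} (hV : ContDiffOn ℝ ∞ V U) {Y : ℝ → E} {a b : ℝ}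
    (hY : ∀ t ∈ Ioo a b, HasDerivAt Y (V (Y t)) t ∧ Y t ∈ U) : ContDiffOn ℝ ∞ Y (Ioo a b) := by
  intro t ht
  apply ContDiffAt.contDiffWithinAt
  obtain ⟨c, hc⟩ := exists_between ht.1
  obtain ⟨d, hd⟩ := exists_between ht.2
  have hsub : Icc c d ⊆ Ioo a b := fun s hs => ⟨hc.1.trans_le hs.1, hs.2.trans_lt hd.2⟩
  refine (ODE.contDiffOn_enat_Icc_of_hasDerivWithinAt (n := ⊤) (f := fun _ => V) (u := U)
    (hV.comp contDiffOn_snd fun p hp => hp.2)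
    (fun s hs => (hY s (hsub hs)).1.hasDerivWithinAt) fun s hs => (hY s (hsub hs)).2).contDiffAt
    (Icc_mem_nhds hc.2 hd.1)

end SmoothSolutions

/-! ### Local existence, uniqueness and flow of geodesics. -/

section GeodesicFlow

variable {M : Type*} [MetricSpace M] [ChartedSpace Plane M] [IsManifold (𝓡 2) ∞ M]
  [RiemannianBundle (fun x : M => TangentSpace (𝓡 2) x)]
  [IsContMDiffRiemannianBundle (𝓡 2) ∞ Plane (fun x : M => TangentSpace (𝓡 2) x)]

variable {γ β : ℝ → M} {t a b : ℝ} {x₀ : M}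

/-- Solutions are smooth by bootstrapping, and the first component of the system says that the
second coordinate really is the velocity of the curve. -/
theorem isGeodesicAt_of_solution (x₀ : M) {Y : ℝ → Plane × Plane}
    (hY : ∀ t ∈ Ioo a b, HasDerivAt Y (chartGeodesicField x₀ (Y t)) t ∧
      (Y t).1 ∈ (extChartAt (𝓡 2) x₀).target) (ht : t ∈ Ioo a b) :
    IsGeodesicAt (fun t => (extChartAt (𝓡 2) x₀).symm (Y t).1) t ∧
      (extChartAt (𝓡 2) x₀).symm (Y t).1 ∈ (chartAt Plane x₀).source ∧
      tangentCoord x₀ (velocity (fun t => (extChartAt (𝓡 2) x₀).symm (Y t).1) t) = Y t := by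
  have hsm : ContDiffOn ℝ ∞ Y (Ioo a b) :=
    contDiffOn_Ioo_of_hasDerivAt (contDiffOn_chartGeodesicField x₀)
      fun t ht => ⟨(hY t ht).1, (hY t ht).2, mem_univ _⟩
  have hγ : ∀ t ∈ Ioo a b,
      ContMDiffAt 𝓘(ℝ, ℝ) (𝓡 2) ∞ (fun t => (extChartAt (𝓡 2) x₀).symm (Y t).1) t := by
    intro t ht
    have h1 : ContMDiffAt 𝓘(ℝ, ℝ) 𝓘(ℝ, Plane) ∞ (fun t => (Y t).1) t :=
      (hsm.contDiffAt (isOpen_Ioo.mem_nhds ht)).fst.contMDiffAt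
    exact (contMDiffAt_extChartAt_symm (hY t ht).2).comp t h1
  have hs : ∀ t ∈ Ioo a b, (extChartAt (𝓡 2) x₀).symm (Y t).1 ∈ (chartAt Plane x₀).source := by
    intro t ht
    have := (extChartAt (𝓡 2) x₀).map_target (hY t ht).2
    rwa [extChartAt_source] at this
  have heq : ∀ t ∈ Ioo a b,
      tangentCoord x₀ (velocity (fun t => (extChartAt (𝓡 2) x₀).symm (Y t).1) t) = Y t := by
    intro t ht
    rw [tangentCoord_velocity_eq ((hγ t ht).mdifferentiableAt (by simp)) (hs t ht)]
    have hd : HasDerivAt (fun t => (Y t).1) (Y t).2 t := (hY t ht).1.fst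
    have hev : (fun s => extChartAt (𝓡 2) x₀ ((extChartAt (𝓡 2) x₀).symm (Y s).1)) =ᶠ[𝓝 t]
        fun s => (Y s).1 := by
      filter_upwards [isOpen_Ioo.mem_nhds ht] with s hs
      exact (extChartAt (𝓡 2) x₀).right_inv (hY s hs).2
    refine Prod.ext hev.eq_of_nhds ?_
    exact hev.deriv_eq.trans hd.deriv
  refine ⟨isGeodesicAt_of_chart (x₀ := x₀) (hγ t ht) (hs t ht) ?_, hs t ht, heq t ht⟩
  rw [heq t ht]
  refine (hY t ht).1.congr_of_eventuallyEq ?_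
  filter_upwards [isOpen_Ioo.mem_nhds ht] with s hs using heq s hs

theorem eventuallyEq_of_velocity_eq (hγ : ∀ᶠ s in 𝓝 t, IsGeodesicAt γ s)
    (hβ : ∀ᶠ s in 𝓝 t, IsGeodesicAt β s) (h : velocity γ t = velocity β t) : γ =ᶠ[𝓝 t] β := by
  have hγβ : γ t = β t := congrArg TotalSpace.proj h
  have ht : γ t ∈ (chartAt Plane (γ t)).source := mem_chart_source _ _
  set x₀ := γ t with hx₀
  have ht' : β t ∈ (chartAt Plane x₀).source := by rwa [← hγβ]
  set y := tangentCoord x₀ (velocity γ t) with hy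
  have hV : ContDiffAt ℝ 1 (chartGeodesicField x₀) y :=
    (contDiffAt_chartGeodesicField x₀ (tangentCoord_fst_mem (v := velocity γ t) ht)).of_le (by simp)
  obtain ⟨K, s, hs, hK⟩ := hV.exists_lipschitzOnWith
  have h1 : ∀ᶠ r in 𝓝 t, tangentCoord x₀ (velocity γ r) ∈ s :=
    (hγ.self_of_nhds.2 x₀ ht).continuousAt hs
  have h2 : ∀ᶠ r in 𝓝 t, tangentCoord x₀ (velocity β r) ∈ s := by
    refine (hβ.self_of_nhds.2 x₀ ht').continuousAt ?_
    rw [← h]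
    exact hs
  have hsγ := hγ.self_of_nhds.1.eventually_mem_source ht
  have hsβ := hβ.self_of_nhds.1.eventually_mem_source ht'
  have := ODE_solution_unique_of_eventually (v := fun _ => chartGeodesicField x₀) (s := fun _ => s)
    (f := fun r => tangentCoord x₀ (velocity γ r)) (g := fun r => tangentCoord x₀ (velocity β r))
    (Eventually.of_forall fun _ => hK)
    (by filter_upwards [hγ, h1, hsγ] with r hr hr1 hr2 using ⟨hr.2 x₀ hr2, hr1⟩)
    (by filter_upwards [hβ, h2, hsβ] with r hr hr1 hr2 using ⟨hr.2 x₀ hr2, hr1⟩) (by rw [h])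
  filter_upwards [this, hsγ, hsβ] with r hr hr1 hr2
  exact congrArg TotalSpace.proj (tangentCoord_injOn x₀ (v := velocity γ r) (w := velocity β r)
    hr1 hr2 hr)

/-- The set of times near which the curves agree is open, and relatively closed because positions
and velocities agree at limit times, where local uniqueness applies again. -/
theorem eqOn_Ioo_of_velocity_eq (hγ : ∀ s ∈ Ioo a b, IsGeodesicAt γ s)
    (hβ : ∀ s ∈ Ioo a b, IsGeodesicAt β s) (ht : t ∈ Ioo a b)
    (h : velocity γ t = velocity β t) : EqOn γ β (Ioo a b) := by
  have hγ' : ∀ s ∈ Ioo a b, ∀ᶠ r in 𝓝 s, IsGeodesicAt γ r := fun s hs =>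
    (isOpen_Ioo.eventually_mem hs).mono hγ
  have hβ' : ∀ s ∈ Ioo a b, ∀ᶠ r in 𝓝 s, IsGeodesicAt β r := fun s hs =>
    (isOpen_Ioo.eventually_mem hs).mono hβ
  have hsub := isPreconnected_Ioo.subset_of_closure_inter_subset (s := Ioo a b)
    (u := {s | γ =ᶠ[𝓝 s] β}) isOpen_setOfPred_eventually_nhds
    ⟨t, ht, eventuallyEq_of_velocity_eq (hγ' t ht) (hβ' t ht) h⟩ ?_
  · exact fun s hs => (hsub hs).eq_of_nhds
  · rintro s ⟨hs, hsI⟩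
    have hfr : ∃ᶠ r in 𝓝 s, γ =ᶠ[𝓝 r] β := mem_closure_iff_frequently.1 hs
    have hγs := hγ s hsI
    have hβs := hβ s hsI
    have heq : γ s = β s := tendsto_nhds_unique_of_frequently_eq hγs.1.continuousAt
      hβs.1.continuousAt (hfr.mono fun r hr => hr.eq_of_nhds)
    have hsrc : γ s ∈ (chartAt Plane (γ s)).source := mem_chart_source _ _
    set x₀ := γ s with hx₀
    have hsrc' : β s ∈ (chartAt Plane x₀).source := by rwa [← heq]
    have hc : tangentCoord x₀ (velocity γ s) = tangentCoord x₀ (velocity β s) :=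
      tendsto_nhds_unique_of_frequently_eq (hγs.2 x₀ hsrc).continuousAt
        (hβs.2 x₀ hsrc').continuousAt (hfr.mono fun r hr => by rw [velocity_congr hr])
    exact eventuallyEq_of_velocity_eq (hγ' s hsI) (hβ' s hsI)
      (tangentCoord_injOn x₀ (v := velocity γ s) (w := velocity β s) hsrc hsrc' hc)

theorem IsGeodesic.eq_of_velocity_eq (hγ : IsGeodesic γ) (hβ : IsGeodesic β)
    (h : velocity γ t = velocity β t) : γ = β := by
  rw [isGeodesic_iff] at hγ hβ
  ext s
  exact eqOn_Ioo_of_velocity_eq (a := min s t - 1) (b := max s t + 1) (fun s _ => hγ s)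
    (fun s _ => hβ s) (t := t) ⟨by linarith [min_le_right s t], by linarith [le_max_right s t]⟩ h
    ⟨by linarith [min_le_left s t], by linarith [le_max_left s t]⟩

theorem IsGeodesic.comp_affine (hγ : IsGeodesic γ) (k b : ℝ) :
    IsGeodesic fun s => γ (k * s + b) := by
  rw [isGeodesic_iff] at hγ ⊢
  exact fun s => (hγ _).comp_affine k b

theorem IsGeodesic.comp_add (hγ : IsGeodesic γ) (b : ℝ) : IsGeodesic fun s => γ (s + b) := by
  simpa using hγ.comp_affine 1 b

theorem IsGeodesic.mdifferentiableAt (hγ : IsGeodesic γ) (t : ℝ) :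
    MDifferentiableAt 𝓘(ℝ, ℝ) (𝓡 2) γ t := (hγ.1 t).mdifferentiableAt (by simp)

theorem IsGeodesic.continuous (hγ : IsGeodesic γ) : Continuous γ := hγ.1.continuous

theorem velocity_comp_add (b : ℝ) (hγ : MDifferentiableAt 𝓘(ℝ, ℝ) (𝓡 2) γ (t + b)) :
    velocity (fun s => γ (s + b)) t = velocity γ (t + b) := by
  have := velocity_comp_affine (γ := γ) (t := t) 1 b (by simpa using hγ)
  simp only [one_smul] at this
  rw [one_mul] at this
  simp only [one_mul] at this
  exact this

theorem IsGeodesic.norm_velocity_eq (hγ : IsGeodesic γ) (s t : ℝ) :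
    ‖(velocity γ s).2‖ = ‖(velocity γ t).2‖ := by
  rw [isGeodesic_iff] at hγ
  exact norm_velocity_eq_of_isGeodesicAt (a := min s t - 1) (b := max s t + 1) (fun s _ => hγ s)
    ⟨by linarith [min_le_left s t], by linarith [le_max_left s t]⟩
    ⟨by linarith [min_le_right s t], by linarith [le_max_right s t]⟩

/-- The local geodesic flow in a chart, `C¹` in the initial condition. -/
theorem exists_local_geodesic_flow (p : M) {y₀ : Plane × Plane}
    (hy₀ : y₀.1 ∈ (extChartAt (𝓡 2) p).target) :
    ∃ r > 0, ∃ ε > 0, ∃ Φ : Plane × Plane → ℝ → Plane × Plane,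
      (∀ t ∈ Ioo (-ε) ε, ContDiffOn ℝ 1 (fun y => Φ y t) (Metric.ball y₀ r)) ∧
      ∀ y ∈ Metric.ball y₀ r, Φ y 0 = y ∧ ∃ β : ℝ → M, ∀ t ∈ Ioo (-ε) ε,
        IsGeodesicAt β t ∧ β t ∈ (chartAt Plane p).source ∧
          tangentCoord p (velocity β t) = Φ y t := by
  have hN : (extChartAt (𝓡 2) p).target ×ˢ (univ : Set Plane) ∈ 𝓝 y₀ :=
    ((isOpen_extChartAt_target p).prod isOpen_univ).mem_nhds ⟨hy₀, mem_univ _⟩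
  have hV : ContDiffAt ℝ 2 (chartGeodesicField p) y₀ :=
    mod_cast contDiffAt_infty.1 (contDiffAt_chartGeodesicField p hy₀) 2
  obtain ⟨r, hr, ε, hε, Φ, hΦ, hΦc⟩ := hV.exists_contDiffOn_flow hN
  refine ⟨r, hr, ε, hε, Φ, hΦc, fun y hy => ⟨(hΦ y hy).1, _, fun t ht =>
    isGeodesicAt_of_solution p (fun t ht => ⟨((hΦ y hy).2 t ht).1, ((hΦ y hy).2 t ht).2.1⟩) ht⟩⟩

/-- Curves with the velocity of a local flow line follow it. -/
theorem IsGeodesic.follow (hγ : IsGeodesic γ) {ε : ℝ} (hε : 0 < ε)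
    (hβ : ∀ t ∈ Ioo (-ε) ε, IsGeodesicAt β t) (h : velocity γ a = velocity β 0)
    (ht : t ∈ Ioo (-ε) ε) : γ (a + t) = β t ∧ velocity γ (a + t) = velocity β t := by
  have hγ' : IsGeodesic fun s => γ (s + a) := hγ.comp_add a
  have hv : velocity (fun s => γ (s + a)) 0 = velocity β 0 := by
    rw [velocity_comp_add a (hγ.mdifferentiableAt _), zero_add, h]
  have heq := eqOn_Ioo_of_velocity_eq (a := -ε) (b := ε) (t := 0)
    (fun s _ => (isGeodesic_iff.1 hγ') s) hβ ⟨by linarith, hε⟩ hv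
  refine ⟨by rw [add_comm]; exact heq ht, ?_⟩
  rw [add_comm, ← velocity_comp_add a (hγ.mdifferentiableAt _)]
  exact velocity_congr (heq.eventuallyEq_of_mem (isOpen_Ioo.mem_nhds ht))

end GeodesicFlow

/-! ### Geodesic completeness of compact surfaces. -/

section GeodesicExistence

variable {M : Type*} [MetricSpace M] [ChartedSpace Plane M] [IsManifold (𝓡 2) ∞ M]
  [RiemannianBundle (fun x : M => TangentSpace (𝓡 2) x)]
  [IsContMDiffRiemannianBundle (𝓡 2) ∞ Plane (fun x : M => TangentSpace (𝓡 2) x)]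

theorem exists_extChartAt_closedBall (p : M) :
    ∃ ρ > 0, Metric.closedBall (extChartAt (𝓡 2) p p) ρ ⊆ (extChartAt (𝓡 2) p).target :=
  Metric.nhds_basis_closedBall.mem_iff.1
    ((isOpen_extChartAt_target p).mem_nhds (mem_extChartAt_target p))

theorem continuousAt_extChartAt_self (p : M) : ContinuousAt (extChartAt (𝓡 2) p) p :=
  continuousAt_extChartAt p

/-- Bounded sequences of tangent vectors subconverge. -/
theorem exists_subseq_tangentCoord_tendsto [CompactSpace M] (v : ℕ → TangentBundle (𝓡 2) M)
    (hv : ∀ n, ‖(v n).2‖ = 1) :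
    ∃ (w : TangentBundle (𝓡 2) M) (φ : ℕ → ℕ), ‖w.2‖ = 1 ∧ StrictMono φ ∧
      (∀ᶠ n in atTop, (v (φ n)).1 ∈ (chartAt Plane w.1).source) ∧
      Tendsto (fun n => (v (φ n)).1) atTop (𝓝 w.1) ∧
      Tendsto (fun n => tangentCoord w.1 (v (φ n))) atTop (𝓝 (tangentCoord w.1 w)) := by
  obtain ⟨p, φ, hφ, hp⟩ := CompactSpace.tendsto_subseq fun n => (v n).1
  obtain ⟨ρ, hρ, hball⟩ := exists_extChartAt_closedBall p
  have hG := isSmoothMetricOn_metricForm p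
  obtain ⟨lam, C, hB⟩ := hG.exists_metricBounds (isCompact_closedBall _ ρ)
    (convex_closedBall _ _) hball
  have hsrc : ∀ᶠ n in atTop, (v (φ n)).1 ∈ (chartAt Plane p).source :=
    hp ((chartAt Plane p).open_source.mem_nhds (mem_chart_source _ p))
  have hpos : Tendsto (fun n => extChartAt (𝓡 2) p (v (φ n)).1) atTop
      (𝓝 (extChartAt (𝓡 2) p p)) := (continuousAt_extChartAt_self p).tendsto.comp hp
  -- Unit vectors have bounded coordinates by the uniform lower bound on the metric, so base points
  -- and then directions subconverge.
  have hbd : ∀ᶠ n in atTop, (tangentCoord p (v (φ n))).2 ∈ Metric.closedBall (0 : Plane) √lam⁻¹ := by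
    filter_upwards [hsrc, hpos (Metric.closedBall_mem_nhds _ hρ)] with n hn hn'
    rw [mem_closedBall_zero_iff]
    refine hB.norm_le_of_unit hn' ?_
    have := metricForm_tangentCoord hn
    rw [hv, one_pow] at this
    exact this
  obtain ⟨u, -, ψ, hψ, hu⟩ := (isCompact_closedBall (0 : Plane) √lam⁻¹).tendsto_subseq'
    hbd.frequently
  obtain ⟨w, hw, hwy⟩ := exists_tangentCoord_eq p (y := (extChartAt (𝓡 2) p p, u))
    (mem_extChartAt_target p)
  obtain ⟨q, w⟩ := w
  have hqp : q = p := (extChartAt (𝓡 2) p).injOn (by rwa [extChartAt_source])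
    (by rw [extChartAt_source]; exact mem_chart_source _ p) (congrArg Prod.fst hwy)
  subst hqp
  have htend : Tendsto (fun n => tangentCoord q (v (φ (ψ n)))) atTop
      (𝓝 (tangentCoord q ⟨q, w⟩)) := by
    rw [hwy]
    exact (hpos.comp hψ.tendsto_atTop).prodMk_nhds hu
  refine ⟨⟨q, w⟩, φ ∘ ψ, ?_, hφ.comp hψ, hψ.tendsto_atTop.eventually hsrc,
    hp.comp hψ.tendsto_atTop, htend⟩
  have hcont : ContinuousAt (fun y : Plane × Plane => metricForm q y.1 y.2 y.2)
      (tangentCoord q ⟨q, w⟩) := by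
    have h1 : ContinuousAt (fun y : Plane × Plane => metricForm q y.1) (tangentCoord q ⟨q, w⟩) :=
      ContinuousAt.comp (f := Prod.fst) (g := metricForm q)
        (hG.contDiffAt (tangentCoord_fst_mem (v := ⟨q, w⟩) hw)).continuousAt continuousAt_fst
    exact (h1.clm_apply continuousAt_snd).clm_apply continuousAt_snd
  have h1 := hcont.tendsto.comp htend
  have h2 : ∀ᶠ n in atTop, (1 : ℝ) = ((fun y : Plane × Plane => metricForm q y.1 y.2 y.2) ∘
      fun n => tangentCoord q (v (φ (ψ n)))) n := by
    filter_upwards [hψ.tendsto_atTop.eventually hsrc] with n hn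
    have := metricForm_tangentCoord hn
    rw [hv, one_pow] at this
    exact this.symm
  have h3 := tendsto_nhds_unique (tendsto_const_nhds.congr' h2) h1
  rw [metricForm_tangentCoord (v := ⟨q, w⟩) hw] at h3
  have h4 : (0 : ℝ) ≤ ‖(w : TangentSpace (𝓡 2) q)‖ := norm_nonneg _
  exact (pow_eq_one_iff_of_nonneg h4 two_ne_zero).1 h3.symm

/-- Unit speed geodesics exist for a uniform time. -/
theorem exists_uniform_geodesic_time [CompactSpace M] :
    ∃ ε > 0, ∀ v : TangentBundle (𝓡 2) M, ‖v.2‖ = 1 → ∃ β : ℝ → M,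
      (∀ t ∈ Ioo (-ε) ε, IsGeodesicAt β t) ∧ velocity β 0 = v := by
  by_contra! hcon
  -- If existence times shrank to zero along `v n`, a flow box around a limit vector would contain
  -- some `v n` and give it a longer time.
  choose v hv hno using fun n : ℕ => hcon (1 / (n + 1)) (by positivity)
  obtain ⟨w, φ, -, hφ, hsrc, -, hlim⟩ := exists_subseq_tangentCoord_tendsto v hv
  obtain ⟨r, hr, ε, hε, Φ, -, hΦ⟩ := exists_local_geodesic_flow w.1 (y₀ := tangentCoord w.1 w)
    (tangentCoord_fst_mem (mem_chart_source _ _))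
  have hsmall : ∀ᶠ n : ℕ in atTop, 1 / ((φ n : ℝ) + 1) < ε :=
    (tendsto_one_div_add_atTop_nhds_zero_nat.comp hφ.tendsto_atTop).eventually_lt_const hε
  obtain ⟨n, hn, hnb, hns⟩ := (hsrc.and ((hlim.eventually_mem (Metric.ball_mem_nhds _ hr)).and hsmall)).exists
  obtain ⟨h0, β, hβ⟩ := hΦ _ hnb
  refine hno (φ n) β (fun t ht => (hβ t ⟨by linarith [ht.1], by linarith [ht.2]⟩).1) ?_
  have := hβ 0 ⟨by linarith, hε⟩
  refine tangentCoord_injOn w.1 (v := velocity β 0) this.2.1 hn ?_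
  rw [this.2.2, h0]

/-- Restarting at a time `s` less than `b` by at most `ε / 2` gains at least `ε / 2`. The two pieces
agree near `s` by uniqueness, so the gluing is a geodesic. -/
theorem exists_extend_right {ε a b : ℝ} (hε : 0 < ε)
    (huni : ∀ v : TangentBundle (𝓡 2) M, ‖v.2‖ = 1 → ∃ β : ℝ → M,
      (∀ t ∈ Ioo (-ε) ε, IsGeodesicAt β t) ∧ velocity β 0 = v)
    (ha : a < 0) (hb : 0 < b) {γ : ℝ → M} (hγ : ∀ t ∈ Ioo a b, IsGeodesicAt γ t)
    (h1 : ‖(velocity γ 0).2‖ = 1) :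
    ∃ γ' : ℝ → M, (∀ t ∈ Ioo a (b + ε / 2), IsGeodesicAt γ' t) ∧
      velocity γ' 0 = velocity γ 0 := by
  obtain ⟨s, hs0, hsb, hsε⟩ : ∃ s, 0 < s ∧ s < b ∧ b - ε / 2 ≤ s := by
    refine ⟨max (b - ε / 2) (b / 2), ?_, ?_, le_max_left _ _⟩
    · exact lt_max_of_lt_right (by linarith)
    · exact max_lt (by linarith) (by linarith)
  have hsI : s ∈ Ioo a b := ⟨by linarith, hsb⟩
  obtain ⟨β, hβ, hβ0⟩ := huni (velocity γ s)
    ((norm_velocity_eq_of_isGeodesicAt hγ hsI ⟨ha, hb⟩).trans h1)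
  have hβ' : ∀ t ∈ Ioo (s - ε) (s + ε), IsGeodesicAt (fun t => β (t - s)) t := by
    intro t ht
    have := (hβ (1 * t + -s) ⟨by linarith [ht.1], by linarith [ht.2]⟩).comp_affine 1 (-s)
    simpa [sub_eq_add_neg] using this
  have hvel : velocity γ s = velocity (fun t => β (t - s)) s := by
    have hm : MDifferentiableAt 𝓘(ℝ, ℝ) (𝓡 2) β (s + -s) := by
      rw [add_neg_cancel]
      exact (hβ 0 ⟨by linarith, hε⟩).1.mdifferentiableAt (by simp)
    have := velocity_comp_add (t := s) (-s) hm
    rw [add_neg_cancel, hβ0] at this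
    exact this.symm
  have heq : EqOn γ (fun t => β (t - s)) (Ioo (max a (s - ε)) (min b (s + ε))) :=
    eqOn_Ioo_of_velocity_eq (t := s)
      (fun t ht => hγ t ⟨(le_max_left _ _).trans_lt ht.1, ht.2.trans_le (min_le_left _ _)⟩)
      (fun t ht => hβ' t ⟨(le_max_right _ _).trans_lt ht.1, ht.2.trans_le (min_le_right _ _)⟩)
      ⟨max_lt hsI.1 (by linarith), lt_min hsb (by linarith)⟩ hvel
  set γ' : ℝ → M := fun t => if t < s then γ t else β (t - s) with hγ'
  have hleft : ∀ t < s, γ =ᶠ[𝓝 t] γ' := by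
    intro t ht
    filter_upwards [Iio_mem_nhds ht] with r hr
    rw [hγ']
    exact (if_pos hr).symm
  refine ⟨γ', fun t ht => ?_, (velocity_congr (hleft 0 hs0)).symm⟩
  rcases lt_trichotomy t s with h | h | h
  · exact (hγ t ⟨ht.1, h.trans hsb⟩).congr (hleft t h)
  · subst h
    refine (hγ t hsI).congr ?_
    filter_upwards [Ioo_mem_nhds (max_lt hsI.1 (by linarith) : max a (t - ε) < t)
      (lt_min hsb (by linarith) : t < min b (t + ε))] with r hr
    rw [hγ']
    change _ = if r < t then γ r else β (r - t)
    split_ifs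
    · rfl
    · exact heq hr
  · refine (hβ' t ⟨by linarith, by linarith [ht.2]⟩).congr ?_
    filter_upwards [Ioi_mem_nhds h] with r hr
    rw [hγ']
    exact (if_neg (not_lt.2 (le_of_lt hr))).symm

/-- Multiplication by scalars in the tangent bundle. -/
noncomputable def tangentSmul (k : ℝ) (v : TangentBundle (𝓡 2) M) : TangentBundle (𝓡 2) M := ⟨v.1, k • v.2⟩

theorem norm_tangentSmul (k : ℝ) (v : TangentBundle (𝓡 2) M) :
    ‖(tangentSmul k v).2‖ = |k| * ‖v.2‖ := by
  rw [← Real.norm_eq_abs]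
  exact norm_smul k v.2

theorem tangentSmul_tangentSmul (k m : ℝ) (v : TangentBundle (𝓡 2) M) :
    tangentSmul k (tangentSmul m v) = tangentSmul (k * m) v :=
  congrArg (TotalSpace.mk v.1) (smul_smul k m v.2)

theorem one_tangentSmul (v : TangentBundle (𝓡 2) M) : tangentSmul 1 v = v :=
  congrArg (TotalSpace.mk v.1) (one_smul ℝ v.2)

theorem tangentCoord_tangentSmul (x₀ : M) (k : ℝ) (v : TangentBundle (𝓡 2) M) :
    tangentCoord x₀ (tangentSmul k v) = ((tangentCoord x₀ v).1, k • (tangentCoord x₀ v).2) :=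
  Prod.ext rfl ((chartCoord x₀ v.1).map_smul k v.2)

theorem velocity_comp_affine' {γ : ℝ → M} {t : ℝ} (k b : ℝ)
    (hγ : MDifferentiableAt 𝓘(ℝ, ℝ) (𝓡 2) γ (k * t + b)) :
    velocity (fun s => γ (k * s + b)) t = tangentSmul k (velocity γ (k * t + b)) :=
  velocity_comp_affine k b hγ

theorem velocity_comp_neg {γ : ℝ → M} {t : ℝ} (hγ : MDifferentiableAt 𝓘(ℝ, ℝ) (𝓡 2) γ (-t)) :
    velocity (fun s => γ (-s)) t = tangentSmul (-1) (velocity γ (-t)) := by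
  have := velocity_comp_affine' (γ := γ) (t := t) (-1) 0 (by simpa using hγ)
  simpa using this

theorem IsGeodesicAt.comp_neg {γ : ℝ → M} {t : ℝ} (hγ : IsGeodesicAt γ (-t)) :
    IsGeodesicAt (fun s => γ (-s)) t := by
  have := IsGeodesicAt.comp_affine (γ := γ) (t := t) (-1) 0 (by simpa using hγ)
  simpa using this

theorem IsGeodesic.comp_neg {γ : ℝ → M} (hγ : IsGeodesic γ) : IsGeodesic fun s => γ (-s) := by
  rw [isGeodesic_iff] at hγ ⊢
  exact fun t => (hγ _).comp_neg

/-- Each step extends to the right, reverses time, extends to the right again and reverses back. -/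
theorem exists_geodesic_Ioo [CompactSpace M] {ε : ℝ} (hε : 0 < ε)
    (huni : ∀ v : TangentBundle (𝓡 2) M, ‖v.2‖ = 1 → ∃ β : ℝ → M,
      (∀ t ∈ Ioo (-ε) ε, IsGeodesicAt β t) ∧ velocity β 0 = v) (n : ℕ)
    (v : TangentBundle (𝓡 2) M) (hv : ‖v.2‖ = 1) :
    ∃ γ : ℝ → M, (∀ t ∈ Ioo (-((n + 1) * (ε / 2))) ((n + 1) * (ε / 2)), IsGeodesicAt γ t) ∧
      velocity γ 0 = v := by
  induction n with
  | zero =>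
    obtain ⟨β, hβ, hβ0⟩ := huni v hv
    refine ⟨β, fun t ht => hβ t ?_, hβ0⟩
    simp only [CharP.cast_eq_zero, zero_add, one_mul] at ht
    exact ⟨by linarith [ht.1], by linarith [ht.2]⟩
  | succ n ih =>
    obtain ⟨γ, hγ, hγ0⟩ := ih
    set T := ((n : ℝ) + 1) * (ε / 2) with hT
    have hT0 : 0 < T := by positivity
    obtain ⟨γ₁, hγ₁, hγ₁0⟩ := exists_extend_right hε huni (neg_lt_zero.2 hT0) hT0 hγ
      (by rw [hγ0]; exact hv)
    have hm : MDifferentiableAt 𝓘(ℝ, ℝ) (𝓡 2) γ₁ (-0) := by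
      rw [neg_zero]
      exact (hγ₁ 0 ⟨by linarith, by linarith⟩).1.mdifferentiableAt (by simp)
    have hv1 := velocity_comp_neg hm
    rw [neg_zero] at hv1
    obtain ⟨γ₂, hγ₂, hγ₂0⟩ := exists_extend_right hε huni (a := -(T + ε / 2)) (b := T)
      (γ := fun s => γ₁ (-s)) (by linarith) hT0
      (fun t ht => (hγ₁ (-t) ⟨by linarith [ht.2], by linarith [ht.1]⟩).comp_neg)
      (by rw [hv1, norm_tangentSmul, hγ₁0, hγ0, hv]; simp)
    have hT' : ((n + 1 : ℕ) + 1 : ℝ) * (ε / 2) = T + ε / 2 := by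
      rw [hT]; push_cast; ring
    rw [hT']
    refine ⟨fun s => γ₂ (-s), fun t ht => (hγ₂ (-t)
      ⟨by linarith [ht.2], by linarith [ht.1]⟩).comp_neg, ?_⟩
    have hm2 : MDifferentiableAt 𝓘(ℝ, ℝ) (𝓡 2) γ₂ (-0) := by
      rw [neg_zero]
      exact (hγ₂ 0 ⟨by linarith, by linarith⟩).1.mdifferentiableAt (by simp)
    rw [velocity_comp_neg hm2, neg_zero]
    rw [hγ₂0, hv1, tangentSmul_tangentSmul, hγ₁0, hγ0]
    simpa using one_tangentSmul v

/-- Compact surfaces are geodesically complete. -/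
theorem exists_isGeodesic_velocity_eq [CompactSpace M] (v : TangentBundle (𝓡 2) M)
    (hv : ‖v.2‖ = 1) : ∃ γ : ℝ → M, IsGeodesic γ ∧ velocity γ 0 = v := by
  obtain ⟨ε, hε, huni⟩ := exists_uniform_geodesic_time (M := M)
  choose g hg hg0 using fun n => exists_geodesic_Ioo hε huni n v hv
  have hagree : ∀ m n : ℕ, m ≤ n → ∀ t ∈ Ioo (-(((m : ℝ) + 1) * (ε / 2))) ((m + 1) * (ε / 2)),
      g m t = g n t := by
    intro m n hmn
    have hle : ((m : ℝ) + 1) * (ε / 2) ≤ (n + 1) * (ε / 2) := by gcongr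
    refine eqOn_Ioo_of_velocity_eq (t := 0) (hg m)
      (fun t ht => hg n t ⟨by linarith [ht.1], by linarith [ht.2]⟩) ?_ ((hg0 m).trans (hg0 n).symm)
    have : 0 < ((m : ℝ) + 1) * (ε / 2) := by positivity
    exact ⟨by linarith, this⟩
  have habs : ∀ (t : ℝ), t ∈ Ioo (-(((⌈|t| / (ε / 2)⌉₊ : ℝ) + 1) * (ε / 2)))
      ((⌈|t| / (ε / 2)⌉₊ + 1) * (ε / 2)) := by
    intro t
    rw [mem_Ioo, ← abs_lt]
    have := Nat.le_ceil (|t| / (ε / 2))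
    rw [div_le_iff₀ (by positivity)] at this
    linarith
  -- At each time a geodesic defined long enough is evaluated; by `hagree` all later indices give
  -- the same value, so one fixed `g N` represents `γ` locally.
  set γ : ℝ → M := fun t => g ⌈|t| / (ε / 2)⌉₊ t with hγ
  have hloc : ∀ (t : ℝ), ∃ N : ℕ, g N =ᶠ[𝓝 t] γ ∧ IsGeodesicAt (g N) t := by
    intro t
    set N := ⌈(|t| + 1) / (ε / 2)⌉₊ with hN
    have hlt : ∀ s : ℝ, |s| < |t| + 1 → ⌈|s| / (ε / 2)⌉₊ ≤ N := by
      intro s hs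
      apply Nat.ceil_le_ceil
      gcongr
    refine ⟨N, ?_, hg N t ?_⟩
    · filter_upwards [(continuous_abs.tendsto t).eventually_lt_const
        (by linarith : |t| < |t| + 1)] with s hs
      exact (hagree _ N (hlt s hs) s (habs s)).symm
    · have h1 : ((⌈|t| / (ε / 2)⌉₊ : ℝ) + 1) * (ε / 2) ≤ (N + 1) * (ε / 2) := by
        have := hlt t (by linarith)
        gcongr
      exact ⟨by linarith [(habs t).1], by linarith [(habs t).2]⟩
  refine ⟨γ, isGeodesic_iff.2 fun t => ?_, ?_⟩
  · obtain ⟨N, h1, h2⟩ := hloc t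
    exact h2.congr h1
  · obtain ⟨N, h1, h2⟩ := hloc 0
    rw [← velocity_congr h1, hg0]

end GeodesicExistence

/-! ### Transport of initial data, convergence of geodesics. -/

section Transport

variable {M : Type*} [MetricSpace M] [ChartedSpace Plane M] [IsManifold (𝓡 2) ∞ M]
  [RiemannianBundle (fun x : M => TangentSpace (𝓡 2) x)]
  [IsContMDiffRiemannianBundle (𝓡 2) ∞ Plane (fun x : M => TangentSpace (𝓡 2) x)]

/-- In the charts at `x₀` and `x₁`, the velocity at time `b` of geodesics near `γ` is a `C¹`
function of their velocity at time `a`. -/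
def Transports (x₀ x₁ : M) (γ : ℝ → M) (a b : ℝ) : Prop :=
  ∃ Ψ : Plane × Plane → Plane × Plane,
    ContDiffAt ℝ 1 Ψ (tangentCoord x₀ (velocity γ a)) ∧
    Ψ (tangentCoord x₀ (velocity γ a)) = tangentCoord x₁ (velocity γ b) ∧
    ∀ᶠ y in 𝓝 (tangentCoord x₀ (velocity γ a)), ∀ β : ℝ → M, IsGeodesic β →
      β a ∈ (chartAt Plane x₀).source → tangentCoord x₀ (velocity β a) = y →
        β b ∈ (chartAt Plane x₁).source ∧ tangentCoord x₁ (velocity β b) = Ψ y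

variable {γ : ℝ → M} {x₀ x₁ x₂ : M} {a b c : ℝ}

theorem Transports.trans (h₁ : Transports x₀ x₁ γ a b) (h₂ : Transports x₁ x₂ γ b c) :
    Transports x₀ x₂ γ a c := by
  obtain ⟨Ψ₁, hc₁, he₁, hΨ₁⟩ := h₁
  obtain ⟨Ψ₂, hc₂, he₂, hΨ₂⟩ := h₂
  rw [← he₁] at hc₂ hΨ₂
  refine ⟨Ψ₂ ∘ Ψ₁, hc₂.comp _ hc₁, by rw [Function.comp_apply, he₁, he₂], ?_⟩
  filter_upwards [hΨ₁, hc₁.continuousAt.eventually hΨ₂] with y hy₁ hy₂ β hβ hβa hβy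
  obtain ⟨h1, h2⟩ := hy₁ β hβ hβa hβy
  exact hy₂ β hβ h1 h2

theorem transports_change_chart (h₀ : γ a ∈ (chartAt Plane x₀).source)
    (h₁ : γ a ∈ (chartAt Plane x₁).source) : Transports x₀ x₁ γ a a := by
  have hz : (tangentCoord x₀ (velocity γ a)).1 ∈ (extChartAt (𝓡 2) x₀).target :=
    tangentCoord_fst_mem (v := velocity γ a) h₀
  have hz₁ : (extChartAt (𝓡 2) x₀).symm (tangentCoord x₀ (velocity γ a)).1 ∈
      (chartAt Plane x₁).source := by
    change (extChartAt (𝓡 2) x₀).symm (extChartAt (𝓡 2) x₀ (γ a)) ∈ _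
    rwa [(extChartAt (𝓡 2) x₀).left_inv (by rwa [extChartAt_source])]
  refine ⟨tangentTransition x₀ x₁, (contDiffAt_tangentTransition hz hz₁).of_le (by simp),
    tangentTransition_tangentCoord (v := velocity γ a) h₀ h₁, ?_⟩
  filter_upwards [continuousAt_fst.eventually (eventually_symm_mem_source hz hz₁)]
    with y hy β hβ hβa hβy
  have h2 : β a ∈ (chartAt Plane x₁).source := by
    have := hy.2
    rw [← hβy] at this
    change (extChartAt (𝓡 2) x₀).symm (extChartAt (𝓡 2) x₀ (β a)) ∈ _ at this
    rwa [(extChartAt (𝓡 2) x₀).left_inv (by rwa [extChartAt_source])] at this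
  exact ⟨h2, by rw [← hβy]; exact (tangentTransition_tangentCoord (v := velocity β a) hβa h2).symm⟩

/-- A single flow box around the velocity at `b` serves all nearby starting times, since the flow
depends only on the elapsed time. -/
theorem IsGeodesic.exists_transports_near (hγ : IsGeodesic γ) (b : ℝ) :
    ∀ᶠ δ in 𝓝[>] (0 : ℝ), ∀ s ∈ Metric.ball b δ, ∀ t ∈ Metric.ball b δ,
      γ s ∈ (chartAt Plane (γ b)).source ∧ Transports (γ b) (γ b) γ s t := by
  have hsrc : γ b ∈ (chartAt Plane (γ b)).source := mem_chart_source _ _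
  set p := γ b with hp
  obtain ⟨r, hr, ε, hε, Φ, hΦc, hΦ⟩ := exists_local_geodesic_flow p
    (y₀ := tangentCoord p (velocity γ b)) (tangentCoord_fst_mem (v := velocity γ b) hsrc)
  have hev : ∀ᶠ s in 𝓝 b, γ s ∈ (chartAt Plane p).source ∧
      tangentCoord p (velocity γ s) ∈ Metric.ball (tangentCoord p (velocity γ b)) r :=
    ((hγ.1 b).eventually_mem_source hsrc).and
      (((isGeodesic_iff.1 hγ b).2 p hsrc).continuousAt.eventually_mem (Metric.ball_mem_nhds _ hr))
  obtain ⟨δ₀, hδ₀, hball⟩ := Metric.eventually_nhds_iff_ball.1 hev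
  filter_upwards [Ioo_mem_nhdsGT (lt_min hδ₀ (half_pos hε))] with δ hδ s hs t ht
  have hδ1 : δ < δ₀ := hδ.2.trans_le (min_le_left _ _)
  have hδ2 : δ < ε / 2 := hδ.2.trans_le (min_le_right _ _)
  have hs' := hball s (Metric.ball_subset_ball hδ1.le hs)
  have hts : t - s ∈ Ioo (-ε) ε := by
    rw [Metric.mem_ball, Real.dist_eq, abs_lt] at hs ht
    exact ⟨by linarith, by linarith⟩
  have key : ∀ β : ℝ → M, IsGeodesic β → β s ∈ (chartAt Plane p).source →
      tangentCoord p (velocity β s) ∈ Metric.ball (tangentCoord p (velocity γ b)) r →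
      β t ∈ (chartAt Plane p).source ∧ tangentCoord p (velocity β t)
        = Φ (tangentCoord p (velocity β s)) (t - s) := by
    intro β hβ hβs hβy
    obtain ⟨h0, τ, hτ⟩ := hΦ _ hβy
    have h00 := hτ 0 ⟨by linarith, hε⟩
    have hv : velocity β s = velocity τ 0 := tangentCoord_injOn p (v := velocity β s)
      (w := velocity τ 0) hβs h00.2.1 (by rw [h00.2.2, h0])
    have := hβ.follow hε (fun t ht => (hτ t ht).1) hv hts
    rw [add_sub_cancel] at this
    rw [this.1, this.2]
    exact (hτ _ hts).2
  refine ⟨hs'.1, fun y => Φ y (t - s),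
    (hΦc _ hts).contDiffAt (Metric.isOpen_ball.mem_nhds hs'.2), (key γ hγ hs'.1 hs'.2).2.symm, ?_⟩
  filter_upwards [Metric.isOpen_ball.mem_nhds hs'.2] with y hy β hβ hβs hβy
  rw [← hβy] at hy ⊢
  exact key β hβ hβs hy

/-- `C¹` dependence of geodesics on their initial velocity. -/
theorem IsGeodesic.transports (hγ : IsGeodesic γ) (h₀ : γ a ∈ (chartAt Plane x₀).source)
    (h₁ : γ b ∈ (chartAt Plane x₁).source) : Transports x₀ x₁ γ a b := by
  -- The reachable times form a clopen set: around each `b`, membership passes between any two times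
  -- within a radius that does not depend on which of them is in `S`.
  set S := {b : ℝ | ∀ x₁, γ b ∈ (chartAt Plane x₁).source → Transports x₀ x₁ γ a b} with hS
  have hloc : ∀ b, ∃ δ > 0, ∀ s ∈ Metric.ball b δ, ∀ t ∈ Metric.ball b δ, s ∈ S → t ∈ S := by
    intro b
    obtain ⟨δ, hδ, hδ0⟩ := ((hγ.exists_transports_near b).and self_mem_nhdsWithin).exists
    refine ⟨δ, hδ0, fun s hs t ht hsS x₁ hx₁ => ?_⟩
    exact ((hsS _ (hδ s hs t ht).1).trans (hδ s hs t ht).2).trans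
      (transports_change_chart (hδ t ht s hs).1 hx₁)
  have hopen : IsOpen S := by
    rw [Metric.isOpen_iff]
    intro b hb
    obtain ⟨δ, hδ, h⟩ := hloc b
    exact ⟨δ, hδ, fun t ht => h b (Metric.mem_ball_self hδ) t ht hb⟩
  have hopen' : IsOpen Sᶜ := by
    rw [Metric.isOpen_iff]
    intro b hb
    obtain ⟨δ, hδ, h⟩ := hloc b
    exact ⟨δ, hδ, fun t ht htS => hb (h t ht b (Metric.mem_ball_self hδ) htS)⟩
  have huniv : S = univ := IsClopen.eq_univ ⟨⟨hopen'⟩, hopen⟩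
    ⟨a, fun x₁ hx₁ => transports_change_chart h₀ hx₁⟩
  exact (huniv ▸ mem_univ b : b ∈ S) x₁ h₁

/-- The velocities of the curves `g n` at time `a` converge to that of `γ`. -/
def VelocityTendsto (g : ℕ → ℝ → M) (γ : ℝ → M) (a : ℝ) : Prop :=
  ∀ x₀ : M, γ a ∈ (chartAt Plane x₀).source →
    (∀ᶠ n in atTop, g n a ∈ (chartAt Plane x₀).source) ∧
    Tendsto (fun n => tangentCoord x₀ (velocity (g n) a)) atTop
      (𝓝 (tangentCoord x₀ (velocity γ a)))

/-- Convergence at one time, seen in one chart, passes to every time and chart by continuity of the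
transport map. -/
theorem velocityTendsto_of_chart {g : ℕ → ℝ → M} (hγ : IsGeodesic γ)
    (hg : ∀ n, IsGeodesic (g n)) (h₀ : γ a ∈ (chartAt Plane x₀).source)
    (hsrc : ∀ᶠ n in atTop, g n a ∈ (chartAt Plane x₀).source)
    (hlim : Tendsto (fun n => tangentCoord x₀ (velocity (g n) a)) atTop
      (𝓝 (tangentCoord x₀ (velocity γ a)))) (b : ℝ) : VelocityTendsto g γ b := by
  intro x₁ h₁
  obtain ⟨Ψ, hc, he, hΨ⟩ := hγ.transports h₀ h₁
  have hev : ∀ᶠ n in atTop, g n b ∈ (chartAt Plane x₁).source ∧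
      tangentCoord x₁ (velocity (g n) b) = Ψ (tangentCoord x₀ (velocity (g n) a)) := by
    filter_upwards [hsrc, hlim.eventually hΨ] with n hn hn'
    exact hn' (g n) (hg n) hn rfl
  refine ⟨hev.mono fun n hn => hn.1, ?_⟩
  rw [← he]
  exact (hc.continuousAt.tendsto.comp hlim).congr' (hev.mono fun n hn => hn.2.symm)

theorem VelocityTendsto.of_time {g : ℕ → ℝ → M} (h : VelocityTendsto g γ a) (hγ : IsGeodesic γ)
    (hg : ∀ n, IsGeodesic (g n)) (b : ℝ) : VelocityTendsto g γ b :=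
  velocityTendsto_of_chart hγ hg (mem_chart_source _ (γ a)) (h _ (mem_chart_source _ _)).1
    (h _ (mem_chart_source _ _)).2 b

theorem VelocityTendsto.tendsto {g : ℕ → ℝ → M} (h : VelocityTendsto g γ a) :
    Tendsto (fun n => g n a) atTop (𝓝 (γ a)) := by
  have hsrc : γ a ∈ (chartAt Plane (γ a)).source := mem_chart_source _ _
  set p := γ a with hp
  obtain ⟨h1, h2⟩ := h p hsrc
  have h3 : Tendsto (fun n => extChartAt (𝓡 2) p (g n a)) atTop (𝓝 (extChartAt (𝓡 2) p p)) := by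
    have := (continuous_fst.tendsto _).comp h2
    rwa [show (tangentCoord p (velocity γ a)).1 = extChartAt (𝓡 2) p p by
      rw [tangentCoord, hp]; rfl] at this
  have h4 := (contMDiffAt_extChartAt_symm (mem_extChartAt_target p)).continuousAt.tendsto.comp h3
  rw [extChartAt_to_inv] at h4
  refine h4.congr' ?_
  filter_upwards [h1] with n hn
  exact (extChartAt (𝓡 2) p).left_inv (by rwa [extChartAt_source])

/-- Geodesics parametrized by arc length. -/
def IsUnitGeodesic (γ : ℝ → M) : Prop := IsGeodesic γ ∧ ∀ t, ‖(velocity γ t).2‖ = 1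

/-- Sequences of unit speed geodesics subconverge. -/
theorem exists_subseq_velocityTendsto [CompactSpace M] (g : ℕ → ℝ → M)
    (hg : ∀ n, IsUnitGeodesic (g n)) (t : ℕ → ℝ) :
    ∃ (γ : ℝ → M) (φ : ℕ → ℕ), IsUnitGeodesic γ ∧ StrictMono φ ∧
      ∀ b, VelocityTendsto (fun n s => g (φ n) (s + t (φ n))) γ b := by
  obtain ⟨w, φ, hw, hφ, hsrc, -, hlim⟩ := exists_subseq_tangentCoord_tendsto
    (fun n => velocity (g n) (t n)) fun n => (hg n).2 (t n)
  obtain ⟨γ, hγ, hγ0⟩ := exists_isGeodesic_velocity_eq w hw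
  have h0 : γ 0 = w.1 := congrArg TotalSpace.proj hγ0
  have hv : ∀ n, velocity (fun s => g (φ n) (s + t (φ n))) 0 = velocity (g (φ n)) (t (φ n)) := by
    intro n
    rw [velocity_comp_add _ ((hg _).1.mdifferentiableAt _), zero_add]
  refine ⟨γ, φ, ⟨hγ, fun s => (hγ.norm_velocity_eq s 0).trans (by rw [hγ0, hw])⟩, hφ,
    velocityTendsto_of_chart (x₀ := w.1) (a := 0) hγ (fun n => (hg _).1.comp_add _)
      (by rw [h0]; exact mem_chart_source _ _) ?_ ?_⟩
  · filter_upwards [hsrc] with n hn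
    rw [zero_add]
    exact hn
  · rw [hγ0]
    exact hlim.congr fun n => by rw [hv]

end Transport

/-! ### Distance bounds from lengths of curves. -/

section LengthBounds

variable {M : Type*} [MetricSpace M] [ChartedSpace Plane M] [IsManifold (𝓡 2) ∞ M]
  [RiemannianBundle (fun x : M => TangentSpace (𝓡 2) x)]
  [IsContMDiffRiemannianBundle (𝓡 2) ∞ Plane (fun x : M => TangentSpace (𝓡 2) x)]

variable [IsRiemannianManifold (𝓡 2) M]

theorem pathELength_of_norm_velocity_eq {γ : ℝ → M} {k : ℝ} (h : ∀ t, ‖(velocity γ t).2‖ = k)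
    (a b : ℝ) : pathELength (𝓡 2) γ a b = ENNReal.ofReal k * ENNReal.ofReal (b - a) := by
  rw [pathELength_eq_lintegral_mfderiv_Icc]
  have : ∀ t, ‖(mfderiv 𝓘(ℝ, ℝ) (𝓡 2) γ t (1 : ℝ) : TangentSpace (𝓡 2) (γ t))‖ₑ =
      ENNReal.ofReal k := by
    intro t
    rw [← ofReal_norm]
    exact congrArg _ (h t)
  refine (MeasureTheory.lintegral_congr this).trans ?_
  simp

theorem edist_eq_riemannianEDist (x y : M) : edist x y = riemannianEDist (𝓡 2) x y :=
  IsRiemannianManifold.out x y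

theorem IsUnitGeodesic.edist_le {γ : ℝ → M} (hγ : IsUnitGeodesic γ) {a b : ℝ} (hab : a ≤ b) :
    edist (γ a) (γ b) ≤ ENNReal.ofReal (b - a) := by
  rw [edist_eq_riemannianEDist]
  refine (riemannianEDist_le_pathELength (hγ.1.1.of_le (by simp)).contMDiffOn rfl rfl hab).trans ?_
  rw [pathELength_of_norm_velocity_eq hγ.2, ENNReal.ofReal_one, one_mul]

theorem IsUnitGeodesic.dist_le {γ : ℝ → M} (hγ : IsUnitGeodesic γ) (a b : ℝ) :
    dist (γ a) (γ b) ≤ |a - b| := by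
  wlog hab : a ≤ b generalizing a b
  · rw [dist_comm, abs_sub_comm]
    exact this b a (le_of_not_ge hab)
  have := hγ.edist_le hab
  rw [edist_dist, ENNReal.ofReal_le_ofReal_iff (by linarith)] at this
  rwa [abs_sub_comm, abs_of_nonneg (by linarith)]

/-- Dominating the speed by an explicit derivative avoids computing a length: the bound on the
distance is just the increment of `F`. -/
theorem dist_le_of_speed_le {x₀ : M} {c c' : ℝ → Plane} {F F' : ℝ → ℝ} {a b : ℝ} (hab : a ≤ b)
    (hc : ∀ t ∈ Icc a b, ContDiffAt ℝ 1 c t) (hc' : ∀ t ∈ Icc a b, HasDerivAt c (c' t) t)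
    (hmem : ∀ t ∈ Icc a b, c t ∈ (extChartAt (𝓡 2) x₀).target)
    (hF : ∀ t ∈ Icc a b, HasDerivAt F (F' t) t)
    (hle : ∀ t ∈ Icc a b, √(metricForm x₀ (c t) (c' t) (c' t)) ≤ F' t) :
    dist ((extChartAt (𝓡 2) x₀).symm (c a)) ((extChartAt (𝓡 2) x₀).symm (c b)) ≤ F b - F a := by
  set γ : ℝ → M := fun t => (extChartAt (𝓡 2) x₀).symm (c t) with hγ
  have hsm : ∀ t ∈ Icc a b, ContMDiffAt 𝓘(ℝ, ℝ) (𝓡 2) 1 γ t := fun t ht =>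
    ((contMDiffAt_extChartAt_symm (hmem t ht)).of_le (by simp)).comp t (hc t ht).contMDiffAt
  have hsrc : ∀ t ∈ Icc a b, γ t ∈ (chartAt Plane x₀).source := by
    intro t ht
    have := (extChartAt (𝓡 2) x₀).map_target (hmem t ht)
    rwa [extChartAt_source] at this
  have hG := isSmoothMetricOn_metricForm x₀
  have hspeed : ∀ t ∈ Ioo a b, ‖(mfderiv 𝓘(ℝ, ℝ) (𝓡 2) γ t (1 : ℝ) : TangentSpace (𝓡 2) (γ t))‖
      = √(metricForm x₀ (c t) (c' t) (c' t)) := by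
    intro t ht
    have ht' := Ioo_subset_Icc_self ht
    have hev : (fun s => extChartAt (𝓡 2) x₀ (γ s)) =ᶠ[𝓝 t] c := by
      filter_upwards [isOpen_Ioo.mem_nhds ht] with s hs
      exact (extChartAt (𝓡 2) x₀).right_inv (hmem s (Ioo_subset_Icc_self hs))
    have h1 := norm_mfderiv_sq ((hsm t ht').mdifferentiableAt (by simp)) (hsrc t ht')
    rw [hev.deriv_eq, (hc' t ht').deriv, hev.eq_of_nhds] at h1
    rw [metricForm_apply, ← h1, Real.sqrt_sq (norm_nonneg _)]
  have hcont : ContinuousOn (fun t => √(metricForm x₀ (c t) (c' t) (c' t))) (Icc a b) := by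
    have hcc : ContinuousOn c (Icc a b) := fun t ht => (hc t ht).continuousAt.continuousWithinAt
    have hcc' : ContinuousOn c' (Icc a b) := by
      have : ContinuousOn (deriv c) (Icc a b) := fun t ht =>
        ((((hc t ht).fderiv_right (m := 0) (by simp)).continuousAt).clm_apply
          continuousAt_const).continuousWithinAt
      exact this.congr fun t ht => (hc' t ht).deriv.symm
    exact (((hG.contDiffOn.continuousOn.comp hcc hmem).clm_apply hcc').clm_apply hcc').sqrt
  have hint : ∫ t in a..b, √(metricForm x₀ (c t) (c' t) (c' t)) ≤ F b - F a := by
    refine intervalIntegral.integral_le_sub_of_hasDeriv_right_of_le hab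
      (HasDerivAt.continuousOn hF)
      (fun t ht => (hF t (Ioo_subset_Icc_self ht)).hasDerivWithinAt) hcont.integrableOn_Icc
      fun t ht => hle t (Ioo_subset_Icc_self ht)
  have hlen : pathELength (𝓡 2) γ a b ≤ ENNReal.ofReal (F b - F a) := by
    refine le_trans (le_of_eq ?_) (ENNReal.ofReal_le_ofReal hint)
    rw [pathELength_eq_lintegral_mfderiv_Ioo, intervalIntegral.integral_of_le hab,
      MeasureTheory.integral_Ioc_eq_integral_Ioo, MeasureTheory.ofReal_integral_eq_lintegral_ofReal
        (hcont.integrableOn_Icc.mono_set Ioo_subset_Icc_self)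
        (Eventually.of_forall fun t => Real.sqrt_nonneg _)]
    refine MeasureTheory.setLIntegral_congr_fun measurableSet_Ioo fun t ht => ?_
    rw [← ofReal_norm]
    exact congrArg _ (hspeed t ht)
  have h0 : 0 ≤ F b - F a := (intervalIntegral.integral_nonneg hab
    fun t _ => Real.sqrt_nonneg _).trans hint
  have hed := (riemannianEDist_le_pathELength (fun t ht => (hsm t ht).contMDiffWithinAt) rfl rfl
    hab).trans hlen
  rwa [← edist_eq_riemannianEDist, edist_dist, ENNReal.ofReal_le_ofReal_iff h0] at hed

end LengthBounds

/-! ### First variation of arc length. -/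

section FirstVariation

variable {M : Type*} [MetricSpace M] [ChartedSpace Plane M] [IsManifold (𝓡 2) ∞ M]
  [RiemannianBundle (fun x : M => TangentSpace (𝓡 2) x)]
  [IsContMDiffRiemannianBundle (𝓡 2) ∞ Plane (fun x : M => TangentSpace (𝓡 2) x)]

variable [IsRiemannianManifold (𝓡 2) M]

/-- A compact convex neighborhood in the chart at `p`, with a metric ball mapped into it. -/
theorem exists_chart_ball (p : M) {R₀ : ℝ} (hR₀ : 0 < R₀) :
    ∃ ρ > 0, ρ ≤ R₀ ∧
      Metric.closedBall (extChartAt (𝓡 2) p p) ρ ⊆ (extChartAt (𝓡 2) p).target ∧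
      ∀ s > 0, ∃ R > 0, ∀ x ∈ Metric.ball p R, x ∈ (chartAt Plane p).source ∧
        extChartAt (𝓡 2) p x ∈ Metric.closedBall (extChartAt (𝓡 2) p p) s := by
  obtain ⟨ρ, hρ, hball⟩ := exists_extChartAt_closedBall p
  refine ⟨min ρ R₀, lt_min hρ hR₀, min_le_right _ _,
    (Metric.closedBall_subset_closedBall (min_le_left _ _)).trans hball, fun s hs => ?_⟩
  exact Metric.mem_nhds_iff.1 (inter_mem ((chartAt Plane p).open_source.mem_nhds
    (mem_chart_source _ p)) ((continuousAt_extChartAt_self p) (Metric.closedBall_mem_nhds _ hs)))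

theorem IsUnitGeodesic.comp_add {γ : ℝ → M} (hγ : IsUnitGeodesic γ) (b : ℝ) :
    IsUnitGeodesic fun s => γ (s + b) :=
  ⟨hγ.1.comp_add b, fun t => by rw [velocity_comp_add b (hγ.1.mdifferentiableAt _)]; exact hγ.2 _⟩

theorem IsUnitGeodesic.comp_neg {γ : ℝ → M} (hγ : IsUnitGeodesic γ) :
    IsUnitGeodesic fun s => γ (-s) :=
  ⟨hγ.1.comp_neg, fun t => by
    rw [velocity_comp_neg (hγ.1.mdifferentiableAt _), norm_tangentSmul, hγ.2]; simp⟩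

theorem IsGeodesic.hasDerivAt_tangentCoord {γ : ℝ → M} {x₀ : M} {t : ℝ} (hγ : IsGeodesic γ)
    (ht : γ t ∈ (chartAt Plane x₀).source) :
    HasDerivAt (fun s => (tangentCoord x₀ (velocity γ s)).1) (tangentCoord x₀ (velocity γ t)).2 t ∧
    HasDerivAt (fun s => (tangentCoord x₀ (velocity γ s)).2)
      (spray (metricForm x₀) (tangentCoord x₀ (velocity γ t)).1 (tangentCoord x₀ (velocity γ t)).2)
      t := by
  have h := (isGeodesic_iff.1 hγ t).2 x₀ ht
  exact ⟨h.fst, h.snd⟩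

theorem IsUnitGeodesic.metricForm_eq_one {γ : ℝ → M} {x₀ : M} {t : ℝ} (hγ : IsUnitGeodesic γ)
    (ht : γ t ∈ (chartAt Plane x₀).source) :
    metricForm x₀ (tangentCoord x₀ (velocity γ t)).1 (tangentCoord x₀ (velocity γ t)).2
      (tangentCoord x₀ (velocity γ t)).2 = 1 := by
  rw [metricForm_tangentCoord (v := velocity γ t) ht, hγ.2, one_pow]

/-- The first variation of arc length, with a uniform quadratic error: moving the end point of a
unit speed geodesic changes the distance to a previous point by at most `g(γ', ξ) + O(‖ξ‖²)`. -/
theorem exists_dist_le_first_variation (p : M) :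
    ∃ r₀ > 0, ∀ r ∈ Ioc 0 r₀, ∃ C ≥ 0, ∃ δ > 0, ∀ γ : ℝ → M, IsUnitGeodesic γ → ∀ s : ℝ,
      dist (γ s) p < δ → ∀ z : M, dist z p < δ →
      dist (γ (s - r)) z ≤ r
        + metricForm p (extChartAt (𝓡 2) p (γ s)) (tangentCoord p (velocity γ s)).2
          (extChartAt (𝓡 2) p z - extChartAt (𝓡 2) p (γ s))
        + C * ‖extChartAt (𝓡 2) p z - extChartAt (𝓡 2) p (γ s)‖ ^ 2 := by
  obtain ⟨ρ, hρ, -, hK, hball⟩ := exists_chart_ball p one_pos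
  have hG := isSmoothMetricOn_metricForm p
  set K := Metric.closedBall (extChartAt (𝓡 2) p p) ρ with hKdef
  obtain ⟨lam, C, hB⟩ := hG.exists_metricBounds (isCompact_closedBall _ ρ)
    (convex_closedBall _ _) hK
  -- The arc of length `r ≤ R / 2` stays in the coordinate ball of radius `ρ / 2`, and the end
  -- points in that of radius `ρ / 4`, so `‖ξ‖ ≤ ρ / 2` and the perturbed arc stays in `K`.
  obtain ⟨R, hR, hR2⟩ := hball (ρ / 2) (by linarith)
  obtain ⟨δ, hδ, hδ4⟩ := hball (ρ / 4) (by linarith)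
  refine ⟨R / 2, by linarith, fun r hr => ⟨C * (1 / lam + 2 * √lam⁻¹ / r + 1 / r ^ 2) / 2 * r, ?_,
    min δ (R / 2), lt_min hδ (by linarith), fun γ hγ s hs z hz => ?_⟩⟩
  · have := hB.C_nonneg
    have := hB.lam_pos
    have := hr.1
    positivity
  set ξ := extChartAt (𝓡 2) p z - extChartAt (𝓡 2) p (γ s) with hξ
  have hr0 := hr.1
  have hnear : ∀ t ∈ Icc (s - r) (s - r + r), γ t ∈ (chartAt Plane p).source ∧
      extChartAt (𝓡 2) p (γ t) ∈ Metric.closedBall (extChartAt (𝓡 2) p p) (ρ / 2) := by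
    intro t ht
    apply hR2
    have h1 := hγ.dist_le t s
    have h2 := hs.trans_le (min_le_right _ _)
    have h3 : |t - s| ≤ r := abs_le.2 ⟨by linarith [ht.1], by linarith [ht.2]⟩
    rw [Metric.mem_ball]
    linarith [dist_triangle (γ t) (γ s) p, hr.2]
  have hs4 := hδ4 (γ s) (hs.trans_le (min_le_left _ _))
  have hz4 := hδ4 z (hz.trans_le (min_le_left _ _))
  have hξn : ‖ξ‖ ≤ ρ / 2 := by
    rw [hξ, ← dist_eq_norm]
    have h1 := Metric.mem_closedBall.1 hz4.2
    have h2 := Metric.mem_closedBall'.1 hs4.2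
    linarith [dist_triangle (extChartAt (𝓡 2) p z) (extChartAt (𝓡 2) p p)
      (extChartAt (𝓡 2) p (γ s))]
  set c : ℝ → Plane := fun t => (tangentCoord p (velocity γ t)).1 with hc
  set v : ℝ → Plane := fun t => (tangentCoord p (velocity γ t)).2 with hv
  have hcK : ∀ t ∈ Icc (s - r) (s - r + r), c t ∈ K := fun t ht =>
    Metric.closedBall_subset_closedBall (by linarith) (hnear t ht).2
  have hbK : ∀ t ∈ Icc (s - r) (s - r + r), c t + ((t - (s - r)) / r) • ξ ∈ K := by
    intro t ht
    have h1 := Metric.mem_closedBall.1 (hnear t ht).2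
    have h2 : ‖((t - (s - r)) / r) • ξ‖ ≤ ρ / 2 := by
      have h0 : 0 ≤ (t - (s - r)) / r := div_nonneg (by linarith [ht.1]) hr0.le
      have h1 : (t - (s - r)) / r ≤ 1 := (div_le_one hr0).2 (by linarith [ht.2])
      rw [norm_smul, Real.norm_of_nonneg h0]
      nlinarith [norm_nonneg ξ]
    rw [hKdef, Metric.mem_closedBall]
    refine (dist_triangle _ (c t) _).trans ?_
    rw [dist_eq_norm, add_sub_cancel_left]
    change _ + dist (extChartAt (𝓡 2) p (γ t)) _ ≤ ρ
    linarith
  have hkey : ∀ t ∈ Icc (s - r) (s - r + r), ∃ D, HasDerivAt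
      (fun t => t + metricForm p (c t) (v t) (((t - (s - r)) / r) • ξ)
        + (C * (1 / lam + 2 * √lam⁻¹ / r + 1 / r ^ 2) / 2 * ‖ξ‖ ^ 2) * t) D t ∧
      √(metricForm p (c t + ((t - (s - r)) / r) • ξ) (v t + r⁻¹ • ξ) (v t + r⁻¹ • ξ)) ≤ D := by
    intro t ht
    obtain ⟨h1, h2⟩ := hγ.1.hasDerivAt_tangentCoord (hnear t ht).1
    exact hB.speed_bump_le hG hK hr0 h1 h2 (hcK t ht) (hγ.metricForm_eq_one (hnear t ht).1) ht
      (hbK t ht)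
  choose! D hD hDle using hkey
  have hη : ∀ t : ℝ, HasDerivAt (fun t => ((t - (s - r)) / r) • ξ) (r⁻¹ • ξ) t := by
    intro t
    have h : HasDerivAt (fun t => (t - (s - r)) / r) (1 / r) t :=
      ((hasDerivAt_id t).sub_const (s - r)).div_const r
    simpa using h.smul_const ξ
  -- The competitor is the geodesic arc plus a field growing linearly from `0` to `ξ`. It starts at
  -- `γ (s - r)` and ends at `z`.
  have hmain := dist_le_of_speed_le (x₀ := p) (c := fun t => c t + ((t - (s - r)) / r) • ξ)
    (c' := fun t => v t + r⁻¹ • ξ) (by linarith : s - r ≤ s - r + r)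
    (fun t ht => by
      have h1 : ContDiffAt ℝ ∞ c t := contDiffAt_extChartAt_comp (hγ.1.1 t) (hnear t ht).1
      have h2 : ContDiff ℝ 1 (fun t : ℝ => ((t - (s - r)) / r) • ξ) := by fun_prop
      exact (h1.of_le (by simp)).add h2.contDiffAt)
    (fun t ht => (hγ.1.hasDerivAt_tangentCoord (hnear t ht).1).1.add (hη t))
    (fun t ht => hK (hbK t ht)) hD hDle
  simp only [sub_self, zero_div, zero_smul, add_zero, sub_add_cancel] at hmain
  have e1 : (extChartAt (𝓡 2) p).symm (c (s - r)) = γ (s - r) :=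
    (extChartAt (𝓡 2) p).left_inv (by
      rw [extChartAt_source]; exact (hnear (s - r) ⟨le_rfl, by linarith⟩).1)
  have e2 : (s - (s - r)) / r = 1 := by rw [sub_sub_cancel, div_self hr0.ne']
  have e3 : c s + ξ = extChartAt (𝓡 2) p z := add_sub_cancel _ _
  have e4 : (extChartAt (𝓡 2) p).symm (extChartAt (𝓡 2) p z) = z :=
    (extChartAt (𝓡 2) p).left_inv (by rw [extChartAt_source]; exact hz4.1)
  rw [e2, one_smul, e3, e1, e4, map_zero, add_zero] at hmain
  refine hmain.trans (le_of_eq ?_)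
  have e5 : c s = extChartAt (𝓡 2) p (γ s) := rfl
  rw [e5]
  ring

end FirstVariation

/-! ### Corners are not minimizing; short geodesics are. -/

section ShortGeodesics

variable {M : Type*} [MetricSpace M] [ChartedSpace Plane M] [IsManifold (𝓡 2) ∞ M]
  [RiemannianBundle (fun x : M => TangentSpace (𝓡 2) x)]
  [IsContMDiffRiemannianBundle (𝓡 2) ∞ Plane (fun x : M => TangentSpace (𝓡 2) x)]

/-- After division by `h > 0` the quadratic term disappears in the limit. All first variation
inequalities are turned into infinitesimal ones in this way. -/
theorem nonneg_of_eventually_quadratic {E : Type*} [NormedAddCommGroup E] [NormedSpace ℝ E]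
    {c : ℝ → E} {v : E} {t k C : ℝ} {L : E →L[ℝ] ℝ} (hc : HasDerivAt c v t)
    (h : ∀ᶠ h in 𝓝[>] (0 : ℝ), 0 ≤ k * h + L (c (t + h) - c t) + C * ‖c (t + h) - c t‖ ^ 2) :
    0 ≤ k + L v := by
  have h1 := hc.tendsto_slope_zero_right
  have h2 : Tendsto (fun h => c (t + h) - c t) (𝓝[>] 0) (𝓝 0) := by
    have : Tendsto (fun h : ℝ => c (t + h) - c t) (𝓝 0) (𝓝 (c (t + 0) - c t)) := by
      refine Tendsto.sub_const ?_ _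
      refine ContinuousAt.tendsto (f := fun h => c (t + h)) (x := 0) ?_
      refine ContinuousAt.comp (g := c) ?_ (by fun_prop)
      rw [add_zero]
      exact hc.continuousAt
    rw [add_zero, sub_self] at this
    exact this.mono_left nhdsWithin_le_nhds
  have h3 : Tendsto (fun h => k + L (h⁻¹ • (c (t + h) - c t))
      + C * (‖h⁻¹ • (c (t + h) - c t)‖ * ‖c (t + h) - c t‖)) (𝓝[>] 0)
      (𝓝 (k + L v + C * (‖v‖ * ‖(0 : E)‖))) :=
    (((L.continuous.tendsto v).comp h1).const_add k).add ((h1.norm.mul h2.norm).const_mul C)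
  rw [norm_zero, mul_zero, mul_zero, add_zero] at h3
  refine ge_of_tendsto h3 ?_
  filter_upwards [h, self_mem_nhdsWithin] with s hs hs0
  have hs0 : 0 < s := hs0
  have e : k + L (s⁻¹ • (c (t + s) - c t)) + C * (‖s⁻¹ • (c (t + s) - c t)‖ * ‖c (t + s) - c t‖)
      = s⁻¹ * (k * s + L (c (t + s) - c t) + C * ‖c (t + s) - c t‖ ^ 2) := by
    rw [map_smul, norm_smul, Real.norm_of_nonneg (inv_nonneg.2 hs0.le), smul_eq_mul]
    field_simp
  rw [e]
  exact mul_nonneg (inv_nonneg.2 hs0.le) hs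

theorem pathELength_eq_integral_of_chart {x₀ : M} {γ : ℝ → M} {a b : ℝ} (hab : a ≤ b)
    (hγ : ∀ t ∈ Icc a b, ContMDiffAt 𝓘(ℝ, ℝ) (𝓡 2) 1 γ t)
    (hsrc : ∀ t ∈ Icc a b, γ t ∈ (chartAt Plane x₀).source) :
    (∀ t ∈ Icc a b, HasDerivAt (fun s => extChartAt (𝓡 2) x₀ (γ s))
      (deriv (fun s => extChartAt (𝓡 2) x₀ (γ s)) t) t) ∧
    ContinuousOn (deriv fun s => extChartAt (𝓡 2) x₀ (γ s)) (Icc a b) ∧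
    pathELength (𝓡 2) γ a b = ENNReal.ofReal (∫ t in a..b, √(metricForm x₀
      (extChartAt (𝓡 2) x₀ (γ t)) (deriv (fun s => extChartAt (𝓡 2) x₀ (γ s)) t)
      (deriv (fun s => extChartAt (𝓡 2) x₀ (γ s)) t))) := by
  set c : ℝ → Plane := fun s => extChartAt (𝓡 2) x₀ (γ s) with hc
  have hcd : ∀ t ∈ Icc a b, ContDiffAt ℝ 1 c t := by
    intro t ht
    rw [← contMDiffAt_iff_contDiffAt]
    exact ((contMDiffAt_extChartAt' (n := ∞) (hsrc t ht)).of_le (by simp)).comp t (hγ t ht)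
  have hG := isSmoothMetricOn_metricForm x₀
  have hcc : ContinuousOn c (Icc a b) := fun t ht => (hcd t ht).continuousAt.continuousWithinAt
  have hcc' : ContinuousOn (deriv c) (Icc a b) := fun t ht =>
    ((((hcd t ht).fderiv_right (m := 0) (by simp)).continuousAt).clm_apply
      continuousAt_const).continuousWithinAt
  have hmem : ∀ t ∈ Icc a b, c t ∈ (extChartAt (𝓡 2) x₀).target := fun t ht =>
    (extChartAt (𝓡 2) x₀).map_source (by rw [extChartAt_source]; exact hsrc t ht)
  have hcont : ContinuousOn (fun t => √(metricForm x₀ (c t) (deriv c t) (deriv c t))) (Icc a b) :=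
    (((hG.contDiffOn.continuousOn.comp hcc hmem).clm_apply hcc').clm_apply hcc').sqrt
  refine ⟨fun t ht => ((hcd t ht).differentiableAt (by simp)).hasDerivAt, hcc', ?_⟩
  rw [pathELength_eq_lintegral_mfderiv_Ioo, intervalIntegral.integral_of_le hab,
    MeasureTheory.integral_Ioc_eq_integral_Ioo, MeasureTheory.ofReal_integral_eq_lintegral_ofReal
      (hcont.integrableOn_Icc.mono_set Ioo_subset_Icc_self)
      (Eventually.of_forall fun t => Real.sqrt_nonneg _)]
  refine MeasureTheory.setLIntegral_congr_fun measurableSet_Ioo fun t ht => ?_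
  have ht' := Ioo_subset_Icc_self ht
  have h1 := norm_mfderiv_sq ((hγ t ht').mdifferentiableAt (by simp)) (hsrc t ht')
  rw [← ofReal_norm]
  refine congrArg _ ?_
  rw [metricForm_apply, ← h1]
  exact (Real.sqrt_sq (norm_nonneg _)).symm

variable [IsRiemannianManifold (𝓡 2) M]

theorem tangentCoord_velocity_comp_neg {γ : ℝ → M} (hγ : IsGeodesic γ) (x₀ : M) (t : ℝ) :
    tangentCoord x₀ (velocity (fun s => γ (-s)) t) =
      ((tangentCoord x₀ (velocity γ (-t))).1, -(tangentCoord x₀ (velocity γ (-t))).2) := by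
  rw [velocity_comp_neg (hγ.mdifferentiableAt _), tangentCoord_tangentSmul, neg_one_smul]

/-- The first variation of arc length, at the initial point of the geodesic. -/
theorem exists_dist_le_first_variation_left (p : M) :
    ∃ r₀ > 0, ∀ r ∈ Ioc 0 r₀, ∃ C ≥ 0, ∃ δ > 0, ∀ γ : ℝ → M, IsUnitGeodesic γ → ∀ s : ℝ,
      dist (γ s) p < δ → ∀ z : M, dist z p < δ →
      dist (γ (s + r)) z ≤ r
        - metricForm p (extChartAt (𝓡 2) p (γ s)) (tangentCoord p (velocity γ s)).2
          (extChartAt (𝓡 2) p z - extChartAt (𝓡 2) p (γ s))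
        + C * ‖extChartAt (𝓡 2) p z - extChartAt (𝓡 2) p (γ s)‖ ^ 2 := by
  obtain ⟨r₀, hr₀, H⟩ := exists_dist_le_first_variation p
  refine ⟨r₀, hr₀, fun r hr => ?_⟩
  obtain ⟨C, hC, δ, hδ, h⟩ := H r hr
  refine ⟨C, hC, δ, hδ, fun γ hγ s hs z hz => ?_⟩
  have := h _ hγ.comp_neg (-s) (by rwa [neg_neg]) z hz
  rw [tangentCoord_velocity_comp_neg hγ.1, neg_neg, map_neg, neg_apply,
    show -(-s - r) = s + r by ring] at this
  linarith

/-- Minimizing curves have no corners. -/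
theorem velocity_eq_of_dist_ge {γ₁ γ₂ : ℝ → M} (h₁ : IsUnitGeodesic γ₁) (h₂ : IsUnitGeodesic γ₂)
    {s₁ s₂ r h : ℝ} (heq : γ₁ s₁ = γ₂ s₂) (hr : 0 < r) (hh : 0 < h)
    (hd : r + h ≤ dist (γ₁ (s₁ - r)) (γ₂ (s₂ + h))) : velocity γ₁ s₁ = velocity γ₂ s₂ := by
  have hsrc : γ₁ s₁ ∈ (chartAt Plane (γ₁ s₁)).source := mem_chart_source _ _
  set p := γ₁ s₁ with hp
  have hsrc₂ : γ₂ s₂ ∈ (chartAt Plane p).source := by rwa [← heq]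
  obtain ⟨r₀, hr₀, H⟩ := exists_dist_le_first_variation p
  obtain ⟨C, -, δ, hδ, H⟩ := H (min r r₀) ⟨lt_min hr hr₀, min_le_right _ _⟩
  set r' := min r r₀ with hr'
  have hr'r : r' ≤ r := min_le_left _ _
  have hG := isSmoothMetricOn_metricForm p
  set X₁ := (tangentCoord p (velocity γ₁ s₁)).2 with hX₁
  set X₂ := (tangentCoord p (velocity γ₂ s₂)).2 with hX₂
  have hz : extChartAt (𝓡 2) p p ∈ (extChartAt (𝓡 2) p).target := mem_extChartAt_target p
  have hc2 : (tangentCoord p (velocity γ₂ s₂)).1 = extChartAt (𝓡 2) p p := by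
    change extChartAt (𝓡 2) p (γ₂ s₂) = _
    rw [← heq]
  have hder := (h₂.1.hasDerivAt_tangentCoord hsrc₂).1
  -- Cutting the corner from `γ₁ (s₁ - r')` to `γ₂ (s₂ + t)` saves no length, so the first variation
  -- in the direction of `γ₂` is at least `1`. For unit vectors, `g(X₁, X₂) ≥ 1` forces equality.
  have hquad : 0 ≤ -1 + metricForm p (extChartAt (𝓡 2) p p) X₁ X₂ := by
    refine nonneg_of_eventually_quadratic (C := C) hder ?_
    have hev : ∀ᶠ t in 𝓝[>] (0 : ℝ), dist (γ₂ (s₂ + t)) p < δ := by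
      filter_upwards [Ioo_mem_nhdsGT hδ] with t ht
      rw [heq]
      refine (h₂.dist_le _ _).trans_lt ?_
      rw [add_sub_cancel_left, abs_of_pos ht.1]
      exact ht.2
    filter_upwards [hev, Ioo_mem_nhdsGT hh] with t ht htI
    have h1 := H γ₁ h₁ s₁ (by rw [← hp, dist_self]; exact hδ) (γ₂ (s₂ + t)) ht
    rw [← hp] at h1
    have h2 : r' + t ≤ dist (γ₁ (s₁ - r')) (γ₂ (s₂ + t)) := by
      have e1 := h₁.dist_le (s₁ - r) (s₁ - r')
      have e2 := h₂.dist_le (s₂ + t) (s₂ + h)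
      rw [show s₁ - r - (s₁ - r') = -(r - r') by ring, abs_neg, abs_of_nonneg (by linarith)] at e1
      rw [show s₂ + t - (s₂ + h) = -(h - t) by ring, abs_neg,
        abs_of_nonneg (by linarith [htI.2])] at e2
      have := dist_triangle4 (γ₁ (s₁ - r)) (γ₁ (s₁ - r')) (γ₂ (s₂ + t)) (γ₂ (s₂ + h))
      linarith
    rw [hc2]
    have e : (tangentCoord p (velocity γ₂ (s₂ + t))).1 = extChartAt (𝓡 2) p (γ₂ (s₂ + t)) := rfl
    rw [e]
    linarith
  have hu₁ : metricForm p (extChartAt (𝓡 2) p p) X₁ X₁ = 1 := h₁.metricForm_eq_one hsrc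
  have hu₂ : metricForm p (extChartAt (𝓡 2) p p) X₂ X₂ = 1 := by
    rw [← hc2]
    exact h₂.metricForm_eq_one hsrc₂
  have hX : X₁ = X₂ := by
    by_contra hne
    have := hG.pos _ hz (X₁ - X₂) (sub_ne_zero.2 hne)
    simp only [map_sub, sub_apply] at this
    rw [hu₁, hu₂, hG.symm _ hz X₂ X₁] at this
    linarith
  exact tangentCoord_injOn p (v := velocity γ₁ s₁) (w := velocity γ₂ s₂) hsrc hsrc₂
    (Prod.ext hc2.symm hX)

/-- Short geodesics are minimizing. -/
theorem exists_dist_eq_of_short (p : M) :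
    ∃ h₀ > 0, ∀ γ : ℝ → M, IsUnitGeodesic γ → γ 0 = p → ∀ h ∈ Icc 0 h₀, dist p (γ h) = h := by
  obtain ⟨ρ, hρ, -, hK, hball⟩ := exists_chart_ball p one_pos
  have hG := isSmoothMetricOn_metricForm p
  set K := Metric.closedBall (extChartAt (𝓡 2) p p) ρ with hKdef
  obtain ⟨lam, C, hB⟩ := hG.exists_metricBounds (isCompact_closedBall _ ρ)
    (convex_closedBall _ _) hK
  obtain ⟨R, hR, hRK⟩ := hball ρ hρ
  have hlam := hB.lam_pos
  have hC := hB.C_nonneg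
  obtain ⟨h₀, hh₀, hh₀R, hsmall⟩ : ∃ h₀ > 0, h₀ < R ∧
      (C / lam + 2 * C ^ 2 / lam ^ 2) * h₀ ^ 2 ≤ lam / 2 := by
    have hcont : Tendsto (fun h : ℝ => (C / lam + 2 * C ^ 2 / lam ^ 2) * h ^ 2) (𝓝[>] 0)
        (𝓝 ((C / lam + 2 * C ^ 2 / lam ^ 2) * 0 ^ 2)) :=
      ((continuous_const.mul (continuous_id.pow 2)).tendsto 0).mono_left nhdsWithin_le_nhds
    rw [zero_pow two_ne_zero, mul_zero] at hcont
    obtain ⟨h, h1, h2⟩ := ((hcont.eventually_lt_const (half_pos hlam)).and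
      (Ioo_mem_nhdsGT hR)).exists
    exact ⟨h, h2.1, h2.2, h1.le⟩
  refine ⟨h₀, hh₀, fun γ hγ hγ0 h hh => ?_⟩
  have hup : dist p (γ h) ≤ h := by
    rw [← hγ0]
    refine (hγ.dist_le _ _).trans_eq ?_
    rw [zero_sub, abs_neg, abs_of_nonneg hh.1]
  rcases hh.1.eq_or_lt with h0 | hpos
  · rw [← h0, hγ0, dist_self]
  refine hup.antisymm (le_of_not_gt fun hlt => ?_)
  have hlt' : riemannianEDist (𝓡 2) p (γ h) < ENNReal.ofReal h := by
    rw [← edist_eq_riemannianEDist, edist_dist]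
    exact (ENNReal.ofReal_lt_ofReal_iff hpos).2 hlt
  -- A curve shorter than `h` from `p` cannot leave the ball of radius `R`, hence stays in the chart
  -- region where `geodesic_le_length` rules it out.
  obtain ⟨b, hb0, hb1, hb, hlen, -, -⟩ :=
    exists_lt_locally_constant_of_riemannianEDist_lt hlt' zero_lt_one
  have hnear : ∀ t ∈ Icc (0 : ℝ) 1, b t ∈ Metric.ball p R := by
    intro t ht
    have h1 : edist p (b t) < ENNReal.ofReal h := by
      rw [edist_eq_riemannianEDist]
      exact ((riemannianEDist_le_pathELength hb.contMDiffOn hb0 rfl ht.1).trans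
        (pathELength_mono le_rfl ht.2)).trans_lt hlen
    rw [edist_dist, ENNReal.ofReal_lt_ofReal_iff hpos] at h1
    rw [Metric.mem_ball']
    linarith [hh.2]
  obtain ⟨hd, hdc, hL⟩ := pathELength_eq_integral_of_chart (x₀ := p) zero_le_one
    (fun t _ => hb t) (fun t ht => (hRK _ (hnear t ht)).1)
  have hγnear : ∀ t ∈ Icc 0 h, γ t ∈ Metric.ball p R := by
    intro t ht
    rw [Metric.mem_ball, ← hγ0]
    refine (hγ.dist_le _ _).trans_lt ?_
    rw [sub_zero, abs_of_nonneg ht.1]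
    linarith [ht.2, hh.2]
  have hsmall' : (C / lam + 2 * C ^ 2 / lam ^ 2) * h ^ 2 ≤ lam / 2 := by
    refine le_trans ?_ hsmall
    have := hh.2
    gcongr
  have hle := hB.geodesic_le_length hG hK hpos hsmall'
    (c := fun t => (tangentCoord p (velocity γ t)).1)
    (v := fun t => (tangentCoord p (velocity γ t)).2)
    (fun t ht => (hγ.1.hasDerivAt_tangentCoord (hRK _ (hγnear t ht)).1).1)
    (fun t ht => (hγ.1.hasDerivAt_tangentCoord (hRK _ (hγnear t ht)).1).2)
    (fun t ht => (hRK _ (hγnear t ht)).2)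
    (fun t ht => hγ.metricForm_eq_one (hRK _ (hγnear t ht)).1) hd hdc
    (fun t ht => (hRK _ (hnear t ht)).2)
    (by rw [hb0]; change _ = extChartAt (𝓡 2) p (γ 0); rw [hγ0])
    (by rw [hb1]; rfl)
  rw [hL, ENNReal.ofReal_lt_ofReal_iff hpos] at hlen
  exact absurd hle (not_le.2 hlen)

end ShortGeodesics

/-! ### The exponential map at a point. -/

section LocalMinimizers

variable {M : Type*} [MetricSpace M] [ChartedSpace Plane M] [IsManifold (𝓡 2) ∞ M]
  [RiemannianBundle (fun x : M => TangentSpace (𝓡 2) x)]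
  [IsContMDiffRiemannianBundle (𝓡 2) ∞ Plane (fun x : M => TangentSpace (𝓡 2) x)]

theorem velocity_comp_mul {γ : ℝ → M} (hγ : IsGeodesic γ) (k t : ℝ) :
    velocity (fun s => γ (k * s)) t = tangentSmul k (velocity γ (k * t)) := by
  have := velocity_comp_affine' (γ := γ) (t := t) k 0 (hγ.mdifferentiableAt _)
  simpa using this

theorem IsGeodesic.comp_mul {γ : ℝ → M} (hγ : IsGeodesic γ) (k : ℝ) :
    IsGeodesic fun s => γ (k * s) := by
  simpa using hγ.comp_affine k 0

theorem tangentCoord_velocity_fst (x₀ : M) (γ : ℝ → M) (t : ℝ) :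
    (tangentCoord x₀ (velocity γ t)).1 = extChartAt (𝓡 2) x₀ (γ t) := rfl

variable [CompactSpace M]

theorem exists_unit_tangent (p : M) : ∃ v : TangentBundle (𝓡 2) M, v.1 = p ∧ ‖v.2‖ = 1 := by
  obtain ⟨e, he⟩ : ∃ e : Plane, e ≠ 0 := exists_ne 0
  obtain ⟨v, hv, hvy⟩ := exists_tangentCoord_eq p (y := (extChartAt (𝓡 2) p p, e))
    (mem_extChartAt_target p)
  have hp : v.1 = p := (extChartAt (𝓡 2) p).injOn (by rwa [extChartAt_source])
    (by rw [extChartAt_source]; exact mem_chart_source _ p) (congrArg Prod.fst hvy)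
  have h := metricForm_tangentCoord hv
  rw [hvy] at h
  have hpos := (isSmoothMetricOn_metricForm p).pos _ (mem_extChartAt_target p) e he
  have hne : ‖v.2‖ ≠ 0 := by
    intro h0
    rw [h0, zero_pow two_ne_zero] at h
    exact hpos.ne' h
  refine ⟨tangentSmul ‖v.2‖⁻¹ v, hp, ?_⟩
  rw [norm_tangentSmul, abs_inv, abs_norm, inv_mul_cancel₀ hne]

theorem exists_unitGeodesic_velocity_eq (v : TangentBundle (𝓡 2) M) (hv : ‖v.2‖ = 1) :
    ∃ γ : ℝ → M, IsUnitGeodesic γ ∧ velocity γ 0 = v := by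
  obtain ⟨γ, hγ, h0⟩ := exists_isGeodesic_velocity_eq v hv
  exact ⟨γ, ⟨hγ, fun t => (hγ.norm_velocity_eq t 0).trans (by rw [h0, hv])⟩, h0⟩

/-- Factoring out the norm lets the zero vector be handled too: any unit geodesic from its base
point serves, with factor `0`. -/
theorem exists_unitGeodesic_tangentSmul (v : TangentBundle (𝓡 2) M) :
    ∃ γ : ℝ → M, IsUnitGeodesic γ ∧ γ 0 = v.1 ∧ tangentSmul ‖v.2‖ (velocity γ 0) = v := by
  rcases eq_or_ne v.2 0 with h0 | h0
  · obtain ⟨w, hw, hw1⟩ := exists_unit_tangent v.1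
    obtain ⟨γ, hγ, hγ0⟩ := exists_unitGeodesic_velocity_eq w hw1
    obtain ⟨p, v⟩ := v
    obtain ⟨q, w⟩ := w
    change q = p at hw
    subst hw
    refine ⟨γ, hγ, congrArg TotalSpace.proj hγ0, ?_⟩
    rw [hγ0]
    change v = 0 at h0
    subst h0
    refine congrArg (TotalSpace.mk q) ?_
    rw [norm_zero, zero_smul]
  · have hn : ‖v.2‖ ≠ 0 := norm_ne_zero_iff.2 h0
    obtain ⟨γ, hγ, hγ0⟩ := exists_unitGeodesic_velocity_eq (tangentSmul ‖v.2‖⁻¹ v)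
      (by rw [norm_tangentSmul, abs_inv, abs_norm, inv_mul_cancel₀ hn])
    refine ⟨γ, hγ, congrArg TotalSpace.proj hγ0, ?_⟩
    rw [hγ0, tangentSmul_tangentSmul, mul_inv_cancel₀ hn, one_tangentSmul]

variable [IsRiemannianManifold (𝓡 2) M]

/-- Nearby points are joined by minimizing geodesics. -/
theorem exists_minimizing_near (p : M) : ∃ r > 0, ∀ q, dist p q < r →
    ∃ γ : ℝ → M, IsUnitGeodesic γ ∧ γ 0 = p ∧ γ (dist p q) = q := by
  obtain ⟨h₀, hh₀, hmin⟩ := exists_dist_eq_of_short p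
  obtain ⟨w, hwp, hw⟩ := exists_unit_tangent p
  obtain ⟨τ, hτ, hτ0⟩ := exists_unitGeodesic_velocity_eq w hw
  have hτp : τ 0 = p := (congrArg TotalSpace.proj hτ0).trans hwp
  have hsrc : p ∈ (chartAt Plane p).source := mem_chart_source _ p
  -- the constant geodesic
  have hconst : IsGeodesic fun t : ℝ => τ (0 * t) := hτ.1.comp_mul 0
  have hst : tangentCoord p (velocity (fun t : ℝ => τ (0 * t)) 0) = (extChartAt (𝓡 2) p p, 0) := by
    rw [velocity_comp_mul hτ.1, tangentCoord_tangentSmul, zero_smul, zero_mul,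
      tangentCoord_velocity_fst, hτp]
  obtain ⟨Ψ, hΨc, hΨ0, hΨ⟩ := hconst.transports (x₀ := p) (x₁ := p) (a := 0) (b := 1)
    (by simp [hτp]) (by simp [hτp])
  rw [hst] at hΨc hΨ0 hΨ
  have hline : ContDiffAt ℝ 1 (fun u : Plane => (extChartAt (𝓡 2) p p, u)) 0 :=
    contDiffAt_const.prodMk contDiffAt_id
  -- This is the exponential map at `p` in coordinates. It is `C¹` at `0` as the time `1` transport
  -- around the constant geodesic.
  set E : Plane → Plane := fun u => (Ψ (extChartAt (𝓡 2) p p, u)).1 with hE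
  have hEc : ContDiffAt ℝ 1 E 0 := (hΨc.comp (0 : Plane) hline).fst
  have hev : ∀ᶠ u in 𝓝 (0 : Plane), ∀ β : ℝ → M, IsGeodesic β →
      β 0 ∈ (chartAt Plane p).source →
      tangentCoord p (velocity β 0) = (extChartAt (𝓡 2) p p, u) →
      β 1 ∈ (chartAt Plane p).source ∧ extChartAt (𝓡 2) p (β 1) = E u := by
    filter_upwards [hline.continuousAt.eventually hΨ] with u hu β hβ hβ0 hβu
    obtain ⟨h1, h2⟩ := hu β hβ hβ0 hβu
    exact ⟨h1, congrArg Prod.fst h2⟩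
  -- geodesics with a given initial velocity
  have hgeo : ∀ u : Plane, ∃ (γ : ℝ → M) (k : ℝ), IsUnitGeodesic γ ∧ γ 0 = p ∧ 0 ≤ k ∧
      k ^ 2 = metricForm p (extChartAt (𝓡 2) p p) u u ∧
      k • (tangentCoord p (velocity γ 0)).2 = u := by
    intro u
    obtain ⟨v, hv, hvy⟩ := exists_tangentCoord_eq p (y := (extChartAt (𝓡 2) p p, u))
      (mem_extChartAt_target p)
    have hp : v.1 = p := (extChartAt (𝓡 2) p).injOn (by rwa [extChartAt_source])
      (by rw [extChartAt_source]; exact mem_chart_source _ p) (congrArg Prod.fst hvy)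
    obtain ⟨γ, hγ, hγ0, hγv⟩ := exists_unitGeodesic_tangentSmul v
    refine ⟨γ, ‖v.2‖, hγ, hγ0.trans hp, norm_nonneg _, ?_, ?_⟩
    · rw [← metricForm_tangentCoord hv, hvy]
    · have := congrArg (tangentCoord p) hγv
      rw [tangentCoord_tangentSmul, hvy] at this
      exact congrArg Prod.snd this
  have hcoord : ∀ (γ : ℝ → M) (k : ℝ), IsUnitGeodesic γ → γ 0 = p →
      tangentCoord p (velocity (fun t => γ (k * t)) 0) =
        (extChartAt (𝓡 2) p p, k • (tangentCoord p (velocity γ 0)).2) := by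
    intro γ k hγ hγ0
    rw [velocity_comp_mul hγ.1, tangentCoord_tangentSmul, mul_zero, tangentCoord_velocity_fst, hγ0]
  -- the derivative of the exponential map
  have h1 := (hEc.differentiableAt (by simp)).hasFDerivAt
  have hid : fderiv ℝ E 0 = ContinuousLinearMap.id ℝ Plane := by
    ext1 u
    obtain ⟨γ, k, hγ, hγ0, -, -, hku⟩ := hgeo u
    have hl : HasDerivAt (fun t : ℝ => t • u) u 0 := by
      simpa using (hasDerivAt_id (0 : ℝ)).smul_const u
    have h2 : HasDerivAt (fun t : ℝ => E (t • u)) (fderiv ℝ E 0 u) 0 := by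
      have : HasFDerivAt E (fderiv ℝ E 0) ((0 : ℝ) • u) := by rwa [zero_smul]
      exact this.comp_hasDerivAt (0 : ℝ) hl
    have h3 : (fun t : ℝ => E (t • u)) =ᶠ[𝓝 0] fun t =>
        (tangentCoord p (velocity (fun s => γ (k * s)) t)).1 := by
      have : Tendsto (fun t : ℝ => t • u) (𝓝 0) (𝓝 0) := by
        have := hl.continuousAt.tendsto
        rwa [zero_smul] at this
      filter_upwards [this.eventually hev] with t ht
      have := (ht (fun s => γ (t * k * s)) (hγ.1.comp_mul _) (by simp [hγ0])
        (by rw [hcoord γ _ hγ hγ0, mul_smul, hku])).2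
      rw [← this, tangentCoord_velocity_fst, mul_one, mul_comm]
    have h4 := ((hγ.1.comp_mul k).hasDerivAt_tangentCoord (x₀ := p) (t := 0)
      (by simp [hγ0])).1
    rw [hcoord γ k hγ hγ0, hku] at h4
    exact (h2.congr_of_eventuallyEq h3.symm).unique h4
  have hd : HasFDerivAt E (ContinuousLinearMap.id ℝ Plane) 0 := hid ▸ h1
  have hstrict : HasStrictFDerivAt E (ContinuousLinearMap.id ℝ Plane) 0 := by
    have := hEc.hasStrictFDerivAt (by simp)
    rwa [hd.fderiv] at this
  -- Only openness of `E` at `0` is needed: every nearby point is the end of a short geodesic, and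
  -- short geodesics minimize.
  have hmap : map E (𝓝 0) = 𝓝 (E 0) :=
    hstrict.map_nhds_eq_of_surj (LinearMap.range_eq_top.2 Function.surjective_id)
  have hE0 : E 0 = extChartAt (𝓡 2) p p := by
    simp only [hE]
    rw [hΨ0, tangentCoord_velocity_fst, zero_mul, hτp]
  rw [hE0] at hmap
  have hsmall : ∀ᶠ u in 𝓝 (0 : Plane), metricForm p (extChartAt (𝓡 2) p p) u u < h₀ ^ 2 := by
    have hc : Continuous fun u : Plane => metricForm p (extChartAt (𝓡 2) p p) u u := by fun_prop
    have := hc.tendsto 0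
    simp only [map_zero] at this
    exact this.eventually_lt_const (by positivity)
  have himg := hmap ▸ image_mem_map (m := E) (hev.and hsmall)
  have hnhds : ∀ᶠ q in 𝓝 p, extChartAt (𝓡 2) p q ∈ E '' _ ∧ q ∈ (chartAt Plane p).source :=
    ((continuousAt_extChartAt_self p).eventually himg).and
      ((chartAt Plane p).open_source.mem_nhds hsrc)
  obtain ⟨r, hr, hball⟩ := Metric.eventually_nhds_iff_ball.1 hnhds
  refine ⟨r, hr, fun q hq => ?_⟩
  obtain ⟨⟨u, ⟨hu1, hu2⟩, huq⟩, hqs⟩ := hball q (Metric.mem_ball'.2 hq)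
  obtain ⟨γ, k, hγ, hγ0, hk0, hk2, hku⟩ := hgeo u
  obtain ⟨h1, h2⟩ := hu1 (fun s => γ (k * s)) (hγ.1.comp_mul k) (by simp [hγ0])
    (by rw [hcoord γ k hγ hγ0, hku])
  rw [mul_one] at h1 h2
  have hqk : γ k = q := (extChartAt (𝓡 2) p).injOn (by rwa [extChartAt_source])
    (by rwa [extChartAt_source]) (h2.trans huq)
  have hk : k ≤ h₀ := by
    rw [← hk2] at hu2
    nlinarith
  have := hmin γ hγ hγ0 k ⟨hk0, hk⟩
  rw [hqk] at this
  exact ⟨γ, hγ, hγ0, by rw [this, hqk]⟩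

end LocalMinimizers

/-! ### Existence of minimizing geodesics. -/

section HopfRinow

variable {M : Type*} [MetricSpace M] [ChartedSpace Plane M] [IsManifold (𝓡 2) ∞ M]
  [RiemannianBundle (fun x : M => TangentSpace (𝓡 2) x)]
  [IsContMDiffRiemannianBundle (𝓡 2) ∞ Plane (fun x : M => TangentSpace (𝓡 2) x)]

variable [IsRiemannianManifold (𝓡 2) M]

/-- A nearly shortest curve from `p` to `y` crosses the sphere of radius `ρ` by the intermediate
value theorem, and its length splits there. -/
theorem exists_dist_eq_and_lt {p y : M} {ρ ε : ℝ} (hρ : 0 ≤ ρ) (hρy : ρ ≤ dist p y) (hε : 0 < ε) :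
    ∃ z, dist p z = ρ ∧ ρ + dist z y < dist p y + ε := by
  have hlt : riemannianEDist (𝓡 2) p y < ENNReal.ofReal (dist p y + ε) := by
    rw [← edist_eq_riemannianEDist, edist_dist]
    exact (ENNReal.ofReal_lt_ofReal_iff (by positivity)).2 (by linarith)
  obtain ⟨b, hb0, hb1, hb, hlen, -, -⟩ :=
    exists_lt_locally_constant_of_riemannianEDist_lt hlt zero_lt_one
  have hc : Continuous fun t => dist p (b t) := continuous_const.dist hb.continuous
  obtain ⟨t, ht, htρ⟩ : ∃ t ∈ Icc (0 : ℝ) 1, dist p (b t) = ρ := by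
    have := intermediate_value_Icc zero_le_one hc.continuousOn
    exact this ⟨by simpa [hb0] using hρ, by simpa [hb1] using hρy⟩
  refine ⟨b t, htρ, ?_⟩
  have h1 : edist p (b t) ≤ pathELength (𝓡 2) b 0 t := by
    rw [edist_eq_riemannianEDist]
    exact riemannianEDist_le_pathELength hb.contMDiffOn hb0 rfl ht.1
  have h2 : edist (b t) y ≤ pathELength (𝓡 2) b t 1 := by
    rw [edist_eq_riemannianEDist]
    exact riemannianEDist_le_pathELength hb.contMDiffOn rfl hb1 ht.2
  have h3 := (add_le_add h1 h2).trans_lt ((pathELength_add ht.1 ht.2).trans_lt hlen)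
  rw [edist_dist, edist_dist, ← ENNReal.ofReal_add dist_nonneg dist_nonneg, htρ,
    ENNReal.ofReal_lt_ofReal_iff (by positivity)] at h3
  exact h3

variable [CompactSpace M]

/-- The point of a small sphere around `p` closest to `y` loses nothing, since nearly shortest
curves cross that sphere; it is joined to `p` by a minimizing geodesic. -/
theorem exists_step {p y : M} (hpy : p ≠ y) : ∃ ρ > 0, ∃ τ : ℝ → M, IsUnitGeodesic τ ∧ τ 0 = p ∧
    dist p y = ρ + dist (τ ρ) y := by
  obtain ⟨r, hr, H⟩ := exists_minimizing_near p
  have hd := dist_pos.2 hpy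
  set ρ := min (r / 2) (dist p y) with hρ
  have hρ0 : 0 < ρ := lt_min (half_pos hr) hd
  have hρr : ρ < r := (min_le_left _ _).trans_lt (half_lt_self hr)
  have hcomp : IsCompact {z | dist p z = ρ} :=
    (isClosed_eq (continuous_const.dist continuous_id) continuous_const).isCompact
  obtain ⟨z₁, hz₁, -⟩ := exists_dist_eq_and_lt hρ0.le (min_le_right _ _ : ρ ≤ dist p y) one_pos
  obtain ⟨z, hz, hmin⟩ := hcomp.exists_isMinOn ⟨z₁, hz₁⟩
    (f := fun z => dist z y) (continuous_id.dist continuous_const).continuousOn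
  have hz : dist p z = ρ := hz
  obtain ⟨τ, hτ, hτ0, hτz⟩ := H z (hz.trans_lt hρr)
  rw [hz] at hτz
  refine ⟨ρ, hρ0, τ, hτ, hτ0, ?_⟩
  rw [hτz]
  refine le_antisymm (by linarith [dist_triangle p z y]) (le_of_forall_pos_lt_add fun ε hε => ?_)
  obtain ⟨z₂, hz₂, hlt⟩ := exists_dist_eq_and_lt hρ0.le (min_le_right _ _ : ρ ≤ dist p y) hε
  have : dist z y ≤ dist z₂ y := hmin hz₂
  linarith

/-- The Hopf-Rinow theorem: any two points are joined by a minimizing geodesic. -/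
theorem exists_minimizing (x y : M) :
    ∃ γ : ℝ → M, IsUnitGeodesic γ ∧ γ 0 = x ∧ γ (dist x y) = y := by
  rcases eq_or_ne x y with rfl | hxy
  · obtain ⟨v, hvx, hv⟩ := exists_unit_tangent x
    obtain ⟨γ, hγ, hγ0⟩ := exists_unitGeodesic_velocity_eq v hv
    have : γ 0 = x := (congrArg TotalSpace.proj hγ0).trans hvx
    exact ⟨γ, hγ, this, by rw [dist_self, this]⟩
  obtain ⟨ρ, hρ, γ, hγ, hγ0, hγρ⟩ := exists_step hxy
  set D := dist x y with hD
  -- These are the times at which `γ` has wasted no length on the way to `y`. If the last of them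
  -- were before `D`, a further step would prolong it, and that step continues `γ` because a corner
  -- there is impossible.
  set T := Icc 0 D ∩ {t | dist (γ t) y = D - t} with hT
  have hTc : IsCompact T := isCompact_Icc.inter_right
    (isClosed_eq (hγ.1.continuous.dist continuous_const) (continuous_const.sub continuous_id))
  have hρT : ρ ∈ T := ⟨⟨hρ.le, by linarith [dist_nonneg (x := γ ρ) (y := y)]⟩,
    show dist (γ ρ) y = D - ρ by linarith⟩
  obtain ⟨t, ht, hmax⟩ := hTc.exists_isMaxOn ⟨ρ, hρT⟩ continuousOn_id
  have htρ : ρ ≤ t := hmax hρT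
  have htd : dist (γ t) y = D - t := ht.2
  refine ⟨γ, hγ, hγ0, ?_⟩
  rcases ht.1.2.eq_or_lt with h1 | h1
  · rw [h1, sub_self, dist_eq_zero] at htd
    exact htd
  · exfalso
    have hne : γ t ≠ y := by
      intro h
      rw [h, dist_self] at htd
      linarith
    obtain ⟨η, hη, τ, hτ, hτ0, hτη⟩ := exists_step hne
    have hcorner : t + η ≤ dist (γ (t - t)) (τ (0 + η)) := by
      rw [sub_self, hγ0, zero_add]
      linarith [dist_triangle x (τ η) y]
    have hv := velocity_eq_of_dist_ge hγ hτ hτ0.symm (hρ.trans_le htρ) hη hcorner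
    have heq : (fun s => γ (s + t)) = τ := (hγ.comp_add t).1.eq_of_velocity_eq hτ.1 (t := 0)
      (by rw [velocity_comp_add t (hγ.1.mdifferentiableAt _), zero_add, hv])
    have hη' : γ (t + η) = τ η := by rw [← heq, add_comm]
    have hmem : t + η ∈ T := by
      have h2 : dist (γ (t + η)) y = D - (t + η) := by rw [hη']; linarith
      exact ⟨⟨by linarith, by linarith [dist_nonneg (x := γ (t + η)) (y := y)]⟩, h2⟩
    have : t + η ≤ t := hmax hmem
    linarith

end HopfRinow

/-! ### Cut times of unit speed geodesics. -/

section CutTimes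

variable {M : Type*} [MetricSpace M] [ChartedSpace Plane M] [IsManifold (𝓡 2) ∞ M]
  [RiemannianBundle (fun x : M => TangentSpace (𝓡 2) x)]
  [IsContMDiffRiemannianBundle (𝓡 2) ∞ Plane (fun x : M => TangentSpace (𝓡 2) x)]

open Metric

theorem range_isCompact {α : ℝ → M} {l : ℝ} (hα : IsSimpleClosedGeodesic α l) :
    IsCompact (range α) :=
  hα.periodic.compact_of_continuous hα.pos.ne' hα.geodesic.continuous

variable [IsRiemannianManifold (𝓡 2) M] {A : Set M} {γ : ℝ → M}

theorem IsUnitGeodesic.infDist_le_add (hγ : IsUnitGeodesic γ) (s t : ℝ) :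
    infDist (γ t) A ≤ infDist (γ s) A + |t - s| :=
  infDist_le_infDist_add_dist.trans (by gcongr; exact hγ.dist_le _ _)

theorem IsUnitGeodesic.infDist_le (hγ : IsUnitGeodesic γ) (h0 : γ 0 ∈ A) {t : ℝ} (ht : 0 ≤ t) :
    infDist (γ t) A ≤ t := by
  have := hγ.infDist_le_add (A := A) 0 t
  rwa [infDist_zero_of_mem h0, sub_zero, abs_of_nonneg ht, zero_add] at this

theorem IsUnitGeodesic.infDist_eq_of_le (hγ : IsUnitGeodesic γ) (h0 : γ 0 ∈ A) {s t : ℝ}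
    (hs : 0 ≤ s) (hst : s ≤ t) (ht : infDist (γ t) A = t) : infDist (γ s) A = s := by
  have h1 := hγ.infDist_le_add (A := A) s t
  rw [abs_of_nonneg (by linarith)] at h1
  linarith [hγ.infDist_le h0 hs]

theorem isMinimizingFromTo_iff {x : M} : IsMinimizingFromTo A γ x ↔
    IsUnitGeodesic γ ∧ γ 0 ∈ A ∧ γ (infDist x A) = x :=
  ⟨fun h => ⟨⟨h.1, h.2.1⟩, h.2.2⟩, fun h => ⟨h.1.1, h.1.2, h.2⟩⟩

/-- The last time up to which `γ` realizes the distance to `A`. -/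
noncomputable def cutTime (A : Set M) (γ : ℝ → M) : ℝ := sSup {r | 0 ≤ r ∧ infDist (γ r) A = r}

section Compact

variable [CompactSpace M]

theorem exists_isMinimizingFromTo (hA : IsCompact A) (hne : A.Nonempty) (x : M) :
    ∃ γ : ℝ → M, IsMinimizingFromTo A γ x := by
  obtain ⟨y, hy, hd⟩ := hA.exists_infDist_eq_dist hne x
  obtain ⟨γ, hγ, h0, h1⟩ := exists_minimizing y x
  exact ⟨γ, isMinimizingFromTo_iff.2 ⟨hγ, by rwa [h0], by rwa [hd, dist_comm]⟩⟩

theorem bddAbove_infDist_eq (A : Set M) (γ : ℝ → M) :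
    BddAbove {r | 0 ≤ r ∧ infDist (γ r) A = r} := by
  obtain ⟨C, hC⟩ := (isCompact_univ (X := M)).bddAbove_image (f := fun x => infDist x A)
    (continuous_infDist_pt A).continuousOn
  exact ⟨C, fun r hr => hr.2 ▸ hC ⟨γ r, mem_univ _, rfl⟩⟩

theorem isClosed_infDist_eq (hγ : IsUnitGeodesic γ) : IsClosed {r | 0 ≤ r ∧ infDist (γ r) A = r} :=
  isClosed_Ici.inter
    (isClosed_eq ((continuous_infDist_pt A).comp hγ.1.continuous) continuous_id)

theorem cutTime_mem (hγ : IsUnitGeodesic γ) (h0 : γ 0 ∈ A) :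
    0 ≤ cutTime A γ ∧ infDist (γ (cutTime A γ)) A = cutTime A γ :=
  (isClosed_infDist_eq hγ).csSup_mem ⟨0, le_rfl, infDist_zero_of_mem h0⟩ (bddAbove_infDist_eq A γ)

/-- Realizing times are closed under decreasing, as the distance is 1-Lipschitz along `γ`, and
contain their supremum. -/
theorem infDist_eq_iff (hγ : IsUnitGeodesic γ) (h0 : γ 0 ∈ A) {r : ℝ} (hr : 0 ≤ r) :
    infDist (γ r) A = r ↔ r ≤ cutTime A γ :=
  ⟨fun h => le_csSup (bddAbove_infDist_eq A γ) ⟨hr, h⟩,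
    fun h => hγ.infDist_eq_of_le h0 hr h (cutTime_mem hγ h0).2⟩

/-- The times after which the distance is never realized are those at or after the last realizing
time, so the least of them is `cutTime`. -/
theorem isCutTime_iff (hγ : IsUnitGeodesic γ) (h0 : γ 0 ∈ A) {s : ℝ} :
    IsCutTime A γ s ↔ s = cutTime A γ := by
  have hset : {s : ℝ | 0 ≤ s ∧ ∀ r : ℝ, s < r →
      pathELength (𝓡 2) γ 0 r ≠ infEDist (γ r) A} = Ici (cutTime A γ) := by
    have hne : ∀ r, infEDist (γ r) A ≠ ⊤ := fun r => infEDist_ne_top ⟨_, h0⟩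
    have hlen : ∀ r, 0 ≤ r → (pathELength (𝓡 2) γ 0 r = infEDist (γ r) A ↔ r ≤ cutTime A γ) := by
      intro r hr
      rw [← infDist_eq_iff hγ h0 hr, pathELength_of_norm_velocity_eq hγ.2, ENNReal.ofReal_one,
        one_mul, sub_zero, infDist, eq_comm, ← ENNReal.ofReal_toReal (hne r),
        ENNReal.ofReal_eq_ofReal_iff ENNReal.toReal_nonneg hr, ENNReal.toReal_ofReal
          ENNReal.toReal_nonneg]
    ext s
    constructor
    · rintro ⟨hs, h⟩
      refine le_of_not_gt fun hlt => h _ hlt ((hlen _ (cutTime_mem hγ h0).1).2 le_rfl)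
    · intro hs
      have hs0 : 0 ≤ s := (cutTime_mem hγ h0).1.trans hs
      exact ⟨hs0, fun r hr h => absurd ((hlen r (hs0.trans hr.le)).1 h)
        (not_le.2 (lt_of_le_of_lt hs hr))⟩
  rw [IsCutTime, hset]
  exact ⟨fun h => h.unique isLeast_Ici, fun h => h ▸ isLeast_Ici⟩

/-- A distance realizing geodesic is determined by any of its points before the cut point. -/
theorem eq_of_lt_cutTime {γ₁ γ₂ : ℝ → M} (h₁ : IsUnitGeodesic γ₁) (h₂ : IsUnitGeodesic γ₂)
    (h₁0 : γ₁ 0 ∈ A) (h₂0 : γ₂ 0 ∈ A) {s : ℝ} (hs : 0 < s) (heq : γ₁ s = γ₂ s)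
    (hs₁ : s < cutTime A γ₁) : γ₁ = γ₂ := by
  -- Following `γ₂` to the common point and then `γ₁` to its cut point takes length `cutTime A γ₁`,
  -- which is at most the distance of the ends; hence there is no corner.
  refine h₁.1.eq_of_velocity_eq h₂.1 (velocity_eq_of_dist_ge h₂ h₁ heq.symm hs (sub_pos.2 hs₁) ?_).symm
  rw [sub_self, add_sub_cancel]
  exact (cutTime_mem h₁ h₁0).2.ge.trans ((infDist_le_dist_of_mem h₂0).trans_eq (dist_comm _ _))

/-- Geodesics issued orthogonally may have any positive speed; this reduces them to unit speed. -/
theorem isCutTime_comp_mul {k s : ℝ} (hγ : IsUnitGeodesic γ) (hk : 0 < k) :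
    IsCutTime A (fun t => γ (k * t)) s ↔ IsCutTime A γ (k * s) := by
  have hlen : ∀ r, pathELength (𝓡 2) (fun t => γ (k * t)) 0 r = pathELength (𝓡 2) γ 0 (k * r) := by
    intro r
    rw [pathELength_of_norm_velocity_eq (k := k), pathELength_of_norm_velocity_eq hγ.2,
      ENNReal.ofReal_one, one_mul, sub_zero, sub_zero, ENNReal.ofReal_mul hk.le]
    intro t
    rw [velocity_comp_mul hγ.1, norm_tangentSmul, hγ.2, abs_of_pos hk, mul_one]
  have hset : ∀ s, s ∈ {s : ℝ | 0 ≤ s ∧ ∀ r : ℝ, s < r →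
      pathELength (𝓡 2) (fun t => γ (k * t)) 0 r ≠ infEDist (γ (k * r)) A} ↔
      k * s ∈ {s : ℝ | 0 ≤ s ∧ ∀ r : ℝ, s < r → pathELength (𝓡 2) γ 0 r ≠ infEDist (γ r) A} := by
    intro s
    simp only [mem_ofPred_eq, hlen, mul_nonneg_iff_of_pos_left hk]
    refine and_congr_right fun _ => ⟨fun h r hr => ?_, fun h r hr => h _ (by gcongr)⟩
    have := h (r / k) (by rwa [lt_div_iff₀' hk])
    rwa [mul_div_cancel₀ _ hk.ne'] at this
  refine and_congr (hset s) ⟨fun h u hu => ?_, fun h u hu => ?_⟩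
  · have := h ((hset (u / k)).2 (by rwa [mul_div_cancel₀ _ hk.ne']))
    rwa [le_div_iff₀' hk] at this
  · exact le_of_mul_le_mul_left (h ((hset u).1 hu)) hk

end Compact

end CutTimes

/-! ### Normal directions in the plane. -/

section Conormal

/-- A vector spanning the kernel of a nonzero linear form on the plane. -/
noncomputable def conormal (w : Plane →L[ℝ] ℝ) : Plane :=
  !₂[-w (EuclideanSpace.single 1 1), w (EuclideanSpace.single 0 1)]

theorem apply_eq_plane (w : Plane →L[ℝ] ℝ) (v : Plane) :
    w v = v 0 * w (EuclideanSpace.single 0 1) + v 1 * w (EuclideanSpace.single 1 1) := by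
  have hv : v = v 0 • EuclideanSpace.single 0 1 + v 1 • EuclideanSpace.single 1 1 := by
    ext i; fin_cases i <;> simp
  conv_lhs => rw [hv]
  simp

theorem apply_conormal (w : Plane →L[ℝ] ℝ) : w (conormal w) = 0 := by
  rw [apply_eq_plane]
  simp [conormal]
  ring

theorem conormal_ne_zero {w : Plane →L[ℝ] ℝ} (hw : w ≠ 0) : conormal w ≠ 0 := by
  intro h
  apply hw
  ext v
  have h0 := congrArg (fun u : Plane => u 0) h
  have h1 := congrArg (fun u : Plane => u 1) h
  simp only [conormal] at h0 h1
  simp at h0 h1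
  rw [apply_eq_plane, h0, h1]
  simp

/-- The kernel is a line. This is where dimension two enters, leaving only two unit normals at each
point of `α`. -/
theorem exists_eq_smul_conormal {w : Plane →L[ℝ] ℝ} (hw : w ≠ 0) {v : Plane} (hv : w v = 0) :
    ∃ k : ℝ, v = k • conormal w := by
  rw [apply_eq_plane] at hv
  set a := w (EuclideanSpace.single 0 1) with ha
  set b := w (EuclideanSpace.single 1 1) with hb
  have hab : a ^ 2 + b ^ 2 ≠ 0 := by
    intro h
    apply hw
    ext v
    have ha0 : a = 0 := by nlinarith
    have hb0 : b = 0 := by nlinarith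
    rw [apply_eq_plane, ← ha, ← hb, ha0, hb0]
    simp
  refine ⟨(a * v 1 - b * v 0) / (a ^ 2 + b ^ 2), ?_⟩
  ext i
  fin_cases i
  · simp [conormal, ← ha, ← hb]
    field_simp
    linear_combination a * hv
  · simp [conormal, ← ha, ← hb]
    field_simp
    linear_combination b * hv

theorem contDiff_conormal {n : WithTop ℕ∞} : ContDiff ℝ n conormal := by
  rw [contDiff_euclidean]
  intro i
  fin_cases i
  · exact (contDiff_id.clm_apply contDiff_const).neg
  · exact contDiff_id.clm_apply contDiff_const

end Conormal

/-! ### Geodesics normal to a simple closed geodesic. -/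

section NormalGeodesics

variable {M : Type*} [MetricSpace M] [ChartedSpace Plane M] [IsManifold (𝓡 2) ∞ M]
  [RiemannianBundle (fun x : M => TangentSpace (𝓡 2) x)]
  [IsContMDiffRiemannianBundle (𝓡 2) ∞ Plane (fun x : M => TangentSpace (𝓡 2) x)]

open Metric

theorem metricForm_tangentCoord_congr {x₀ x₁ : M} {v w : TangentBundle (𝓡 2) M} (h : w.1 = v.1)
    (h₀ : v.1 ∈ (chartAt Plane x₀).source) (h₁ : v.1 ∈ (chartAt Plane x₁).source) :
    metricForm x₀ (tangentCoord x₀ v).1 (tangentCoord x₀ v).2 (tangentCoord x₀ w).2 =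
      metricForm x₁ (tangentCoord x₁ v).1 (tangentCoord x₁ v).2 (tangentCoord x₁ w).2 := by
  obtain ⟨p, v⟩ := v
  obtain ⟨q, w⟩ := w
  change q = p at h
  subst h
  exact (chartMetric_chartCoord h₀ v w).trans (chartMetric_chartCoord h₁ v w).symm

/-- The unit speed geodesics issued orthogonally from `α`. -/
def IsUnitNormal (α γ : ℝ → M) : Prop :=
  IsUnitGeodesic γ ∧ ∃ θ, γ 0 = α θ ∧ ∀ x₀ : M, α θ ∈ (chartAt Plane x₀).source →
    metricForm x₀ (tangentCoord x₀ (velocity α θ)).1 (tangentCoord x₀ (velocity α θ)).2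
      (tangentCoord x₀ (velocity γ 0)).2 = 0

variable {α γ : ℝ → M} {l : ℝ}

theorem IsUnitNormal.mem_range (h : IsUnitNormal α γ) : γ 0 ∈ range α :=
  let ⟨θ, hθ, _⟩ := h.2
  ⟨θ, hθ.symm⟩

theorem isUnitNormal_of_chart (hγ : IsUnitGeodesic γ) {θ : ℝ} (hθ : γ 0 = α θ) {x₀ : M}
    (hx₀ : α θ ∈ (chartAt Plane x₀).source)
    (h : metricForm x₀ (tangentCoord x₀ (velocity α θ)).1 (tangentCoord x₀ (velocity α θ)).2
      (tangentCoord x₀ (velocity γ 0)).2 = 0) : IsUnitNormal α γ :=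
  ⟨hγ, θ, hθ, fun _ hx₁ => (metricForm_tangentCoord_congr (v := velocity α θ) (w := velocity γ 0)
    hθ hx₁ hx₀).trans h⟩

theorem issuesOrthogonally_iff {β : ℝ → M} : IssuesOrthogonally α β ↔
    IsGeodesic β ∧ (velocity β 0).2 ≠ 0 ∧ ∃ θ, β 0 = α θ ∧
      metricForm (α θ) (tangentCoord (α θ) (velocity α θ)).1 (tangentCoord (α θ) (velocity α θ)).2
      (tangentCoord (α θ) (velocity β 0)).2 = 0 := by
  refine and_congr_right fun hβ => ?_
  generalize hw : velocity β 0 = w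
  have hw1 : β 0 = w.1 := congrArg TotalSpace.proj hw
  rw [hw1]
  obtain ⟨q, w⟩ := w
  constructor
  · rintro ⟨t, v, hv, hin, heq⟩
    obtain rfl : q = α t := congrArg TotalSpace.proj heq
    obtain rfl : w = v := eq_of_heq (TotalSpace.mk.inj heq).2
    refine ⟨hv, t, rfl, ?_⟩
    refine (chartMetric_chartCoord (mem_chart_source _ _) _ _).trans ?_
    exact (real_inner_comm _ _).trans hin
  · rintro ⟨hv, t, heq, hin⟩
    change q = α t at heq
    subst heq
    refine ⟨t, w, hv, ?_, rfl⟩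
    rw [real_inner_comm]
    exact (chartMetric_chartCoord (mem_chart_source _ _) _ _).symm.trans hin

theorem IsUnitNormal.issuesOrthogonally (h : IsUnitNormal α γ) : IssuesOrthogonally α γ := by
  obtain ⟨hγ, θ, hθ, horth⟩ := h
  refine issuesOrthogonally_iff.2 ⟨hγ.1, fun h0 => ?_, θ, hθ, horth _ (mem_chart_source _ _)⟩
  have := hγ.2 0
  rw [h0, norm_zero] at this
  exact zero_ne_one this

theorem IssuesOrthogonally.exists_isUnitNormal [CompactSpace M] {β : ℝ → M}
    (h : IssuesOrthogonally α β) :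
    ∃ k > 0, ∃ γ : ℝ → M, IsUnitNormal α γ ∧ β = fun t => γ (k * t) := by
  obtain ⟨hβ, hne, θ, hθ, horth⟩ := issuesOrthogonally_iff.1 h
  obtain ⟨γ, hγ, hγ0, hγv⟩ := exists_unitGeodesic_tangentSmul (velocity β 0)
  have hk : 0 < ‖(velocity β 0).2‖ := norm_pos_iff.2 hne
  set k := ‖(velocity β 0).2‖
  have hγ0' : γ 0 = β 0 := hγ0
  refine ⟨k, hk, γ, isUnitNormal_of_chart hγ (hγ0'.trans hθ) (mem_chart_source _ _) ?_, ?_⟩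
  · rw [← hγv, tangentCoord_tangentSmul, map_smul, smul_eq_mul] at horth
    exact (mul_eq_zero.1 horth).resolve_left hk.ne'
  · refine hβ.eq_of_velocity_eq (hγ.1.comp_mul k) (t := 0) ?_
    rw [velocity_comp_mul hγ.1, mul_zero, hγv]

theorem IsSimpleClosedGeodesic.velocity_periodic (hα : IsSimpleClosedGeodesic α l) :
    Function.Periodic (velocity α) l := by
  intro t
  have h : (fun s => α (s + l)) = α := funext hα.periodic
  rw [← velocity_comp_add l (hα.geodesic.mdifferentiableAt _), h]

/-- Two parameters of the same point differ by a multiple of the period. Consequently normality does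
not depend on the parameter chosen for the starting point. -/
theorem IsSimpleClosedGeodesic.velocity_eq (hα : IsSimpleClosedGeodesic α l) {s t : ℝ}
    (h : α s = α t) : velocity α s = velocity α t := by
  obtain ⟨s', hs', hs⟩ := hα.velocity_periodic.exists_mem_Ico₀ hα.pos s
  obtain ⟨t', ht', ht⟩ := hα.velocity_periodic.exists_mem_Ico₀ hα.pos t
  have h1 : α s = α s' := congrArg TotalSpace.proj hs
  have h2 : α t = α t' := congrArg TotalSpace.proj ht
  rw [hs, ht, hα.injOn hs' ht' (by rw [← h1, ← h2, h])]

theorem IsSimpleClosedGeodesic.eq_of_mem_Ico (hα : IsSimpleClosedGeodesic α l) {s t : ℝ}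
    (hst : t ∈ Ico s (s + l)) (h : α s = α t) : t = s := by
  obtain ⟨m, hm, -⟩ := existsUnique_sub_zsmul_mem_Ico hα.pos s 0
  have hs := hα.periodic.sub_zsmul_eq m (x := s)
  have ht := hα.periodic.sub_zsmul_eq m (x := t)
  rw [zero_add] at hm
  rcases lt_or_ge (t - m • l) l with h1 | h1
  · have := hα.injOn hm ⟨by linarith [hm.1, hst.1], h1⟩ (by rw [hs, ht, h])
    linarith
  · have ht' := hα.periodic.sub_eq (t - m • l)
    have := hα.injOn hm (x₂ := t - m • l - l)
      ⟨by linarith, by linarith [hm.2, hst.2]⟩ (by rw [hs, ht', ht, h])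
    linarith [hst.2]

/-- The rest of one period has compact image missing `α θ₀`, by injectivity; so points of `α` near
`α θ₀` come from nearby parameters. -/
theorem IsSimpleClosedGeodesic.eventually_exists_mem_ball (hα : IsSimpleClosedGeodesic α l)
    (θ₀ : ℝ) {ε : ℝ} (hε : 0 < ε) :
    ∀ᶠ x in 𝓝 (α θ₀), x ∈ range α → ∃ θ ∈ ball θ₀ ε, x = α θ := by
  have hl := hα.pos
  have hK : IsCompact (α '' (Icc (θ₀ - l / 2) (θ₀ + l / 2) \ ball θ₀ ε)) :=
    (isCompact_Icc.diff isOpen_ball).image hα.geodesic.continuous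
  have hmem : α θ₀ ∉ α '' (Icc (θ₀ - l / 2) (θ₀ + l / 2) \ ball θ₀ ε) := by
    rintro ⟨θ, ⟨hθ, hθε⟩, heq⟩
    apply hθε
    have : θ = θ₀ := by
      rcases le_total θ₀ θ with h | h
      · exact hα.eq_of_mem_Ico ⟨h, by linarith [hθ.2]⟩ heq.symm
      · exact (hα.eq_of_mem_Ico ⟨h, by linarith [hθ.1]⟩ heq).symm
    rw [this]
    exact mem_ball_self hε
  filter_upwards [hK.isClosed.isOpen_compl.mem_nhds hmem]
  rintro _ hx ⟨t, rfl⟩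
  obtain ⟨θ, hθ, heq⟩ := hα.periodic.exists_mem_Ico hl t (θ₀ - l / 2)
  refine ⟨θ, by_contra fun h => hx ⟨θ, ⟨⟨hθ.1, by linarith [hθ.2]⟩, h⟩, heq.symm⟩, heq⟩

theorem IsUnitNormal.orthogonal (hα : IsSimpleClosedGeodesic α l) (h : IsUnitNormal α γ) {θ : ℝ}
    (hθ : γ 0 = α θ) {x₀ : M} (hx₀ : α θ ∈ (chartAt Plane x₀).source) :
    metricForm x₀ (tangentCoord x₀ (velocity α θ)).1 (tangentCoord x₀ (velocity α θ)).2
      (tangentCoord x₀ (velocity γ 0)).2 = 0 := by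
  obtain ⟨-, θ', hθ', horth⟩ := h
  have hv := hα.velocity_eq (hθ.symm.trans hθ')
  have := horth x₀ (by rwa [← hθ', hθ])
  rwa [← hv] at this

/-- Otherwise `α` would be constant by uniqueness of geodesics, against injectivity on a period. -/
theorem IsSimpleClosedGeodesic.velocity_ne_zero (hα : IsSimpleClosedGeodesic α l) (θ : ℝ) :
    (velocity α θ).2 ≠ 0 := by
  intro h0
  have hconst : α = fun t => α (0 * t + θ) := by
    refine hα.geodesic.eq_of_velocity_eq (hα.geodesic.comp_affine 0 θ) (t := θ) ?_
    rw [velocity_comp_affine' 0 θ (hα.geodesic.mdifferentiableAt _), zero_mul, zero_add]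
    refine congrArg (TotalSpace.mk (α θ)) ?_
    rw [zero_smul]
    exact h0
  have hl := hα.pos
  have h1 : α 0 = α (l / 2) := by rw [hconst]; simp
  have := hα.injOn ⟨le_rfl, hl⟩ ⟨by linarith, by linarith⟩ h1
  linarith

theorem IsSimpleClosedGeodesic.metricForm_velocity_ne_zero (hα : IsSimpleClosedGeodesic α l)
    {θ : ℝ} {x₀ : M} (hx₀ : α θ ∈ (chartAt Plane x₀).source) :
    metricForm x₀ (tangentCoord x₀ (velocity α θ)).1 (tangentCoord x₀ (velocity α θ)).2 ≠ 0 := by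
  intro h
  have h1 := metricForm_tangentCoord (v := velocity α θ) hx₀
  rw [h, zero_apply] at h1
  exact hα.velocity_ne_zero θ (norm_eq_zero.1 (pow_eq_zero_iff two_ne_zero |>.1 h1.symm))

/-- A unit normal vector of `α`, in the chart at `x₀`. -/
noncomputable def unitNormalCoord (x₀ : M) (α : ℝ → M) (θ : ℝ) : Plane :=
  (√(metricForm x₀ (tangentCoord x₀ (velocity α θ)).1
    (conormal (metricForm x₀ (tangentCoord x₀ (velocity α θ)).1 (tangentCoord x₀ (velocity α θ)).2))
    (conormal (metricForm x₀ (tangentCoord x₀ (velocity α θ)).1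
      (tangentCoord x₀ (velocity α θ)).2))))⁻¹ •
    conormal (metricForm x₀ (tangentCoord x₀ (velocity α θ)).1 (tangentCoord x₀ (velocity α θ)).2)

section

variable (hα : IsSimpleClosedGeodesic α l) {θ : ℝ} {x₀ : M}
  (hx₀ : α θ ∈ (chartAt Plane x₀).source)

include hα hx₀

theorem metricForm_conormal_pos : 0 < metricForm x₀ (tangentCoord x₀ (velocity α θ)).1
    (conormal (metricForm x₀ (tangentCoord x₀ (velocity α θ)).1 (tangentCoord x₀ (velocity α θ)).2))
    (conormal (metricForm x₀ (tangentCoord x₀ (velocity α θ)).1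
      (tangentCoord x₀ (velocity α θ)).2)) :=
  (isSmoothMetricOn_metricForm x₀).pos _ (tangentCoord_fst_mem (v := velocity α θ) hx₀) _
    (conormal_ne_zero (hα.metricForm_velocity_ne_zero hx₀))

theorem metricForm_velocity_unitNormalCoord :
    metricForm x₀ (tangentCoord x₀ (velocity α θ)).1 (tangentCoord x₀ (velocity α θ)).2
      (unitNormalCoord x₀ α θ) = 0 := by
  rw [unitNormalCoord, map_smul, apply_conormal, smul_zero]

theorem metricForm_unitNormalCoord :
    metricForm x₀ (tangentCoord x₀ (velocity α θ)).1 (unitNormalCoord x₀ α θ)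
      (unitNormalCoord x₀ α θ) = 1 := by
  have h := metricForm_conormal_pos hα hx₀
  rw [unitNormalCoord, map_smul, smul_eq_mul, map_smul, smul_apply, smul_eq_mul, ← mul_assoc,
    ← mul_inv, Real.mul_self_sqrt h.le, inv_mul_cancel₀ h.ne']

theorem contDiffAt_tangentCoord_velocity :
    ContDiffAt ℝ ∞ (fun t => tangentCoord x₀ (velocity α t)) θ := by
  have hs := hα.geodesic.1 θ
  have hc := contDiffAt_extChartAt_comp hs hx₀
  refine ContDiffAt.congr_of_eventuallyEq ?_ (eventually_tangentCoord_velocity_eq hs hx₀)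
  exact hc.prodMk ((hc.fderiv_right (m := ∞) (by simp)).clm_apply contDiffAt_const)

theorem contDiffAt_unitNormalCoord : ContDiffAt ℝ ∞ (unitNormalCoord x₀ α) θ := by
  have h := contDiffAt_tangentCoord_velocity hα hx₀
  have hm : ContDiffAt ℝ ∞ (fun t => metricForm x₀ (tangentCoord x₀ (velocity α t)).1) θ := by
    have h1 : ContDiffAt ℝ ∞ (metricForm x₀) (tangentCoord x₀ (velocity α θ)).1 :=
      (isSmoothMetricOn_metricForm x₀).contDiffOn.contDiffAt
        ((isOpen_extChartAt_target x₀).mem_nhds (tangentCoord_fst_mem (v := velocity α θ) hx₀))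
    exact ContDiffAt.comp (g := metricForm x₀) (f := fun t => (tangentCoord x₀ (velocity α t)).1) θ h1
      h.fst
  have hc := (contDiff_conormal (n := ∞)).contDiffAt.comp θ (hm.clm_apply h.snd)
  have hpos := metricForm_conormal_pos hα hx₀
  exact (((hm.clm_apply hc).clm_apply hc).sqrt hpos.ne' |>.inv
    (Real.sqrt_ne_zero'.2 hpos)).smul hc

/-- There are two unit normal vectors of `α` at each point. -/
theorem eq_unitNormalCoord_or_neg {v : Plane}
    (hv : metricForm x₀ (tangentCoord x₀ (velocity α θ)).1 (tangentCoord x₀ (velocity α θ)).2 v = 0)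
    (hv1 : metricForm x₀ (tangentCoord x₀ (velocity α θ)).1 v v = 1) :
    v = unitNormalCoord x₀ α θ ∨ v = -unitNormalCoord x₀ α θ := by
  have h := metricForm_conormal_pos hα hx₀
  obtain ⟨k, rfl⟩ := exists_eq_smul_conormal (hα.metricForm_velocity_ne_zero hx₀) hv
  rw [unitNormalCoord]
  set u := conormal (metricForm x₀ (tangentCoord x₀ (velocity α θ)).1
    (tangentCoord x₀ (velocity α θ)).2)
  set g := metricForm x₀ (tangentCoord x₀ (velocity α θ)).1 u u
  have hk : (k * √g) ^ 2 = 1 := by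
    rw [map_smul, smul_eq_mul, map_smul, smul_apply, smul_eq_mul] at hv1
    rw [mul_pow, Real.sq_sqrt h.le]
    linarith
  have hs : √g ≠ 0 := Real.sqrt_ne_zero'.2 h
  rw [← neg_smul]
  rcases sq_eq_sq_iff_eq_or_eq_neg.1 (hk.trans (one_pow 2).symm) with h1 | h1
  · left
    rw [eq_inv_of_mul_eq_one_left h1]
  · right
    rw [← neg_eq_iff_eq_neg, ← neg_mul] at h1
    rw [← eq_inv_of_mul_eq_one_left h1, neg_neg]

end

theorem exists_isUnitNormal [CompactSpace M] (hα : IsSimpleClosedGeodesic α l) (θ : ℝ) :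
    ∃ γ : ℝ → M, IsUnitNormal α γ ∧ γ 0 = α θ := by
  have hsrc := mem_chart_source Plane (α θ)
  obtain ⟨v, hv, hvy⟩ := exists_tangentCoord_eq (α θ)
    (y := ((tangentCoord (α θ) (velocity α θ)).1, unitNormalCoord (α θ) α θ))
    (mem_extChartAt_target (α θ))
  have hp : v.1 = α θ := (extChartAt (𝓡 2) (α θ)).injOn (by rwa [extChartAt_source])
    (by rwa [extChartAt_source]) (congrArg Prod.fst hvy)
  have hnorm := metricForm_tangentCoord hv
  rw [hvy, metricForm_unitNormalCoord hα hsrc] at hnorm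
  obtain ⟨γ, hγ, hγ0⟩ := exists_unitGeodesic_velocity_eq v
    (((pow_eq_one_iff_of_nonneg (norm_nonneg _) two_ne_zero).1 hnorm.symm))
  have h0 : γ 0 = α θ := (congrArg TotalSpace.proj hγ0).trans hp
  refine ⟨γ, isUnitNormal_of_chart hγ h0 hsrc ?_, h0⟩
  rw [hγ0, hvy]
  exact metricForm_velocity_unitNormalCoord hα hsrc

variable [IsRiemannianManifold (𝓡 2) M]

/-- Moving the starting point along `α` cannot shorten the distance to a point of `γ`, so the first
variation has a sign. Running `α` backwards gives the opposite sign. -/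
theorem isUnitNormal_of_infDist_eq (hα : IsSimpleClosedGeodesic α l) (hγ : IsUnitGeodesic γ)
    (h0 : γ 0 ∈ range α) {s : ℝ} (hs : 0 < s) (hd : infDist (γ s) (range α) = s) :
    IsUnitNormal α γ := by
  obtain ⟨θ, hθ⟩ := h0
  have hsrc := mem_chart_source Plane (γ 0)
  have hsrcα : α θ ∈ (chartAt Plane (γ 0)).source := by rwa [hθ]
  obtain ⟨r₀, hr₀, H⟩ := exists_dist_le_first_variation_left (γ 0)
  set r := min r₀ s
  have hr : 0 < r := lt_min hr₀ hs
  obtain ⟨C, hC, δ, hδ, H⟩ := H r ⟨hr, min_le_left _ _⟩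
  have hdr := hγ.infDist_eq_of_le (A := range α) ⟨θ, hθ⟩ hr.le (min_le_right r₀ s) hd
  set L := metricForm (γ 0) (extChartAt (𝓡 2) (γ 0) (γ 0)) (tangentCoord (γ 0) (velocity γ 0)).2
    with hL
  have key : ∀ a : ℝ → M, IsGeodesic a → ∀ t, a t = γ 0 → range a ⊆ range α →
      0 ≤ -L (tangentCoord (γ 0) (velocity a t)).2 := by
    intro a ha t hat hsub
    have hd := (ha.hasDerivAt_tangentCoord (x₀ := γ 0) (t := t) (by rwa [hat])).1
    have := nonneg_of_eventually_quadratic (k := 0) (C := C) (L := -L) hd ?_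
    · rwa [zero_add, neg_apply] at this
    have hc : Tendsto (fun h => a (t + h)) (𝓝[>] 0) (𝓝 (γ 0)) := by
      have : Tendsto (fun h => a (t + h)) (𝓝 0) (𝓝 (a (t + 0))) :=
        (ha.continuous.comp (continuous_const.add continuous_id)).tendsto 0
      rw [add_zero, hat] at this
      exact this.mono_left nhdsWithin_le_nhds
    filter_upwards [hc.eventually (ball_mem_nhds _ hδ)] with h hh
    have h1 := H γ hγ 0 (by rwa [dist_self]) (a (t + h)) hh
    have h2 : r ≤ dist (γ (0 + r)) (a (t + h)) := by
      rw [zero_add]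
      exact hdr.ge.trans (infDist_le_dist_of_mem (hsub ⟨_, rfl⟩))
    rw [neg_apply, tangentCoord_velocity_fst, tangentCoord_velocity_fst, hat]
    linarith
  have h1 := key α hα.geodesic θ hθ subset_rfl
  have h2 := key (fun t => α (-t)) hα.geodesic.comp_neg (-θ) (by simpa using hθ)
    (range_subset_iff.2 fun t => ⟨_, rfl⟩)
  rw [tangentCoord_velocity_comp_neg hα.geodesic, neg_neg, map_neg, neg_neg] at h2
  refine isUnitNormal_of_chart hγ hθ.symm hsrcα ?_
  rw [tangentCoord_velocity_fst, hθ]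
  refine (chartMetric_symm _ _ _ _).trans ?_
  change L (tangentCoord (γ 0) (velocity α θ)).2 = 0
  linarith

/-- Orthogonality of a minimizer comes from positive length only; over points of `α` a normal
geodesic is picked instead. -/
theorem exists_isUnitNormal_minimizing [CompactSpace M] (hα : IsSimpleClosedGeodesic α l) (x : M) :
    ∃ γ : ℝ → M, IsUnitNormal α γ ∧ γ (infDist x (range α)) = x := by
  rcases (infDist_nonneg (x := x) (s := range α)).eq_or_lt with h | h
  · have hx : x ∈ range α :=
      ((range_isCompact hα).isClosed.mem_iff_infDist_zero (range_nonempty α)).2 h.symm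
    obtain ⟨θ, rfl⟩ := hx
    obtain ⟨γ, hγ, h0⟩ := exists_isUnitNormal hα θ
    exact ⟨γ, hγ, by rw [← h, h0]⟩
  · obtain ⟨γ, hγ⟩ := exists_isMinimizingFromTo (range_isCompact hα) (range_nonempty α) x
    obtain ⟨h1, h2, h3⟩ := isMinimizingFromTo_iff.1 hγ
    exact ⟨γ, isUnitNormal_of_infDist_eq hα h1 h2 h (by rw [h3]), h3⟩

theorem mem_cutLocus_iff [CompactSpace M] {q : M} : q ∈ cutLocus α ↔
    ∃ γ : ℝ → M, IsUnitNormal α γ ∧ q = γ (cutTime (range α) γ) := by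
  constructor
  · rintro ⟨β, s, hβ, hs, rfl⟩
    obtain ⟨k, hk, γ, hγ, rfl⟩ := hβ.exists_isUnitNormal
    rw [isCutTime_comp_mul hγ.1 hk, isCutTime_iff hγ.1 hγ.mem_range] at hs
    exact ⟨γ, hγ, congrArg γ hs⟩
  · rintro ⟨γ, hγ, rfl⟩
    exact ⟨γ, _, hγ.issuesOrthogonally, (isCutTime_iff hγ.1 hγ.mem_range).2 rfl, rfl⟩

end NormalGeodesics

/-! ### The normal exponential map in coordinates. -/

section NormalExponential

variable {M : Type*} [MetricSpace M] [ChartedSpace Plane M] [IsManifold (𝓡 2) ∞ M]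
  [RiemannianBundle (fun x : M => TangentSpace (𝓡 2) x)]
  [IsContMDiffRiemannianBundle (𝓡 2) ∞ Plane (fun x : M => TangentSpace (𝓡 2) x)]

open Metric

variable [IsRiemannianManifold (𝓡 2) M] {α γ₀ : ℝ → M} {l θ₀ : ℝ}

theorem IsSimpleClosedGeodesic.injOn_Ico (hα : IsSimpleClosedGeodesic α l) (a : ℝ) :
    InjOn α (Ico a (a + l)) := by
  intro s hs t ht h
  rcases le_total s t with hst | hst
  · exact (hα.eq_of_mem_Ico ⟨hst, by linarith [hs.1, ht.2]⟩ h).symm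
  · exact hα.eq_of_mem_Ico ⟨hst, by linarith [ht.1, hs.2]⟩ h.symm

/-- Parameters are taken in the period centered at `θ₀`; there they are unique, so they must be the
nearby ones. -/
theorem IsSimpleClosedGeodesic.exists_tendsto (hα : IsSimpleClosedGeodesic α l) {x : ℕ → M}
    (hx : ∀ n, x n ∈ range α) (hlim : Tendsto x atTop (𝓝 (α θ₀))) :
    ∃ θ : ℕ → ℝ, Tendsto θ atTop (𝓝 θ₀) ∧ ∀ n, x n = α (θ n) := by
  have hl := hα.pos
  have h : ∀ n, ∃ θ ∈ Ico (θ₀ - l / 2) (θ₀ - l / 2 + l), x n = α θ := by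
    intro n
    obtain ⟨t, ht⟩ := hx n
    obtain ⟨θ, hθ, h⟩ := hα.periodic.exists_mem_Ico hl t (θ₀ - l / 2)
    exact ⟨θ, hθ, ht.symm.trans h⟩
  choose θ hθ hxθ using h
  refine ⟨θ, Metric.tendsto_nhds.2 fun ε hε => ?_, hxθ⟩
  filter_upwards [hlim.eventually
    (hα.eventually_exists_mem_ball θ₀ (lt_min hε (half_pos hl)))] with n hn
  obtain ⟨t, ht, hxt⟩ := hn (hx n)
  rw [mem_ball, Real.dist_eq, lt_min_iff] at ht
  have h2 := abs_lt.1 ht.2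
  rw [hα.injOn_Ico (θ₀ - l / 2) (hθ n) ⟨by linarith, by linarith⟩ ((hxθ n).symm.trans hxt)]
  exact ht.1

/-- `γ` is a unit speed geodesic issued from `α θ`, with the initial velocity `ν θ` in the chart
at `x₀`. -/
structure IsIssuedAlong (x₀ : M) (α : ℝ → M) (ν : ℝ → Plane) (γ : ℝ → M) (θ : ℝ) : Prop where
  unit : IsUnitGeodesic γ
  start : γ 0 = α θ
  velocity : (tangentCoord x₀ (velocity γ 0)).2 = ν θ

/-- The geodesic `γ₀` follows one of the two smooth local unit normal fields, and normal geodesics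
close to it follow the same one. -/
theorem exists_normalField (hα : IsSimpleClosedGeodesic α l) (h₀ : IsUnitNormal α γ₀)
    (hθ₀ : γ₀ 0 = α θ₀) :
    ∃ ν : ℝ → Plane, ContDiffAt ℝ ∞ ν θ₀ ∧ IsIssuedAlong (α θ₀) α ν γ₀ θ₀ ∧
      ∀ g : ℕ → ℝ → M, (∀ n, IsUnitNormal α (g n)) → VelocityTendsto g γ₀ 0 →
        ∃ θ : ℕ → ℝ, Tendsto θ atTop (𝓝 θ₀) ∧
          ∀ᶠ n in atTop, IsIssuedAlong (α θ₀) α ν (g n) (θ n) := by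
  have hsrc := mem_chart_source Plane (α θ₀)
  have hsrc₀ : γ₀ 0 ∈ (chartAt Plane (α θ₀)).source := by rwa [hθ₀]
  set p := α θ₀ with hp
  have hpm : ∀ (γ : ℝ → M) (θ : ℝ), IsUnitNormal α γ → γ 0 = α θ → α θ ∈ (chartAt Plane p).source →
      (tangentCoord p (velocity γ 0)).2 = unitNormalCoord p α θ ∨
      (tangentCoord p (velocity γ 0)).2 = -unitNormalCoord p α θ := by
    intro γ θ hγ hγθ hθ
    refine eq_unitNormalCoord_or_neg hα hθ (hγ.orthogonal hα hγθ hθ) ?_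
    have := hγ.1.metricForm_eq_one (x₀ := p) (t := 0) (by rwa [hγθ])
    rwa [tangentCoord_velocity_fst, hγθ] at this
  have hn := contDiffAt_unitNormalCoord hα hsrc
  obtain ⟨ε, hε, hX⟩ : ∃ ε : ℝ, (ε = 1 ∨ ε = -1) ∧
      (tangentCoord p (velocity γ₀ 0)).2 = ε • unitNormalCoord p α θ₀ := by
    rcases hpm γ₀ θ₀ h₀ hθ₀ hsrc with h | h
    · exact ⟨1, Or.inl rfl, by rw [h, one_smul]⟩
    · exact ⟨-1, Or.inr rfl, by rw [h, neg_one_smul]⟩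
  refine ⟨fun θ => ε • unitNormalCoord p α θ, (contDiffAt_const (c := ε)).smul hn, ⟨h₀.1, hθ₀, hX⟩,
    fun g hg hlim => ?_⟩
  obtain ⟨hgsrc, hgv⟩ := hlim p hsrc₀
  have hlim0 := hlim.tendsto
  rw [hθ₀] at hlim0
  obtain ⟨θ, hθ, hgθ⟩ := hα.exists_tendsto (fun n => (hg n).mem_range) hlim0
  refine ⟨θ, hθ, ?_⟩
  have hsum : Tendsto (fun n => (tangentCoord p (velocity (g n) 0)).2 +
      ε • unitNormalCoord p α (θ n)) atTop (𝓝 ((tangentCoord p (velocity γ₀ 0)).2 +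
      ε • unitNormalCoord p α θ₀)) :=
    ((continuous_snd.tendsto _).comp hgv).add ((hn.continuousAt.tendsto.comp hθ).const_smul ε)
  -- A geodesic on the other side would make the sum with the chosen normal zero, while the limit of
  -- these sums is twice a unit vector.
  have hne : (tangentCoord p (velocity γ₀ 0)).2 + ε • unitNormalCoord p α θ₀ ≠ 0 := by
    rw [← hX, ← two_smul ℝ]
    refine smul_ne_zero two_ne_zero fun h => ?_
    have := h₀.1.metricForm_eq_one hsrc₀
    rw [h, map_zero] at this
    exact zero_ne_one this
  filter_upwards [hsum.eventually_ne hne, hgsrc] with n hn1 hn2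
  refine ⟨(hg n).1, hgθ n, ?_⟩
  rw [hgθ n] at hn2
  rcases hpm (g n) (θ n) (hg n) (hgθ n) hn2 with h | h <;> rcases hε with rfl | rfl
  · rw [h, one_smul]
  · rw [h, neg_one_smul, add_neg_cancel] at hn1
    exact absurd rfl hn1
  · rw [h, one_smul, neg_add_cancel] at hn1
    exact absurd rfl hn1
  · rw [h, neg_one_smul]

theorem tangentCoord_velocity_comp_mul {γ : ℝ → M} (hγ : IsGeodesic γ) (x₀ : M) (k t : ℝ) :
    tangentCoord x₀ (velocity (fun s => γ (k * s)) t) =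
      (extChartAt (𝓡 2) x₀ (γ (k * t)), k • (tangentCoord x₀ (velocity γ (k * t))).2) := by
  rw [velocity_comp_mul hγ, tangentCoord_tangentSmul, tangentCoord_velocity_fst]

/-- The normal exponential map of `α`, in coordinates. -/
theorem exists_normalExp (hα : IsSimpleClosedGeodesic α l) {ν : ℝ → Plane}
    (hν : ContDiffAt ℝ ∞ ν θ₀) (h₀ : IsIssuedAlong (α θ₀) α ν γ₀ θ₀) (s : ℝ) :
    ∃ E : ℝ × ℝ → Plane, ContDiffAt ℝ 1 E (θ₀, s) ∧
      (∀ᶠ q in 𝓝 (θ₀, s), ∀ γ : ℝ → M, IsIssuedAlong (α θ₀) α ν γ q.1 →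
        γ q.2 ∈ (chartAt Plane (γ₀ s)).source ∧ extChartAt (𝓡 2) (γ₀ s) (γ q.2) = E q) ∧
      (s = 0 → ∀ᶠ θ in 𝓝 θ₀, E (θ, 0) = extChartAt (𝓡 2) (γ₀ s) (α θ)) := by
  have hsrc := mem_chart_source Plane (α θ₀)
  have hst : tangentCoord (α θ₀) (velocity (fun t => γ₀ (s * t)) 0) =
      (extChartAt (𝓡 2) (α θ₀) (α θ₀), s • ν θ₀) := by
    rw [tangentCoord_velocity_comp_mul h₀.unit.1, mul_zero, h₀.start, h₀.velocity]
  -- Transport is differentiable in the initial velocity for a fixed time only, so the length is put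
  -- into the velocity: `γ q.2` is the time `1` point of the geodesic with initial velocity `q.2 • ν
  -- q.1`.
  obtain ⟨Ψ, hΨc, -, hΨ⟩ := (h₀.unit.1.comp_mul s).transports (x₀ := α θ₀) (x₁ := γ₀ s) (a := 0)
    (b := 1) (by simp [h₀.start]) (by simp)
  rw [hst] at hΨc hΨ
  have hc : ContDiffAt ℝ 1 (fun q : ℝ × ℝ =>
      (extChartAt (𝓡 2) (α θ₀) (α q.1), q.2 • ν q.1)) (θ₀, s) := by
    have h1 : ContDiffAt ℝ 1 (fun θ => extChartAt (𝓡 2) (α θ₀) (α θ)) θ₀ :=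
      (contDiffAt_extChartAt_comp (hα.geodesic.1 θ₀) hsrc).of_le (by simp)
    have h2 : ContDiffAt ℝ 1 ν θ₀ := hν.of_le (by simp)
    exact (ContDiffAt.comp (θ₀, s) (g := fun θ => extChartAt (𝓡 2) (α θ₀) (α θ))
      h1 contDiffAt_fst).prodMk
      (contDiffAt_snd.smul (ContDiffAt.comp (θ₀, s) (g := ν) h2 contDiffAt_fst))
  have hαsrc : ∀ᶠ θ in 𝓝 θ₀, α θ ∈ (chartAt Plane (α θ₀)).source :=
    hα.geodesic.continuous.continuousAt ((chartAt Plane (α θ₀)).open_source.mem_nhds hsrc)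
  have hev := (hc.continuousAt.eventually hΨ).and
    ((continuous_fst.tendsto (θ₀, s)).eventually hαsrc)
  refine ⟨fun q => (Ψ (extChartAt (𝓡 2) (α θ₀) (α q.1), q.2 • ν q.1)).1,
    (ContDiffAt.comp (g := Ψ) (θ₀, s) hΨc hc).fst, ?_, ?_⟩
  · filter_upwards [hev] with q hq γ hγ
    obtain ⟨h1, h2⟩ := hq.1 _ (hγ.unit.1.comp_mul q.2) (by simpa [hγ.start] using hq.2)
      (by rw [tangentCoord_velocity_comp_mul hγ.unit.1, mul_zero, hγ.start, hγ.velocity])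
    rw [mul_one] at h1
    refine ⟨h1, ?_⟩
    rw [← h2, tangentCoord_velocity_comp_mul hγ.unit.1, mul_one]
  · rintro rfl
    have hline : Tendsto (fun θ : ℝ => (θ, (0 : ℝ))) (𝓝 θ₀) (𝓝 (θ₀, 0)) :=
      (continuous_id.prodMk continuous_const).tendsto θ₀
    filter_upwards [hline.eventually hev] with θ hq
    have hconst : velocity (fun t => α (0 * t + θ)) 0 = tangentSmul 0 (velocity α θ) := by
      rw [velocity_comp_affine' 0 θ (hα.geodesic.mdifferentiableAt _), zero_mul, zero_add]
    obtain ⟨h1, h2⟩ := hq.1 _ (hα.geodesic.comp_affine 0 θ) (by simpa using hq.2)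
      (by rw [hconst, tangentCoord_tangentSmul, zero_smul, zero_smul]; rfl)
    rw [← h2, tangentCoord_velocity_fst, zero_mul, zero_add]

theorem hasDerivAt_comp_normalExp {ν : ℝ → Plane} {s : ℝ} {E : ℝ × ℝ → Plane}
    (h₀ : IsIssuedAlong (α θ₀) α ν γ₀ θ₀) (hE : ContDiffAt ℝ 1 E (θ₀, s))
    (hEq : ∀ᶠ q in 𝓝 (θ₀, s), ∀ γ : ℝ → M, IsIssuedAlong (α θ₀) α ν γ q.1 →
        γ q.2 ∈ (chartAt Plane (γ₀ s)).source ∧ extChartAt (𝓡 2) (γ₀ s) (γ q.2) = E q) :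
    fderiv ℝ E (θ₀, s) (0, 1) = (tangentCoord (γ₀ s) (velocity γ₀ s)).2 := by
  have h1 := (hE.differentiableAt (by simp)).hasFDerivAt
  have hl : HasDerivAt (fun t : ℝ => (θ₀, t)) (0, 1) s :=
    (hasDerivAt_const s θ₀).prodMk (hasDerivAt_id s)
  have h2 : HasDerivAt (fun t : ℝ => E (θ₀, t)) (fderiv ℝ E (θ₀, s) (0, 1)) s :=
    h1.comp_hasDerivAt s hl
  have h3 := (h₀.unit.1.hasDerivAt_tangentCoord (x₀ := γ₀ s) (t := s) (mem_chart_source _ _)).1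
  refine h2.unique (h3.congr_of_eventuallyEq ?_)
  filter_upwards [hl.continuousAt.eventually hEq] with t ht
  rw [← (ht γ₀ h₀).2, tangentCoord_velocity_fst]

/-- On `α` the two partial derivatives are the velocities of `α` and of `γ₀`, which are nonzero and
orthogonal. -/
theorem injective_fderiv_normalExp_zero (hα : IsSimpleClosedGeodesic α l) (hn : IsUnitNormal α γ₀)
    {ν : ℝ → Plane} {E : ℝ × ℝ → Plane} (h₀ : IsIssuedAlong (α θ₀) α ν γ₀ θ₀)
    (hE : ContDiffAt ℝ 1 E (θ₀, 0))
    (hEq : ∀ᶠ q in 𝓝 (θ₀, (0 : ℝ)), ∀ γ : ℝ → M, IsIssuedAlong (α θ₀) α ν γ q.1 →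
        γ q.2 ∈ (chartAt Plane (γ₀ 0)).source ∧ extChartAt (𝓡 2) (γ₀ 0) (γ q.2) = E q)
    (hE0 : ∀ᶠ θ in 𝓝 θ₀, E (θ, 0) = extChartAt (𝓡 2) (γ₀ 0) (α θ)) :
    Function.Injective (fderiv ℝ E (θ₀, 0)) := by
  have hsrc := mem_chart_source Plane (γ₀ 0)
  have hsrcα : α θ₀ ∈ (chartAt Plane (γ₀ 0)).source := by rwa [← h₀.start]
  have h1 := (hE.differentiableAt (by simp)).hasFDerivAt
  have hl : HasDerivAt (fun t : ℝ => (t, (0 : ℝ))) (1, 0) θ₀ :=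
    (hasDerivAt_id θ₀).prodMk (hasDerivAt_const θ₀ 0)
  have h2 : HasDerivAt (fun t : ℝ => E (t, 0)) (fderiv ℝ E (θ₀, 0) (1, 0)) θ₀ :=
    h1.comp_hasDerivAt θ₀ hl
  have h3 := (hα.geodesic.hasDerivAt_tangentCoord hsrcα).1
  have hd1 : fderiv ℝ E (θ₀, 0) (1, 0) = (tangentCoord (γ₀ 0) (velocity α θ₀)).2 := by
    refine h2.unique (h3.congr_of_eventuallyEq ?_)
    filter_upwards [hE0] with t ht
    rw [ht, tangentCoord_velocity_fst]
  have hd2 := hasDerivAt_comp_normalExp h₀ hE hEq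
  have horth := hn.orthogonal hα h₀.start hsrcα
  have hne := hα.metricForm_velocity_ne_zero hsrcα
  have hunit := hn.1.metricForm_eq_one hsrc
  rw [tangentCoord_velocity_fst] at hunit
  rw [tangentCoord_velocity_fst, ← h₀.start] at horth hne
  set a := (tangentCoord (γ₀ 0) (velocity α θ₀)).2
  set X := (tangentCoord (γ₀ 0) (velocity γ₀ 0)).2
  set G := metricForm (γ₀ 0) (extChartAt (𝓡 2) (γ₀ 0) (γ₀ 0))
  rw [injective_iff_map_eq_zero]
  rintro ⟨u, v⟩ huv
  have hdec : ((u, v) : ℝ × ℝ) = u • ((1, 0) : ℝ × ℝ) + v • ((0, 1) : ℝ × ℝ) := by simp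
  rw [hdec, map_add, map_smul, map_smul, hd1, hd2] at huv
  have hv : v = 0 := by
    have h4 : G X (u • a + v • X) = 0 := by rw [huv, map_zero]
    have h5 : G X a = G a X := chartMetric_symm _ _ _ _
    rw [map_add, map_smul, map_smul, h5, horth, hunit] at h4
    simpa using h4
  rw [hv, zero_smul, add_zero, smul_eq_zero] at huv
  rcases huv with hu | ha
  · rw [hu, hv]; rfl
  · rw [ha, map_zero] at hne
    exact absurd rfl hne

end NormalExponential

/-! ### Estimates for covectors. -/

section FlatForms

attribute [-instance]
  Bundle.instNormedAddCommGroupOfRiemannianBundleOfIsTopologicalAddGroupOfContinuousConstSMulReal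
  Bundle.instInnerProductSpaceReal

variable {E : Type*} [NormedAddCommGroup E] [NormedSpace ℝ E]

/-- By homogeneity one sphere determines the norm; choosing the radius `‖ξ‖` converts a quadratic
error into a linear bound. -/
theorem norm_le_of_forall_norm_eq {w : E →L[ℝ] ℝ} {ξ : E} {K : ℝ} (hξ : ξ ≠ 0) (hK : 0 ≤ K)
    (h : ∀ η, ‖η‖ = ‖ξ‖ → w η ≤ K * ‖ξ‖ ^ 2) : ‖w‖ ≤ K * ‖ξ‖ := by
  have hξ' : 0 < ‖ξ‖ := norm_pos_iff.2 hξ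
  have key : ∀ v, w v ≤ K * ‖ξ‖ * ‖v‖ := by
    intro v
    rcases eq_or_ne v 0 with rfl | hv
    · simp
    · have hv' : 0 < ‖v‖ := norm_pos_iff.2 hv
      have := h ((‖ξ‖ / ‖v‖) • v) (by
        rw [norm_smul, Real.norm_of_nonneg (by positivity), div_mul_cancel₀ _ hv'.ne'])
      rw [map_smul, smul_eq_mul, div_mul_eq_mul_div, div_le_iff₀ hv'] at this
      refine le_of_mul_le_mul_left (this.trans_eq ?_) hξ'
      ring
  refine w.opNorm_le_bound (by positivity) fun v => ?_
  rw [Real.norm_eq_abs, abs_le]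
  have := key (-v)
  rw [map_neg, norm_neg] at this
  exact ⟨by linarith, key v⟩

/-- Coercivity of `G z` on `Y - X`, with `G z Y` compared to `G y Y`, turns closeness of covectors
at two base points into closeness of vectors. -/
theorem MetricBounds.norm_sub_le_of_forms {G : E → E →L[ℝ] E →L[ℝ] ℝ} {K : Set E} {lam C : ℝ}
    (hB : MetricBounds G K lam C) {z y X Y : E} (hz : z ∈ K) (hy : y ∈ K) :
    lam * ‖Y - X‖ ≤ C * ‖y - z‖ * ‖Y‖ + ‖G y Y - G z X‖ := by
  rcases eq_or_ne (Y - X) 0 with h0 | h0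
  · rw [h0, norm_zero, mul_zero]
    have := hB.C_nonneg
    positivity
  have hpos : 0 < ‖Y - X‖ := norm_pos_iff.2 h0
  have h1 := hB.lower z hz (Y - X)
  have h2 : G z (Y - X) (Y - X) = (G y Y - G z X) (Y - X) - (G y - G z) Y (Y - X) := by
    simp only [map_sub, sub_apply]
    ring
  have h3 : (G y Y - G z X) (Y - X) ≤ ‖G y Y - G z X‖ * ‖Y - X‖ :=
    (le_abs_self _).trans ((G y Y - G z X).le_opNorm _)
  have h4 : -((G y - G z) Y (Y - X)) ≤ C * ‖y - z‖ * ‖Y‖ * ‖Y - X‖ := by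
    refine (neg_le_abs _).trans (((G y - G z) Y).le_opNorm _ |>.trans ?_)
    gcongr
    refine ((G y - G z).le_opNorm Y).trans ?_
    gcongr
    exact hB.sub_le z hz y hy
  refine le_of_mul_le_mul_right ?_ hpos
  nlinarith

end FlatForms

/-! ### Regularity of the distance before the cut point. -/

section DistanceRegularity

variable {M : Type*} [MetricSpace M] [ChartedSpace Plane M] [IsManifold (𝓡 2) ∞ M]
  [RiemannianBundle (fun x : M => TangentSpace (𝓡 2) x)]
  [IsContMDiffRiemannianBundle (𝓡 2) ∞ Plane (fun x : M => TangentSpace (𝓡 2) x)]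

open Metric

variable [IsRiemannianManifold (𝓡 2) M] [CompactSpace M]

/-- Before the cut point, the minimizing geodesics from `A` depend in a Lipschitz way on their end
points. -/
theorem exists_lipschitz_minimizing {A : Set M} {γ₀ : ℝ → M} {s : ℝ} (h₀ : IsUnitGeodesic γ₀)
    (h₀A : γ₀ 0 ∈ A) (hs : 0 < s) (hsc : s < cutTime A γ₀) :
    ∃ C, ∀ᶠ y in 𝓝 (γ₀ s), y ≠ γ₀ s → ∀ γ : ℝ → M, IsUnitGeodesic γ → γ 0 ∈ A →
      γ (infDist y A) = y →
      |infDist y A - s| ≤ C * ‖extChartAt (𝓡 2) (γ₀ s) y - extChartAt (𝓡 2) (γ₀ s) (γ₀ s)‖ ∧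
      ‖(tangentCoord (γ₀ s) (velocity γ (infDist y A))).2 -
          (tangentCoord (γ₀ s) (velocity γ₀ s)).2‖ ≤
        C * ‖extChartAt (𝓡 2) (γ₀ s) y - extChartAt (𝓡 2) (γ₀ s) (γ₀ s)‖ := by
  have hsrc := mem_chart_source Plane (γ₀ s)
  have hsd : infDist (γ₀ s) A = s := (infDist_eq_iff h₀ h₀A hs.le).2 hsc.le
  set p := γ₀ s with hp
  set φ := extChartAt (𝓡 2) p with hφ
  obtain ⟨r₁, hr₁, H₁⟩ := exists_dist_le_first_variation p
  obtain ⟨r₂, hr₂, H₂⟩ := exists_dist_le_first_variation_left p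
  -- The geodesic `γ₀` still minimizes at time `s + r`, and minimizers to nearby points, longer than
  -- `s / 2`, can be cut back by `r`.
  set r := min (min r₁ r₂) (min (s / 2) (cutTime A γ₀ - s)) with hr
  have hr0 : 0 < r := lt_min (lt_min hr₁ hr₂) (lt_min (half_pos hs) (sub_pos.2 hsc))
  have hrs : r ≤ s / 2 := (min_le_right _ _).trans (min_le_left _ _)
  have hrc : r ≤ cutTime A γ₀ - s := (min_le_right _ _).trans (min_le_right _ _)
  obtain ⟨C₁, hC₁, δ₁, hδ₁, H₁⟩ := H₁ r ⟨hr0, (min_le_left _ _).trans (min_le_left _ _)⟩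
  obtain ⟨C₂, hC₂, δ₂, hδ₂, H₂⟩ := H₂ r ⟨hr0, (min_le_left _ _).trans (min_le_right _ _)⟩
  obtain ⟨ρ, hρ, -, hK, hball⟩ := exists_chart_ball p one_pos
  obtain ⟨lam, C₃, hB⟩ := (isSmoothMetricOn_metricForm p).exists_metricBounds
    (isCompact_closedBall _ ρ) (convex_closedBall _ _) hK
  obtain ⟨R, hR, hRK⟩ := hball ρ hρ
  have hlam := hB.lam_pos
  have hC₃ := hB.C_nonneg
  clear_value r
  -- upper and lower bounds for the distance to `A`
  have hup : ∀ γ : ℝ → M, IsUnitGeodesic γ → γ 0 ∈ A → ∀ u, r ≤ u → dist (γ u) p < δ₁ →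
      ∀ z, dist z p < δ₁ → infDist z A ≤ u + metricForm p (φ (γ u))
        (tangentCoord p (velocity γ u)).2 (φ z - φ (γ u)) + C₁ * ‖φ z - φ (γ u)‖ ^ 2 := by
    intro γ hγ hγ0 u hu hup z hz
    have h1 := H₁ γ hγ u hup z hz
    have h2 := hγ.infDist_le hγ0 (sub_nonneg.2 hu)
    have h3 := infDist_le_infDist_add_dist (s := A) (x := z) (y := γ (u - r))
    rw [dist_comm] at h3
    linarith
  -- A short distance to `A` near `p` would give a shortcut to `γ₀ (s + r)`, whose distance to `A`
  -- is `s + r`.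
  have hlow : ∀ z, dist z p < δ₂ → s + metricForm p (φ p)
        (tangentCoord p (velocity γ₀ s)).2 (φ z - φ p) - C₂ * ‖φ z - φ p‖ ^ 2 ≤ infDist z A := by
    intro z hz
    have h1 := H₂ γ₀ h₀ s (by rwa [← hp, dist_self]) z hz
    have h2 := (infDist_eq_iff h₀ h₀A (by linarith : 0 ≤ s + r)).2 (by linarith)
    have h3 := infDist_le_infDist_add_dist (s := A) (x := γ₀ (s + r)) (y := z)
    rw [← hp] at h1
    linarith
  set L := metricForm p (φ p) (tangentCoord p (velocity γ₀ s)).2 with hL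
  obtain ⟨ρ', hρ', hsymm⟩ : ∃ ρ' > 0, ∀ u, dist u (φ p) < ρ' → u ∈ φ.target ∧
      dist (φ.symm u) p < min δ₁ δ₂ := by
    have h1 : ∀ᶠ u in 𝓝 (φ p), u ∈ φ.target := extChartAt_target_mem_nhds p
    have h2 : Tendsto φ.symm (𝓝 (φ p)) (𝓝 p) := by
      have := (continuousAt_extChartAt_symm p : ContinuousAt φ.symm (φ p)).tendsto
      rwa [extChartAt_to_inv] at this
    exact Metric.eventually_nhds_iff.1
      (h1.and (h2.eventually (Metric.ball_mem_nhds p (lt_min hδ₁ hδ₂))))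
  set B := 1 + 1 / lam with hBdef
  refine ⟨‖L‖ + C₁ + C₂ + (C₃ * B + (4 * C₂ + 2 * C₁)) / lam, ?_⟩
  have hφc : ∀ᶠ y in 𝓝 p, dist (φ y) (φ p) < min 1 (ρ' / 2) :=
    (continuousAt_extChartAt_self p).eventually (Metric.ball_mem_nhds _ (by positivity))
  have hdc : ∀ᶠ y in 𝓝 p, s / 2 < infDist y A :=
    (continuous_infDist_pt A).continuousAt.eventually_const_lt
      (by change s / 2 < infDist p A; rw [hsd]; linarith)
  filter_upwards [hφc, hdc, Metric.ball_mem_nhds p (lt_min (lt_min hδ₁ hδ₂) hR)] with y hy1 hy2 hy3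
    hyp γ hγ hγ0 hγy
  rw [mem_ball, lt_min_iff, lt_min_iff] at hy3
  obtain ⟨⟨hyδ₁, hyδ₂⟩, hyR⟩ := hy3
  obtain ⟨hysrc, hyK⟩ := hRK y hyR
  have hpK := (hRK p (mem_ball_self hR)).2
  rw [dist_eq_norm, lt_min_iff] at hy1
  set d := infDist y A with hd
  set ξ := φ y - φ p with hξ
  have hξ0 : ξ ≠ 0 := by
    intro h
    exact hyp (φ.injOn (by rwa [extChartAt_source]) (by rwa [extChartAt_source]) (sub_eq_zero.1 h))
  have hξ1 : ‖ξ‖ ^ 2 ≤ ‖ξ‖ := by nlinarith [norm_nonneg ξ]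
  have hLξ : |L ξ| ≤ ‖L‖ * ‖ξ‖ := L.le_opNorm ξ
  have hy_up : d ≤ s + L ξ + C₁ * ‖ξ‖ ^ 2 :=
    hup γ₀ h₀ h₀A s (by linarith) (by rwa [← hp, dist_self]) y hyδ₁
  have hy_low : s + L ξ - C₂ * ‖ξ‖ ^ 2 ≤ d := hlow y hyδ₂
  have hC₁' : C₁ * ‖ξ‖ ^ 2 ≤ C₁ * ‖ξ‖ := by gcongr
  have hC₂' : C₂ * ‖ξ‖ ^ 2 ≤ C₂ * ‖ξ‖ := by gcongr
  set X := (tangentCoord p (velocity γ₀ s)).2 with hX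
  set Y := (tangentCoord p (velocity γ d)).2 with hY
  set L' := metricForm p (φ y) Y with hL'
  -- At the point of coordinates `φ y + η`, the lower bound with slope `L` based at `p` lies below
  -- the upper bound with slope `L'` based at `y`. Taking `‖η‖ = ‖ξ‖` forces the slopes to differ by
  -- `O(‖ξ‖)`.
  have hforms : ‖L - L'‖ ≤ (4 * C₂ + 2 * C₁) * ‖ξ‖ := by
    refine norm_le_of_forall_norm_eq hξ0 (by positivity) fun η hη => ?_
    obtain ⟨hz1, hz2⟩ := hsymm (φ y + η) (by
      rw [dist_eq_norm, show φ y + η - φ p = ξ + η by rw [hξ]; abel]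
      refine (norm_add_le _ _).trans_lt ?_
      rw [hη]
      linarith)
    rw [lt_min_iff] at hz2
    have h1 := hlow _ hz2.2
    have h2 := hup γ hγ hγ0 d (by linarith) (by rwa [hγy]) _ hz2.1
    rw [φ.right_inv hz1, show φ y + η - φ p = ξ + η by rw [hξ]; abel] at h1
    rw [φ.right_inv hz1, hγy, add_sub_cancel_left] at h2
    have h3 : ‖ξ + η‖ ^ 2 ≤ 4 * ‖ξ‖ ^ 2 := by
      have := norm_add_le ξ η
      rw [hη] at this
      nlinarith [norm_nonneg (ξ + η)]
    have h4 : C₂ * ‖ξ + η‖ ^ 2 ≤ C₂ * (4 * ‖ξ‖ ^ 2) := by gcongr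
    rw [hη] at h2
    rw [map_add] at h1
    rw [sub_apply]
    linarith
  have hYB : ‖Y‖ ≤ B := by
    have h1 := hγ.metricForm_eq_one (x₀ := p) (t := d) (by rwa [hγy])
    rw [tangentCoord_velocity_fst, hγy] at h1
    have h2 := hB.lower _ hyK Y
    rw [h1, mul_comm, ← le_div_iff₀ hlam] at h2
    nlinarith [norm_nonneg Y, sq_nonneg (‖Y‖ - 1)]
  have hξn := norm_nonneg ξ
  have hY_le : ‖Y - X‖ ≤ (C₃ * B + (4 * C₂ + 2 * C₁)) / lam * ‖ξ‖ := by
    have h1 := hB.norm_sub_le_of_forms (X := X) (Y := Y) hpK hyK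
    rw [norm_sub_rev (metricForm p (φ y) Y)] at h1
    have h2 : C₃ * ‖ξ‖ * ‖Y‖ ≤ C₃ * ‖ξ‖ * B := by gcongr
    rw [div_mul_eq_mul_div, le_div_iff₀ hlam]
    linarith
  have hq : 0 ≤ (C₃ * B + (4 * C₂ + 2 * C₁)) / lam := by positivity
  constructor
  · have h1 := abs_le.1 hLξ
    have : 0 ≤ (C₃ * B + (4 * C₂ + 2 * C₁)) / lam * ‖ξ‖ := by positivity
    have : 0 ≤ C₁ * ‖ξ‖ := by positivity
    have : 0 ≤ C₂ * ‖ξ‖ := by positivity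
    rw [abs_le]
    constructor <;> linarith
  · refine hY_le.trans ?_
    gcongr
    have := norm_nonneg L
    linarith

end DistanceRegularity

/-! ### No focal points before the cut point. -/

section FocalPoints

variable {M : Type*} [MetricSpace M] [ChartedSpace Plane M] [IsManifold (𝓡 2) ∞ M]
  [RiemannianBundle (fun x : M => TangentSpace (𝓡 2) x)]
  [IsContMDiffRiemannianBundle (𝓡 2) ∞ Plane (fun x : M => TangentSpace (𝓡 2) x)]

open Metric Asymptotics

variable [IsRiemannianManifold (𝓡 2) M] {α γ₀ : ℝ → M} {l θ₀ : ℝ}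

theorem VelocityTendsto.tendsto_comp {g : ℕ → ℝ → M} {γ : ℝ → M} {t : ℕ → ℝ} {a : ℝ}
    (h : VelocityTendsto g γ a) (hg : ∀ n, IsUnitGeodesic (g n)) (ht : Tendsto t atTop (𝓝 a)) :
    Tendsto (fun n => g n (t n)) atTop (𝓝 (γ a)) := by
  refine (tendsto_iff_of_dist ?_).1 h.tendsto
  refine squeeze_zero (fun _ => dist_nonneg) (fun n => (hg n).dist_le a (t n)) ?_
  have : Tendsto (fun n => |a - t n|) atTop (𝓝 |a - a|) := (tendsto_const_nhds.sub ht).abs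
  simpa using this

theorem isUnitNormal_of_velocityTendsto (hα : IsSimpleClosedGeodesic α l) {g : ℕ → ℝ → M}
    {γ : ℝ → M} (hg : ∀ n, IsUnitNormal α (g n)) (hγ : IsUnitGeodesic γ)
    (h : VelocityTendsto g γ 0) : IsUnitNormal α γ := by
  obtain ⟨θ₀, hθ₀⟩ : γ 0 ∈ range α := (range_isCompact hα).isClosed.mem_of_tendsto h.tendsto
    (Eventually.of_forall fun n => (hg n).mem_range)
  have hsrc := mem_chart_source Plane (γ 0)
  have hsrcα : α θ₀ ∈ (chartAt Plane (γ 0)).source := by rwa [hθ₀]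
  obtain ⟨θ, hθ, hgθ⟩ := hα.exists_tendsto (x := fun n => g n 0) (θ₀ := θ₀)
    (fun n => (hg n).mem_range) (hθ₀ ▸ h.tendsto)
  obtain ⟨h1, h2⟩ := h _ hsrc
  refine isUnitNormal_of_chart hγ hθ₀.symm hsrcα ?_
  have hc := contDiffAt_tangentCoord_velocity hα hsrcα
  have hm : ContinuousAt (fun t => metricForm (γ 0) (tangentCoord (γ 0) (velocity α t)).1
      (tangentCoord (γ 0) (velocity α t)).2) θ₀ := by
    have h1 : ContinuousAt (metricForm (γ 0)) (tangentCoord (γ 0) (velocity α θ₀)).1 :=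
      (isSmoothMetricOn_metricForm (γ 0)).contDiffOn.continuousOn.continuousAt
        ((isOpen_extChartAt_target _).mem_nhds (tangentCoord_fst_mem (v := velocity α θ₀) hsrcα))
    exact (ContinuousAt.comp (g := metricForm (γ 0))
      (f := fun t => (tangentCoord (γ 0) (velocity α t)).1) h1 hc.continuousAt.fst).clm_apply
      hc.continuousAt.snd
  have h3 : Continuous fun q : (Plane →L[ℝ] ℝ) × Plane => q.1 q.2 :=
    continuous_fst.clm_apply continuous_snd
  have hlim := (h3.tendsto _).comp
    ((hm.tendsto.comp hθ).prodMk_nhds ((continuous_snd.tendsto _).comp h2))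
  refine tendsto_nhds_unique (hlim.congr' ?_) tendsto_const_nhds
  filter_upwards [h1] with n hn
  exact (hg n).orthogonal hα (hgθ n) (by rwa [← hgθ n])

/-- Normality and the end point condition are closed, and unit geodesics subconverge. -/
theorem exists_subseq_minimizing [CompactSpace M] (hα : IsSimpleClosedGeodesic α l)
    {g : ℕ → ℝ → M} (hg : ∀ n, IsUnitNormal α (g n)) {z : ℕ → M} {x : M}
    (hz : Tendsto z atTop (𝓝 x)) (hgz : ∀ n, g n (infDist (z n) (range α)) = z n) :
    ∃ (γ : ℝ → M) (φ : ℕ → ℕ), IsUnitNormal α γ ∧ StrictMono φ ∧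
      VelocityTendsto (fun n => g (φ n)) γ 0 ∧ γ (infDist x (range α)) = x := by
  obtain ⟨γ, φ, hγ, hφ, hlim⟩ := exists_subseq_velocityTendsto g (fun n => (hg n).1) fun _ => 0
  simp only [add_zero] at hlim
  refine ⟨γ, φ, isUnitNormal_of_velocityTendsto hα (fun n => hg _) hγ (hlim 0), hφ, hlim 0, ?_⟩
  have hz' := hz.comp hφ.tendsto_atTop
  have h1 := (hlim (infDist x (range α))).tendsto_comp (fun n => (hg _).1)
    (((continuous_infDist_pt (range α)).tendsto x).comp hz')
  refine tendsto_nhds_unique (h1.congr fun n => ?_) hz'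
  exact hgz _

/-- A degenerate differential is incompatible with minimizers depending in a Lipschitz way on their
end points: the map would have, at first order, a right inverse along a direction outside its range.
-/
theorem injective_fderiv_normalExp [CompactSpace M] (hα : IsSimpleClosedGeodesic α l)
    (hn : IsUnitNormal α γ₀) {s : ℝ} (hs : 0 < s) (hsc : s < cutTime (range α) γ₀)
    {ν : ℝ → Plane} {E : ℝ × ℝ → Plane} (h₀ : IsIssuedAlong (α θ₀) α ν γ₀ θ₀)
    (hν : ∀ g : ℕ → ℝ → M, (∀ n, IsUnitNormal α (g n)) → VelocityTendsto g γ₀ 0 →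
        ∃ θ : ℕ → ℝ, Tendsto θ atTop (𝓝 θ₀) ∧
          ∀ᶠ n in atTop, IsIssuedAlong (α θ₀) α ν (g n) (θ n))
    (hE : ContDiffAt ℝ 1 E (θ₀, s))
    (hEq : ∀ᶠ q in 𝓝 (θ₀, s), ∀ γ : ℝ → M, IsIssuedAlong (α θ₀) α ν γ q.1 →
        γ q.2 ∈ (chartAt Plane (γ₀ s)).source ∧ extChartAt (𝓡 2) (γ₀ s) (γ q.2) = E q) :
    Function.Injective (fderiv ℝ E (θ₀, s)) := by
  have hfin : Module.finrank ℝ (ℝ × ℝ) = Module.finrank ℝ Plane := by simp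
  refine (LinearMap.injective_iff_surjective_of_finrank_eq_finrank
    (f := (fderiv ℝ E (θ₀, s)).toLinearMap) hfin).2 ?_
  rw [← LinearMap.range_eq_top]
  by_contra hsurj
  obtain ⟨f, hf, hker⟩ := Submodule.exists_le_ker_of_lt_top _ (lt_top_iff_ne_top.2 hsurj)
  -- The form `f` kills the range of the differential, and `w` points out of it. Along points `φ p +
  -- h w`, the value of `f` grows exactly like `h`.
  obtain ⟨w, hw⟩ : ∃ w, f w = 1 := by
    obtain ⟨v, hv⟩ : ∃ v, f v ≠ 0 := by
      by_contra! h
      exact hf (LinearMap.ext h)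
    exact ⟨(f v)⁻¹ • v, by rw [map_smul, smul_eq_mul, inv_mul_cancel₀ hv]⟩
  set f' : Plane →L[ℝ] ℝ := LinearMap.toContinuousLinearMap f with hf'
  have hf0 : ∀ q, f' (fderiv ℝ E (θ₀, s) q) = 0 := fun q => hker ⟨q, rfl⟩
  have hw' : f' w = 1 := hw
  have hw0 : w ≠ 0 := by
    rintro rfl
    rw [map_zero] at hw
    exact zero_ne_one hw
  clear_value f'
  have hsrc := mem_chart_source Plane (γ₀ s)
  have hsd : infDist (γ₀ s) (range α) = s := (infDist_eq_iff hn.1 hn.mem_range hs.le).2 hsc.le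
  obtain ⟨C, hC⟩ := exists_lipschitz_minimizing hn.1 hn.mem_range hs hsc
  set p := γ₀ s with hp
  set φ := extChartAt (𝓡 2) p with hφ
  -- points approaching `p` in the direction of `w`
  have hh : Tendsto (fun n : ℕ => 1 / ((n : ℝ) + 1)) atTop (𝓝 0) :=
    tendsto_one_div_add_atTop_nhds_zero_nat
  have hu : Tendsto (fun n : ℕ => φ p + (1 / ((n : ℝ) + 1)) • w) atTop (𝓝 (φ p)) := by
    simpa using (hh.smul_const w).const_add (φ p)
  have hy : Tendsto (fun n : ℕ => φ.symm (φ p + (1 / ((n : ℝ) + 1)) • w)) atTop (𝓝 p) := by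
    have := (continuousAt_extChartAt_symm p : ContinuousAt φ.symm (φ p)).tendsto
    rw [extChartAt_to_inv] at this
    exact this.comp hu
  choose g hg hgy using fun n : ℕ =>
    exists_isUnitNormal_minimizing hα (φ.symm (φ p + (1 / ((n : ℝ) + 1)) • w))
  obtain ⟨γ, ψ, hγ, hψ, hlim, hγp⟩ := exists_subseq_minimizing hα hg hy hgy
  rw [hsd] at hγp
  obtain rfl : γ₀ = γ := eq_of_lt_cutTime hn.1 hγ.1 hn.mem_range hγ.mem_range hs hγp.symm hsc
  obtain ⟨θ, hθ, hissued⟩ := hν _ (fun n => hg _) hlim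
  set h : ℕ → ℝ := fun n => 1 / ((ψ n : ℝ) + 1) with hhdef
  have hpos : ∀ n, 0 < h n := fun n => by positivity
  set y : ℕ → M := fun n => φ.symm (φ p + h n • w) with hydef
  have hh := hh.comp hψ.tendsto_atTop
  have hu := hu.comp hψ.tendsto_atTop
  have hy := hy.comp hψ.tendsto_atTop
  have hg : ∀ n, IsUnitNormal α (g (ψ n)) := fun n => hg _
  have hgy : ∀ n, g (ψ n) (infDist (y n) (range α)) = y n := fun n => hgy _
  set d : ℕ → ℝ := fun n => infDist (y n) (range α) with hddef
  have hd : Tendsto d atTop (𝓝 s) := by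
    have := ((continuous_infDist_pt (range α)).tendsto p).comp hy
    rwa [hsd] at this
  change Tendsto h atTop (𝓝 0) at hh
  change Tendsto (fun n => φ p + h n • w) atTop (𝓝 (φ p)) at hu
  change Tendsto y atTop (𝓝 p) at hy
  have hφy : ∀ᶠ n in atTop, φ (y n) = φ p + h n • w := by
    have h1 : ∀ᶠ u in 𝓝 (φ p), u ∈ φ.target := extChartAt_target_mem_nhds p
    filter_upwards [hu.eventually h1] with n hn1
    exact φ.right_inv hn1
  clear_value h y
  have hφO : (fun n => φ (y n) - φ p) =O[atTop] h := by
    refine IsBigO.of_bound ‖w‖ ?_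
    filter_upwards [hφy] with n hn1
    rw [hn1, add_sub_cancel_left, norm_smul, mul_comm]
  have hLip : ∀ᶠ n in atTop, |d n - s| ≤ C * ‖φ (y n) - φ p‖ ∧
      ‖(tangentCoord p (velocity (g (ψ n)) (d n))).2 - (tangentCoord p (velocity γ₀ s)).2‖ ≤
        C * ‖φ (y n) - φ p‖ := by
    filter_upwards [hy.eventually hC, hφy] with n hn1 hn2
    refine hn1 ?_ _ (hg n).1 (hg n).mem_range (hgy n)
    intro h0
    rw [h0, left_eq_add, smul_eq_zero] at hn2
    exact hn2.elim (hpos n).ne' hw0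
  have hdO : (fun n => d n - s) =O[atTop] h :=
    (IsBigO.of_bound C (hLip.mono fun n hn1 => hn1.1)).trans hφO
  have hXO : (fun n => (tangentCoord p (velocity (g (ψ n)) (d n))).2 -
      (tangentCoord p (velocity γ₀ s)).2) =O[atTop] h :=
    (IsBigO.of_bound C (hLip.mono fun n hn1 => hn1.2)).trans hφO
  -- the geodesics, followed backwards
  have hv : tangentCoord p (velocity (fun t => γ₀ (s * t)) 1) =
      (φ p, s • (tangentCoord p (velocity γ₀ s)).2) := by
    rw [tangentCoord_velocity_comp_mul hn.1.1, mul_one]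
  -- Run backwards over unit time, one differentiable map recovers the foot point from the end point
  -- and the velocity scaled by the length. Hence the foot points, and then their parameters, are
  -- `O(h)` close.
  obtain ⟨Ψ, hΨc, -, hΨ⟩ := (hn.1.1.comp_mul s).transports (x₀ := p) (x₁ := α θ₀) (a := 1)
    (b := 0) (by simp [hp]) (by simp [h₀.start])
  rw [hv] at hΨc hΨ
  set Y : ℕ → Plane × Plane := fun n =>
    (φ (y n), d n • (tangentCoord p (velocity (g (ψ n)) (d n))).2) with hY
  have hYO : (fun n => Y n - (φ p, s • (tangentCoord p (velocity γ₀ s)).2)) =O[atTop] h := by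
    have h1 := (hd.isBigO_one ℝ).smul hXO
    have h2 := hdO.smul (isBigO_const_const (tangentCoord p (velocity γ₀ s)).2
      (one_ne_zero : (1 : ℝ) ≠ 0) atTop)
    simp only [smul_eq_mul, one_mul, mul_one] at h1 h2
    refine hφO.prod_left ((h1.add h2).congr_left fun n => ?_)
    rw [smul_sub, sub_smul]
    abel
  have hY0 : Tendsto Y atTop (𝓝 (φ p, s • (tangentCoord p (velocity γ₀ s)).2)) := by
    rw [← tendsto_sub_nhds_zero_iff]
    exact hYO.trans_tendsto hh
  have hback : ∀ᶠ n in atTop, extChartAt (𝓡 2) (α θ₀) (α (θ n)) = (Ψ (Y n)).1 := by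
    filter_upwards [hY0.eventually hΨ, hissued,
      hy.eventually ((chartAt Plane p).open_source.mem_nhds hsrc)] with n hn1 hn2 hn3
    have h1 := (hn1 _ ((hg n).1.1.comp_mul (d n)) (by
      simp only [mul_one]
      rwa [hgy n]) (by rw [tangentCoord_velocity_comp_mul (hg n).1.1, mul_one, hgy n])).2
    rw [← h1, tangentCoord_velocity_fst, mul_zero, hn2.start]
  have hback0 : extChartAt (𝓡 2) (α θ₀) (α θ₀) =
      (Ψ (φ p, s • (tangentCoord p (velocity γ₀ s)).2)).1 := by
    have h1 := (hΨ.self_of_nhds _ (hn.1.1.comp_mul s) (by simp [hp]) hv).2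
    rw [← h1, tangentCoord_velocity_fst, mul_zero, h₀.start]
  have hαO : (fun n => extChartAt (𝓡 2) (α θ₀) (α (θ n)) - extChartAt (𝓡 2) (α θ₀) (α θ₀))
      =O[atTop] h := by
    have h1 := (((hΨc.fst.differentiableAt (by simp)).hasFDerivAt.isBigO_sub).comp_tendsto hY0).trans
      hYO
    refine h1.congr' ?_ EventuallyEq.rfl
    filter_upwards [hback] with n hn1
    rw [hn1, hback0]
    rfl
  have hθO : (fun n => θ n - θ₀) =O[atTop] h := by
    have hsrcα := mem_chart_source Plane (α θ₀)
    have h1 := (hα.geodesic.hasDerivAt_tangentCoord (x₀ := α θ₀) (t := θ₀) hsrcα).1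
    have h2 : (tangentCoord (α θ₀) (velocity α θ₀)).2 ≠ 0 := by
      intro h0
      have := hα.metricForm_velocity_ne_zero hsrcα
      rw [h0, map_zero] at this
      exact this rfl
    have h3 : Tendsto (fun n => (θ n, θ₀)) atTop (𝓝 θ₀ ×ˢ pure θ₀) :=
      hθ.prodMk tendsto_const_pure
    -- As `α` has nonzero velocity at `θ₀`, its parameter is controlled by its position.
    exact ((h1.isTheta_sub h2).2.comp_tendsto h3).trans hαO
  have hqO : (fun n => (θ n, d n) - (θ₀, s)) =O[atTop] h := hθO.prod_left hdO
  have hq : Tendsto (fun n => (θ n, d n)) atTop (𝓝 (θ₀, s)) := hθ.prodMk_nhds hd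
  have hlit := (((hE.differentiableAt (by simp)).hasFDerivAt.isLittleO).comp_tendsto hq).trans_isBigO
    hqO
  have hlit' := (f'.isBigO_comp _ _).trans_isLittleO hlit
  have hE₀ : E (θ₀, s) = φ p := (hEq.self_of_nhds γ₀ h₀).2.symm
  refine isLittleO_irrefl (Eventually.of_forall fun n => (hpos n).ne').frequently
    (hlit'.congr' ?_ EventuallyEq.rfl : h =o[atTop] h)
  filter_upwards [hq.eventually hEq, hissued, hφy] with n hn1 hn2 hn3
  have h1 := (hn1 _ hn2).2
  change φ (g (ψ n) (d n)) = _ at h1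
  rw [hgy n, hn3] at h1
  change f' (E (θ n, d n) - E (θ₀, s) - fderiv ℝ E (θ₀, s) ((θ n, d n) - (θ₀, s))) = h n
  rw [map_sub, hf0, sub_zero, ← h1, hE₀, add_sub_cancel_left, map_smul, hw', smul_eq_mul, mul_one]

end FocalPoints

/-! ### Continuity and positivity of the cut time. -/

section CutTimeContinuity

variable {M : Type*} [MetricSpace M] [ChartedSpace Plane M] [IsManifold (𝓡 2) ∞ M]
  [RiemannianBundle (fun x : M => TangentSpace (𝓡 2) x)]
  [IsContMDiffRiemannianBundle (𝓡 2) ∞ Plane (fun x : M => TangentSpace (𝓡 2) x)]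

open Metric Asymptotics

variable [IsRiemannianManifold (𝓡 2) M] {α γ₀ : ℝ → M} {l θ₀ : ℝ}

theorem VelocityTendsto.comp_tendsto {g : ℕ → ℝ → M} {γ : ℝ → M} {a : ℝ} {φ : ℕ → ℕ}
    (h : VelocityTendsto g γ a) (hφ : Tendsto φ atTop atTop) :
    VelocityTendsto (fun n => g (φ n)) γ a :=
  fun x₀ hx₀ => ⟨hφ.eventually (h x₀ hx₀).1, (h x₀ hx₀).2.comp hφ⟩

theorem VelocityTendsto.comp_neg {g : ℕ → ℝ → M} {γ : ℝ → M}
    (h : VelocityTendsto g γ 0) (hg : ∀ n, IsGeodesic (g n)) (hγ : IsGeodesic γ) :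
    VelocityTendsto (fun n t => g n (-t)) (fun t => γ (-t)) 0 := by
  intro x₀ hx₀
  obtain ⟨h1, h2⟩ := h x₀ (by simpa using hx₀)
  refine ⟨by simpa using h1, ?_⟩
  simp only [tangentCoord_velocity_comp_neg (hg _), tangentCoord_velocity_comp_neg hγ, neg_zero]
  exact ((continuous_fst.tendsto _).comp h2).prodMk_nhds ((continuous_snd.tendsto _).comp h2).neg

theorem IsUnitNormal.comp_neg {γ : ℝ → M} (h : IsUnitNormal α γ) :
    IsUnitNormal α fun t => γ (-t) := by
  obtain ⟨hγ, θ, hθ, horth⟩ := h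
  refine ⟨hγ.comp_neg, θ, by simpa using hθ, fun x₀ hx₀ => ?_⟩
  rw [tangentCoord_velocity_comp_neg hγ.1, map_neg, neg_zero, horth x₀ hx₀, neg_zero]

/-- There are only two unit speed geodesics issued orthogonally from a point of `α`. -/
theorem IsUnitNormal.eq_or_eq_comp_neg (hα : IsSimpleClosedGeodesic α l) {γ γ' : ℝ → M}
    (h : IsUnitNormal α γ) (h' : IsUnitNormal α γ') (h0 : γ' 0 = γ 0) :
    γ' = γ ∨ γ' = fun t => γ (-t) := by
  obtain ⟨θ, hθ⟩ := h.mem_range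
  have hsrc := mem_chart_source Plane (α θ)
  have key : ∀ γ : ℝ → M, IsUnitNormal α γ → γ 0 = α θ →
      (tangentCoord (α θ) (velocity γ 0)).2 = unitNormalCoord (α θ) α θ ∨
      (tangentCoord (α θ) (velocity γ 0)).2 = -unitNormalCoord (α θ) α θ := by
    intro γ hγ hγθ
    refine eq_unitNormalCoord_or_neg hα hsrc (hγ.orthogonal hα hγθ hsrc) ?_
    have := hγ.1.metricForm_eq_one (x₀ := α θ) (t := 0) (by rwa [hγθ])
    rwa [tangentCoord_velocity_fst, hγθ] at this
  have heq : ∀ γ : ℝ → M, IsUnitNormal α γ → γ 0 = α θ →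
      (tangentCoord (α θ) (velocity γ' 0)).2 = (tangentCoord (α θ) (velocity γ 0)).2 → γ' = γ := by
    intro γ hγ hγ0 hv
    refine h'.1.1.eq_of_velocity_eq hγ.1.1 (t := 0) (tangentCoord_injOn (α θ)
      (v := velocity γ' 0) (w := velocity γ 0) ?_ ?_ (Prod.ext ?_ hv))
    · change γ' 0 ∈ _
      rwa [h0, ← hθ]
    · change γ 0 ∈ _
      rwa [hγ0]
    · rw [tangentCoord_velocity_fst, tangentCoord_velocity_fst, h0, ← hθ, hγ0]
  have hneg := tangentCoord_velocity_comp_neg h.1.1 (α θ) 0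
  rw [neg_zero] at hneg
  have hneg0 : (fun t => γ (-t)) 0 = α θ := by simp [hθ]
  rcases key γ h hθ.symm with h1 | h1 <;> rcases key γ' h' (h0.trans hθ.symm) with h2 | h2
  · exact Or.inl (heq γ h hθ.symm (h2.trans h1.symm))
  · exact Or.inr (heq _ h.comp_neg hneg0 (by rw [h2, hneg, h1]))
  · exact Or.inr (heq _ h.comp_neg hneg0 (by rw [h2, hneg, h1, neg_neg]))
  · exact Or.inl (heq γ h hθ.symm (h2.trans h1.symm))

variable [CompactSpace M]

/-- Local injectivity of the normal exponential map, before the cut point. -/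
theorem eventually_eq_of_velocityTendsto (hα : IsSimpleClosedGeodesic α l) (hn : IsUnitNormal α γ₀)
    {s : ℝ} (hs : s = 0 ∨ 0 < s ∧ s < cutTime (range α) γ₀) {g g' : ℕ → ℝ → M}
    (hg : ∀ n, IsUnitNormal α (g n)) (hg' : ∀ n, IsUnitNormal α (g' n))
    (hlim : VelocityTendsto g γ₀ 0) (hlim' : VelocityTendsto g' γ₀ 0) {t t' : ℕ → ℝ}
    (ht : Tendsto t atTop (𝓝 s)) (ht' : Tendsto t' atTop (𝓝 s))
    (heq : ∀ n, g n (t n) = g' n (t' n)) : ∀ᶠ n in atTop, t n = t' n := by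
  obtain ⟨θ₀, hθ₀⟩ := hn.mem_range
  obtain ⟨ν, hν, h₀, hνlim⟩ := exists_normalField hα hn hθ₀.symm
  obtain ⟨E, hE, hEq, hE0⟩ := exists_normalExp hα hν h₀ s
  have hinj : Function.Injective (fderiv ℝ E (θ₀, s)) := by
    rcases hs with rfl | hs
    · exact injective_fderiv_normalExp_zero hα hn h₀ hE hEq (hE0 rfl)
    · exact injective_fderiv_normalExp hα hn hs.1 hs.2 h₀ hνlim hE hEq
  have hemb : IsClosedEmbedding (fderiv ℝ E (θ₀, s)) :=
    LinearMap.isClosedEmbedding_of_injective (f := (fderiv ℝ E (θ₀, s)).toLinearMap)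
      (LinearMap.ker_eq_bot.2 hinj)
  obtain ⟨θ, hθ, hiss⟩ := hνlim g hg hlim
  obtain ⟨θ', hθ', hiss'⟩ := hνlim g' hg' hlim'
  have hq := hθ.prodMk_nhds ht
  have hq' := hθ'.prodMk_nhds ht'
  -- Strict differentiability with injective differential bounds parameter differences by
  -- differences of values near the base point; equal values give equal parameters.
  have hO := ((hE.hasStrictFDerivAt (by simp)).isTheta_sub hemb.isInducing).2.comp_tendsto
    (hq.prodMk_nhds hq')
  obtain ⟨C, hC⟩ := hO.bound
  filter_upwards [hC, hiss, hiss', hq.eventually hEq, hq'.eventually hEq] with n h1 h2 h3 h4 h5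
  have h6 : E (θ n, t n) = E (θ' n, t' n) := by
    rw [← (h4 _ h2).2, ← (h5 _ h3).2, heq n]
  simp only [Function.comp_apply, h6, sub_self, norm_zero, mul_zero, norm_le_zero_iff,
    sub_eq_zero] at h1
  exact congrArg Prod.snd h1

theorem infDist_eq_self (hn : IsUnitNormal α γ₀) {s : ℝ}
    (hs : s = 0 ∨ 0 < s ∧ s < cutTime (range α) γ₀) : infDist (γ₀ s) (range α) = s := by
  rcases hs with rfl | hs
  · exact infDist_zero_of_mem hn.mem_range
  · exact (infDist_eq_iff hn.1 hn.mem_range hs.1.le).2 hs.2.le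

/-- If `g n` failed to minimize at `t n`, a minimizer to the same point would reach it strictly
earlier. In the limit both sequences follow `γ₀`, or for `s = 0` possibly its reverse, against local
injectivity. -/
theorem eventually_le_cutTime (hα : IsSimpleClosedGeodesic α l) (hn : IsUnitNormal α γ₀)
    {s : ℝ} (hs : s = 0 ∨ 0 < s ∧ s < cutTime (range α) γ₀) {g : ℕ → ℝ → M}
    (hg : ∀ n, IsUnitNormal α (g n)) (hlim : VelocityTendsto g γ₀ 0) {t : ℕ → ℝ}
    (ht : Tendsto t atTop (𝓝 s)) (htpos : ∀ n, 0 < t n) :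
    ∀ᶠ n in atTop, t n ≤ cutTime (range α) (g n) := by
  by_contra hcon
  rw [not_eventually] at hcon
  obtain ⟨φ, hφ, hcut⟩ := extraction_of_frequently_atTop hcon
  have hsd := infDist_eq_self hn hs
  have hlimb := (hlim.comp_tendsto hφ.tendsto_atTop).of_time hn.1.1 (fun n => (hg _).1.1) s
  have hz := hlimb.tendsto_comp (fun n => (hg _).1) (ht.comp hφ.tendsto_atTop)
  have hd : ∀ n, infDist (g (φ n) (t (φ n))) (range α) < t (φ n) := by
    intro n
    refine lt_of_le_of_ne ((hg _).1.infDist_le (hg _).mem_range (htpos _).le) fun h => hcut n ?_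
    exact (infDist_eq_iff (hg _).1 (hg _).mem_range (htpos _).le).1 h
  choose g' hg' hgz using fun n => exists_isUnitNormal_minimizing hα (g (φ n) (t (φ n)))
  obtain ⟨γ', ψ, hγ', hψ, hlim', hγs⟩ := exists_subseq_minimizing hα hg' hz hgz
  rw [hsd] at hγs
  have hφψ := hφ.tendsto_atTop.comp hψ.tendsto_atTop
  have hd0 : Tendsto (fun n => infDist (g (φ (ψ n)) (t (φ (ψ n)))) (range α)) atTop (𝓝 s) := by
    have := ((continuous_infDist_pt (range α)).tendsto _).comp (hz.comp hψ.tendsto_atTop)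
    rwa [hsd] at this
  have hsame : γ' = γ₀ → False := by
    rintro rfl
    obtain ⟨n, hn1⟩ := (eventually_eq_of_velocityTendsto hα hn hs (fun n => hg _) (fun n => hg' _)
      (hlim.comp_tendsto hφψ) hlim' (ht.comp hφψ) hd0 fun n => (hgz (ψ n)).symm).exists
    exact (hd (ψ n)).ne' hn1
  rcases id hs with h0 | hs'
  · rw [h0] at hγs
    -- At `s = 0` the limit only shares its starting point with `γ₀`. If it is the opposite normal,
    -- reversing the minimizers makes their times nonpositive, so they cannot equal `t n > 0`.
    rcases hn.eq_or_eq_comp_neg hα hγ' hγs with h | h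
    · exact hsame h
    · have hlim'' := hlim'.comp_neg (fun n => (hg' _).1.1) hγ'.1.1
      rw [h] at hlim''
      simp only [neg_neg] at hlim''
      have hd0' : Tendsto (fun n => -infDist (g (φ (ψ n)) (t (φ (ψ n)))) (range α)) atTop
          (𝓝 s) := by
        have := hd0.neg
        rwa [h0, neg_zero, ← h0] at this
      obtain ⟨n, hn1⟩ := (eventually_eq_of_velocityTendsto hα hn hs (fun n => hg _)
        (fun n => (hg' _).comp_neg) (hlim.comp_tendsto hφψ) hlim'' (ht.comp hφψ) hd0' fun n => by
          simp only [neg_neg]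
          exact (hgz (ψ n)).symm).exists
      have h1 := htpos (φ (ψ n))
      have h2 : t (φ (ψ n)) = -infDist (g (φ (ψ n)) (t (φ (ψ n)))) (range α) := hn1
      have h3 := infDist_nonneg (x := g (φ (ψ n)) (t (φ (ψ n)))) (s := range α)
      linarith
  · exact hsame (eq_of_lt_cutTime hn.1 hγ'.1 hn.mem_range hγ'.mem_range hs'.1 hγs.symm hs'.2).symm

/-- The constant sequence `γ₀` with positive times tending to `0`. -/
theorem cutTime_pos (hα : IsSimpleClosedGeodesic α l) (hn : IsUnitNormal α γ₀) :
    0 < cutTime (range α) γ₀ := by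
  have hlim : VelocityTendsto (fun _ => γ₀) γ₀ 0 :=
    fun x₀ hx₀ => ⟨Eventually.of_forall fun _ => hx₀, tendsto_const_nhds⟩
  obtain ⟨n, hn1⟩ := (eventually_le_cutTime hα hn (Or.inl rfl) (fun _ => hn) hlim
    tendsto_one_div_add_atTop_nhds_zero_nat fun n => by positivity).exists
  exact lt_of_lt_of_le (by positivity) hn1

/-- From below, any time before the limit cut time is eventually realized. From above, a time
realized infinitely often is realized by the limit. -/
theorem tendsto_cutTime (hα : IsSimpleClosedGeodesic α l) (hn : IsUnitNormal α γ₀)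
    {g : ℕ → ℝ → M} (hg : ∀ n, IsUnitNormal α (g n)) (hlim : VelocityTendsto g γ₀ 0) :
    Tendsto (fun n => cutTime (range α) (g n)) atTop (𝓝 (cutTime (range α) γ₀)) := by
  have hpos := cutTime_pos hα hn
  refine tendsto_order.2 ⟨fun a ha => ?_, fun a ha => ?_⟩
  · obtain ⟨s, hs, hsc⟩ := exists_between (max_lt ha hpos)
    rw [max_lt_iff] at hs
    filter_upwards [eventually_le_cutTime hα hn (Or.inr ⟨hs.2, hsc⟩) hg hlim tendsto_const_nhds
      fun _ => hs.2] with n h1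
    exact hs.1.trans_le h1
  · by_contra hcon
    rw [not_eventually] at hcon
    obtain ⟨φ, hφ, hcut⟩ := extraction_of_frequently_atTop hcon
    have ha0 := hpos.trans ha
    have h1 : ∀ n, infDist (g (φ n) a) (range α) = a := fun n =>
      (infDist_eq_iff (hg _).1 (hg _).mem_range ha0.le).2 (not_lt.1 (hcut n))
    have hlimb := ((hlim.comp_tendsto hφ.tendsto_atTop).of_time hn.1.1 (fun n => (hg _).1.1) a)
    have h2 := ((continuous_infDist_pt (range α)).tendsto _).comp hlimb.tendsto
    have h3 := tendsto_nhds_unique (h2.congr h1) tendsto_const_nhds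
    exact not_le.2 ha ((infDist_eq_iff hn.1 hn.mem_range ha0.le).1 h3)

end CutTimeContinuity

/-! ### Sliding to the cut locus. -/

section Retraction

variable {M : Type*} [MetricSpace M] [ChartedSpace Plane M] [IsManifold (𝓡 2) ∞ M]
  [RiemannianBundle (fun x : M => TangentSpace (𝓡 2) x)]
  [IsContMDiffRiemannianBundle (𝓡 2) ∞ Plane (fun x : M => TangentSpace (𝓡 2) x)]

open Metric

variable [IsRiemannianManifold (𝓡 2) M] [CompactSpace M] {α : ℝ → M} {l : ℝ}
  (hα : IsSimpleClosedGeodesic α l)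

include hα

theorem infDist_pos_of_notMem {x : M} (hx : x ∉ range α) : 0 < infDist x (range α) :=
  ((range_isCompact hα).isClosed.notMem_iff_infDist_pos (range_nonempty α)).1 hx

theorem cutLocus_subset : cutLocus α ⊆ (range α)ᶜ := by
  intro q hq hqα
  obtain ⟨γ, hγ, rfl⟩ := mem_cutLocus_iff.1 hq
  have h1 := (cutTime_mem hγ.1 hγ.mem_range).2
  rw [infDist_zero_of_mem hqα] at h1
  exact (cutTime_pos hα hγ).ne h1

/-- A geodesic issued orthogonally from `α` that minimizes the distance from `α` to `x`. -/
noncomputable def minimizer (x : M) : ℝ → M := (exists_isUnitNormal_minimizing hα x).choose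

theorem isUnitNormal_minimizer (x : M) : IsUnitNormal α (minimizer hα x) :=
  (exists_isUnitNormal_minimizing hα x).choose_spec.1

theorem minimizer_infDist (x : M) : minimizer hα x (infDist x (range α)) = x :=
  (exists_isUnitNormal_minimizing hα x).choose_spec.2

theorem infDist_le_cutTime {γ : ℝ → M} (hγ : IsUnitNormal α γ) {x : M}
    (hx : γ (infDist x (range α)) = x) : infDist x (range α) ≤ cutTime (range α) γ :=
  (infDist_eq_iff hγ.1 hγ.mem_range infDist_nonneg).1 (by rw [hx])

/-- A cut point is a priori the cut point of some other geodesic; if `γ` minimized beyond it,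
uniqueness would identify the two. -/
theorem mem_cutLocus_iff_of_minimizing {γ : ℝ → M} (hγ : IsUnitNormal α γ) {x : M}
    (hx : γ (infDist x (range α)) = x) :
    x ∈ cutLocus α ↔ cutTime (range α) γ = infDist x (range α) := by
  constructor
  · intro hmem
    obtain ⟨γ', hγ', hxγ'⟩ := mem_cutLocus_iff.1 hmem
    have hd : infDist x (range α) = cutTime (range α) γ' := by
      rw [hxγ', (cutTime_mem hγ'.1 hγ'.mem_range).2]
    refine le_antisymm (le_of_not_gt fun hlt => ?_) (infDist_le_cutTime hα hγ hx)
    have hpos := infDist_pos_of_notMem hα (cutLocus_subset hα hmem)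
    have heq := eq_of_lt_cutTime hγ.1 hγ'.1 hγ.mem_range hγ'.mem_range hpos
      (by rw [hx, hd, ← hxγ']) hlt
    rw [heq, ← hd] at hlt
    exact lt_irrefl _ hlt
  · intro h
    exact mem_cutLocus_iff.2 ⟨γ, hγ, by rw [h, hx]⟩

/-- The point at time `t` of the motion that slides `x` along a minimizing geodesic to its cut
point. -/
noncomputable def slide (t : ℝ) (x : M) : M :=
  minimizer hα x ((1 - t) * infDist x (range α) + t * cutTime (range α) (minimizer hα x))

theorem slide_zero (x : M) : slide hα 0 x = x := by
  rw [slide, sub_zero, one_mul, zero_mul, add_zero, minimizer_infDist]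

theorem slide_one_mem (x : M) : slide hα 1 x ∈ cutLocus α := by
  rw [slide, sub_self, zero_mul, one_mul, zero_add]
  exact mem_cutLocus_iff.2 ⟨_, isUnitNormal_minimizer hα x, rfl⟩

/-- Independence of the choice: off the cut locus the minimizer is unique, and on it every choice
gives the constant motion. -/
theorem slide_eq_of_minimizing {γ : ℝ → M} (hγ : IsUnitNormal α γ) {x : M} (hxα : x ∉ range α)
    (hx : γ (infDist x (range α)) = x) (t : ℝ) :
    slide hα t x = γ ((1 - t) * infDist x (range α) + t * cutTime (range α) γ) := by
  have hm := isUnitNormal_minimizer hα x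
  have hmx := minimizer_infDist hα x
  rw [slide]
  by_cases hc : x ∈ cutLocus α
  · rw [(mem_cutLocus_iff_of_minimizing hα hγ hx).1 hc,
      (mem_cutLocus_iff_of_minimizing hα hm hmx).1 hc, ← add_mul, sub_add_cancel, one_mul, hx, hmx]
  · have hlt : infDist x (range α) < cutTime (range α) γ :=
      lt_of_le_of_ne (infDist_le_cutTime hα hγ hx) fun h =>
        hc ((mem_cutLocus_iff_of_minimizing hα hγ hx).2 h.symm)
    rw [eq_of_lt_cutTime hγ.1 hm.1 hγ.mem_range hm.mem_range (infDist_pos_of_notMem hα hxα)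
      (by rw [hx, hmx]) hlt]

theorem slide_of_mem_cutLocus {x : M} (hx : x ∈ cutLocus α) (t : ℝ) : slide hα t x = x := by
  have hmx := minimizer_infDist hα x
  rw [slide, (mem_cutLocus_iff_of_minimizing hα (isUnitNormal_minimizer hα x) hmx).1 hx,
    ← add_mul, sub_add_cancel, one_mul, hmx]

/-- The parameter stays between `d(x, α)` and the cut time, where the distance to `α` equals the
parameter and is positive. -/
theorem slide_notMem {x : M} (hx : x ∉ range α) {t : ℝ} (ht : t ∈ Icc (0 : ℝ) 1) :
    slide hα t x ∉ range α := by
  intro hmem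
  have hm := isUnitNormal_minimizer hα x
  have hpos := infDist_pos_of_notMem hα hx
  have hle := infDist_le_cutTime hα hm (minimizer_infDist hα x)
  set d := infDist x (range α)
  set c := cutTime (range α) (minimizer hα x) with hc
  have h1 : d ≤ (1 - t) * d + t * c := by nlinarith [ht.1]
  have h2 : (1 - t) * d + t * c ≤ c := by nlinarith [ht.2]
  have h3 := (infDist_eq_iff hm.1 hm.mem_range (hpos.le.trans h1)).2 h2
  rw [slide] at hmem
  rw [infDist_zero_of_mem hmem] at h3
  linarith

/-- Chosen minimizers subconverge to some minimizer of `x₀`, not necessarily the chosen one;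
`slide_eq_of_minimizing` makes this harmless. -/
theorem tendsto_slide {t : ℕ → ℝ} {t₀ : ℝ} {x : ℕ → M} {x₀ : M} (hx₀ : x₀ ∉ range α)
    (ht : Tendsto t atTop (𝓝 t₀)) (hx : Tendsto x atTop (𝓝 x₀)) :
    Tendsto (fun n => slide hα (t n) (x n)) atTop (𝓝 (slide hα t₀ x₀)) := by
  refine tendsto_of_subseq_tendsto fun φ hφ => ?_
  have hxφ := hx.comp hφ
  obtain ⟨γ, ψ, hγ, hψ, hlim, hγx⟩ := exists_subseq_minimizing hα
    (g := fun n => minimizer hα (x (φ n))) (fun n => isUnitNormal_minimizer hα _) hxφ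
    fun n => minimizer_infDist hα _
  refine ⟨ψ, ?_⟩
  have hg : ∀ n, IsUnitNormal α (minimizer hα (x (φ (ψ n)))) :=
    fun n => isUnitNormal_minimizer hα _
  have hc := tendsto_cutTime hα hγ hg hlim
  have hd := ((continuous_infDist_pt (range α)).tendsto x₀).comp (hxφ.comp hψ.tendsto_atTop)
  have htφ := ht.comp (hφ.comp hψ.tendsto_atTop)
  have hpar := ((tendsto_const_nhds (x := (1 : ℝ)).sub htφ).mul hd).add (htφ.mul hc)
  rw [slide_eq_of_minimizing hα hγ hx₀ hγx]
  exact (hlim.of_time hγ.1.1 (fun n => (hg n).1.1) _).tendsto_comp (fun n => (hg n).1) hpar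

theorem continuous_slide :
    Continuous fun q : I × ↥(range α)ᶜ => slide hα (q.1 : ℝ) (q.2 : M) := by
  refine continuous_iff_seqContinuous.2 fun q q₀ hq => ?_
  exact tendsto_slide hα q₀.2.2
    ((continuous_subtype_val.comp continuous_fst).tendsto q₀ |>.comp hq)
    ((continuous_subtype_val.comp continuous_snd).tendsto q₀ |>.comp hq)

end Retraction

end SurfaceTheory

/-! ### The deformation retraction. -/

theorem mainTheorem7 {M : Type*} [MetricSpace M] [CompactSpace M] [ConnectedSpace M]
    [ChartedSpace Plane M] [IsManifold (𝓡 2) ∞ M]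
    [RiemannianBundle (fun x : M => TangentSpace (𝓡 2) x)]
    [IsContMDiffRiemannianBundle (𝓡 2) ∞ Plane (fun x : M => TangentSpace (𝓡 2) x)]
    [IsRiemannianManifold (𝓡 2) M]
    (α : ℝ → M) (l : ℝ) (hα : IsSimpleClosedGeodesic α l) :
    cutLocus α ⊆ (range α)ᶜ ∧
    ∃ (ρ : C(↥(range α)ᶜ, ↥(range α)ᶜ))
      (F : (ContinuousMap.id ↥(range α)ᶜ).HomotopyRel ρ (Subtype.val ⁻¹' cutLocus α)),
      (∀ x, (ρ x : M) ∈ cutLocus α) ∧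
      ∀ x : ↥(range α)ᶜ, (x : M) ∉ cutLocus α →
        ∃ (γ : ℝ → M) (c : ℝ),
          IsMinimizingFromTo (range α) γ x ∧
          (∀ γ' : ℝ → M, IsMinimizingFromTo (range α) γ' x → γ' = γ) ∧
          IssuesOrthogonally α γ ∧
          IsCutTime (range α) γ c ∧
          Metric.infDist (x : M) (range α) < c ∧
          ∀ t : I, (F (t, x) : M) =
            γ ((1 - (t : ℝ)) * Metric.infDist (x : M) (range α) + (t : ℝ) * c) := by
  refine ⟨cutLocus_subset hα, ?_⟩
  have hcont := continuous_slide hα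
  set S : C(I × ↥(range α)ᶜ, ↥(range α)ᶜ) :=
    ⟨fun q => ⟨slide hα (q.1 : ℝ) (q.2 : M), slide_notMem hα q.2.2 q.1.2⟩,
      hcont.subtype_mk _⟩ with hS
  set ρ : C(↥(range α)ᶜ, ↥(range α)ᶜ) := S.comp ⟨fun x => (1, x), by fun_prop⟩ with hρ
  have hρ1 : ∀ x, (ρ x : M) = slide hα 1 x := fun x => rfl
  refine ⟨ρ, ⟨⟨S, fun x => ?_, fun x => rfl⟩, fun t x hx => ?_⟩, fun x => ?_, fun x hx => ?_⟩
  · exact Subtype.ext (slide_zero hα (x : M))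
  · exact Subtype.ext (slide_of_mem_cutLocus hα hx t)
  · rw [hρ1]
    exact slide_one_mem hα (x : M)
  · have hm := isUnitNormal_minimizer hα (x : M)
    have hmx := minimizer_infDist hα (x : M)
    have hlt : Metric.infDist (x : M) (range α) < cutTime (range α) (minimizer hα (x : M)) :=
      lt_of_le_of_ne (infDist_le_cutTime hα hm hmx) fun h =>
        hx ((mem_cutLocus_iff_of_minimizing hα hm hmx).2 h.symm)
    refine ⟨minimizer hα x, cutTime (range α) (minimizer hα x),
      isMinimizingFromTo_iff.2 ⟨hm.1, hm.mem_range, hmx⟩, fun γ' hγ' => ?_, hm.issuesOrthogonally,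
      (isCutTime_iff hm.1 hm.mem_range).2 rfl, hlt, fun t => rfl⟩
    obtain ⟨h1, h2, h3⟩ := isMinimizingFromTo_iff.1 hγ'
    exact (eq_of_lt_cutTime hm.1 h1 hm.mem_range h2 (infDist_pos_of_notMem hα x.2)
      (hmx.trans h3.symm) hlt).symm
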